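/- **Setting.** Consider the underactuated vessel model at the pivot point $$\dot x=u_r\cos\psi-v_r\sin\psi+V_x,\quad \dot y=u_r\sin\psi+v_r\cos\psi+V_y,\quad \dot\psi=r,$$ $$\dot u_r=F_u(v_r,r)-\tfrac{d_{11}}{m_{11}}u_r+\tau_u,\quad \dot v_r=X(u_r)r+Y(u_r)v_r,\quad \dot r=F_r(u_r,v_r,r)+\tau_r,$$ where $D_M=m_{22}m_{33}-m_{23}^2$, $F_u=\frac1{m_{11}}(m_{22}v_r+m_{23}r)r$, $X(u)=\frac{m_{23}^2-m_{11}m_{33}}{D_M}u+\frac{d_{33}m_{23}-d_{23}m_{33}}{D_M}$, $Y(u)=\frac{(m_{22}-m_{11})m_{23}}{D_M}u-\frac{d_{22}m_{33}-d_{32}m_{23}}{D_M}$, and $F_r=\frac{m_{23}d_{22}-m_{22}(d_{32}+(m_{22}-m_{11})u_r)}{D_M}v_r+\frac{m_{23}(d_{23}+m_{11}u_r)-m_{22}(d_{33}+m_{23}u_r)}{D_M}r$. The mass matrix is positive definite ($m_{11},m_{22},D_M>0$), $d_{11}\ge0$, and the current $(V_x,V_y)$ is constant with norm at most $V_{\max}$,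 $V_{\max}>0$. Let $P(\theta)=(x_p(\theta),y_p(\theta))$, $\theta\in\mathbb R$, be a smooth path parametrised by arc length with tangent angle $\gamma(\theta)$ and curvature $\kappa=\gamma'$, where $\kappa$ and $\kappa'$ are bounded. Let $(x_{b/p},y_{b/p})$ be the components of $(x-x_p(\theta),y-y_p(\theta))$ in the path-tangential frame (tangent $(\cos\gamma,\sin\gamma)$, normal $(-\sin\gamma,\cos\gamma)$). The desired surge velocity $u_{rd}$ is $C^2$; on $t\ge0$ it and its first two derivatives are bounded, and $u_{rd}(t)>2V_{\max}$. *Observer* (all gains positive), with $\tilde x=x-\hat x$, $\tilde y=y-\hat y$, $\tilde V_x=V_x-\hat V_x$, $\tilde V_y=V_y-\hat V_y$: $\dot{\hat x}=u_r\cos\psi-v_r\sin\psi+\hat V_x+k_{x_1}\tilde x$, $\dot{\hat y}=u_r\sin\psi+v_r\cos\psi+\hat V_y+k_{y_1}\tilde y$, $\dot{\hat V}_x=k_{x_2}\tilde x$, $\dot{\hat V}_y=k_{y_2}\tilde y$. Put $\hat V_T=\hat V_x\cos\gamma+\hat V_y\sin\gamma$, $\hat V_N=-\hat V_x\sin\gamma+\hat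 V_y\cos\gamma$, and similarly $\tilde V_T,\tilde V_N$. *Update law*: $\dot\theta=u_r\cos(\psi-\gamma)-v_r\sin(\psi-\gamma)+\frac{k_\delta x_{b/p}}{\sqrt{1+x_{b/p}^2}}+\hat V_T$, $k_\delta>0$. (The first two terms are $u_t\cos(\chi-\gamma)$, with total speed $u_t$ and course $\chi$.) *Guidance*: $\Delta=\sqrt{\mu+x_{b/p}^2+y_{b/p}^2}$, $\mu>0$; $u_{td}=\sqrt{u_{rd}^2+v_r^2}$; $a=-(u_{td}^2-\hat V_N^2)$, $b=y_{b/p}\hat V_N$, $c=\Delta^2+y_{b/p}^2$; $s=\frac{b+\sqrt{b^2-ac}}{-a}$, $g=\hat V_N s$; $E=\Delta^2+(y_{b/p}+g)^2$; $\psi_d=\gamma-\arctan\frac{v_r}{u_{rd}}-\phi$ with $\phi=\arctan\frac{y_{b/p}+g}{\Delta}$. Put $\tilde\psi=\psi-\psi_d$ and $\tilde u=u_r-u_{rd}$. *Surge controller*: $\tau_u=-F_u+\dot u_{rd}+\frac{d_{11}}{m_{11}}u_{rd}-k_u\tilde u$, $k_u>0$. *Yaw-rate controller.* Partial derivatives of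 $g$ are those of $g=\hat V_N s(a,b,c)$ as a function of $a,b,c$. Put $$C_r=1+\frac{X(u_r)u_{rd}}{u_{rd}^2+v_r^2}-\frac{2X(u_r)v_r\Delta}{E}\,\frac{\partial g}{\partial a},$$ $$G_1=u_{td}(1-\cos\tilde\psi)\sin\phi+\tilde u\sin(\psi-\gamma)+u_{td}\cos\phi\,\sin\tilde\psi,$$ $$\dot x^k=-\tfrac{k_\delta x_{b/p}}{\sqrt{1+x_{b/p}^2}}+y_{b/p}\kappa\dot\theta,\quad \dot y^k=-\tfrac{u_{td}y_{b/p}}{\sqrt E}+G_1-x_{b/p}\kappa\dot\theta,\quad \dot\Delta^k=\tfrac{\partial\Delta}{\partial x_{b/p}}\dot x^k+\tfrac{\partial\Delta}{\partial y_{b/p}}\dot y^k,$$ $$\dot{\hat V}_N=k_{y_2}\tilde y\cos\gamma-k_{x_2}\tilde x\sin\gamma-\kappa\dot\theta\hat V_T,$$ $$r_d=-\frac1{C_r}\Big[-\kappa\dot\theta+\frac{Y(u_r)v_ru_{rd}-\dot u_{rd}v_r}{u_{rd}^2+v_r^2}+\frac{\Delta}{E}\Big(\dot{\hat V}_N s+\frac{\partial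 g}{\partial b}\dot{\hat V}_Ny_{b/p}+2\frac{\partial g}{\partial a}\big(\hat V_N\dot{\hat V}_N-u_{rd}\dot u_{rd}-Y(u_r)v_r^2\big)+\Big(1+2\frac{\partial g}{\partial c}y_{b/p}+\frac{\partial g}{\partial b}\hat V_N\Big)\dot y^k+2\frac{\partial g}{\partial c}\Delta\dot\Delta^k\Big)-\frac{y_{b/p}+g}{E}\dot\Delta^k\Big].$$ Regard $r_d$ as a function of $\theta,v_r,u_r,u_{rd},\dot u_{rd},\hat V_T,\hat V_N,x_{b/p},y_{b/p},\tilde\psi,\tilde x,\tilde y$ (with $\psi-\gamma=\tilde\psi-\arctan\frac{v_r}{u_{rd}}-\phi$), and put $\tilde r=r-r_d$. With $k_1,k_2>0$, $$\tau_r=-F_r+\dot r_d^{\,k}-k_1\tilde r-k_2C_r\tilde\psi,$$ where $\dot r_d^{\,k}$ is the sum of the partial derivatives of $r_d$, each times the known part of the rate of its argument. These parts are: the closed-loop rates for $\theta,v_r,u_r,u_{rd},\dot u_{rd},\hat V_T,\hat V_N$; $\dot x^k$ and $\dot y^k$ for $x_{b/p},y_{b/p}$; $C_r\tilde r$ for $\tilde\psi$;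 $-k_{x_1}\tilde x$ and $-k_{y_1}\tilde y$ for $\tilde x,\tilde y$. The closed loop is considered on the set of states where $\hat V_N^2<u_{td}^2$ and $C_r>0$, in which the control laws are defined. **Assumptions.** (i) $Y_{\min}>0$ and $Y(u)\le -Y_{\min}$ for all $u\in[-V_{\max},u_{rd}(t)]$, $t\ge0$. (ii) With $X_{\max}=\sup\{|X(u)|:u\in[-V_{\max},u_{rd}(t)],\,t\ge0\}$ and $\kappa_{\max}=\sup|\kappa|$: $2X_{\max}\kappa_{\max}<Y_{\min}$ and $\mu>\dfrac{8X_{\max}}{Y_{\min}-2X_{\max}\kappa_{\max}}$. (iii) A constant $\underline c>0$ is fixed. A trajectory satisfies *Condition 1* if $C_r\ge\underline c$ along it. The observer is called *admissibly initialised* at $t_0$ if at time $t_0$ $$\tilde x^2+\tilde y^2+\tfrac1{k_{x_2}}\tilde V_x^2+\tfrac1{k_{y_2}}\tilde V_y^2\le \tfrac{V_{\max}^2}{\max(k_{x_2},k_{y_2})}$$ (for $k_{x_2}=k_{y_2}$ this includes $\hat x=x,\ \hat y=y,\ \hat V_x=\hat V_y=0$). **Theorem.** Let $e=(y_{b/p},x_{b/p},\tilde\psi,\tilde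 r,\tilde x,\tilde y,\tilde V_x,\tilde V_y,\tilde u)$, with Euclidean norm $\|e\|$. 1. For every $t_0\ge0$ and every state at which the closed loop is defined and the observer is admissibly initialised, there is a maximal forward solution from that state at time $t_0$. 2. (Path following, boundedness, global attractivity.) Every maximal forward solution starting at a time $t_0\ge0$ with admissibly initialised observer and satisfying Condition 1 is defined for all $t\ge t_0$; along it $v_r,\tau_r,\tau_u$ are bounded, $(x,y)-P(\theta)\to0$ and $e(t)\to0$ as $t\to\infty$. 3. (Stability.) For all $R,\varepsilon>0$ there is $\delta>0$ such that for every $t_0\ge0$ and every solution on $[t_0,\infty)$ satisfying Condition 1, with $|v_r(t_0)|\le R$ and $\|e(t_0)\|<\delta$, one has $\|e(t)\|<\varepsilon$ for all $t\ge t_0$. 4. (Local exponential stability.) For every $R>0$ there are $\rho,k,\lambda>0$ such that for every $t_0\ge0$ and every solution on $[t_0,\infty)$ satisfying Condition 1, with $|v_r(t_0)|\le R$ and $\|e(t_0)\|<\rho$, one has $\|e(t)\|\le k\|e(t_0)\|e^{-\lambda(t-t_0)}$ for all $t\ge t_0$. Thus the origin of the error system is globally asymptotically stable (within the admissible observer initialisations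 and along trajectories satisfying Condition 1) and locally exponentially stable. -/

import Mathlib

open Set Filter Topology
open scoped ContDiff

namespace VesselPF

noncomputable section

/-- Parameters of the vessel model at the pivot point. The mass matrix
`[[m11, 0, 0], [0, m22, m23], [0, m23, m33]]` is symmetric positive definite and the
surge damping is nonnegative. -/
structure Vessel where
  (m11 m22 m23 m33 : ℝ)
  (d11 d22 d23 d32 d33 : ℝ)
  m11_pos : 0 < m11
  m22_pos : 0 < m22
  det_pos : 0 < m22 * m33 - m23 ^ 2
  d11_nonneg : 0 ≤ d11

namespace Vessel
variable (P : Vessel)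

def Fu (v r : ℝ) : ℝ := (1 / P.m11) * (P.m22 * v + P.m23 * r) * r

def X (u : ℝ) : ℝ :=
  (P.m23 ^ 2 - P.m11 * P.m33) / (P.m22 * P.m33 - P.m23 ^ 2) * u
    + (P.d33 * P.m23 - P.d23 * P.m33) / (P.m22 * P.m33 - P.m23 ^ 2)

def Y (u : ℝ) : ℝ :=
  (P.m22 - P.m11) * P.m23 / (P.m22 * P.m33 - P.m23 ^ 2) * u
    - (P.d22 * P.m33 - P.d32 * P.m23) / (P.m22 * P.m33 - P.m23 ^ 2)

def Fr (u v r : ℝ) : ℝ :=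
  (P.m23 * P.d22 - P.m22 * (P.d32 + (P.m22 - P.m11) * u)) / (P.m22 * P.m33 - P.m23 ^ 2) * v
    + (P.m23 * (P.d23 + P.m11 * u) - P.m22 * (P.d33 + P.m23 * u))
        / (P.m22 * P.m33 - P.m23 ^ 2) * r

end Vessel

/-- A smooth planar path `θ ↦ (xp θ, yp θ)`, parametrised by arc length, with tangent angle `γ`. -/
structure Path where
  (xp yp γ : ℝ → ℝ)
  smooth : ContDiff ℝ ∞ γ
  hasDerivAt_xp : ∀ θ, HasDerivAt xp (Real.cos (γ θ)) θ
  hasDerivAt_yp : ∀ θ, HasDerivAt yp (Real.sin (γ θ)) θ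

/-- Signed curvature. -/
def Path.κ (p : Path) : ℝ → ℝ := deriv p.γ

/-- Gains of the surge controller (`ku`), of the observer (`kx1, kx2, ky1, ky2`), of the yaw-rate
controller (`k1, k2`) and of the update law (`kδ`), and the look-ahead constant `μ`. -/
structure Gains where
  (ku kx1 kx2 ky1 ky2 k1 k2 kδ μ : ℝ)
  ku_pos : 0 < ku
  kx1_pos : 0 < kx1
  kx2_pos : 0 < kx2
  ky1_pos : 0 < ky1
  ky2_pos : 0 < ky2
  k1_pos : 0 < k1
  k2_pos : 0 < k2
  kδ_pos : 0 < kδ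
  μ_pos : 0 < μ

/-- All the data of the problem: vessel, path, gains, desired relative surge velocity `urd` and the
constant ocean current `(Vx, Vy)`. -/
structure Setup extends Vessel, Path, Gains where
  urd : ℝ → ℝ
  (Vx Vy : ℝ)

/-! ### Look-ahead distance and the current-compensating term of the guidance law -/

/-- Look-ahead distance `Δ`. -/
def lookahead (μ x y : ℝ) : ℝ := √(μ + x ^ 2 + y ^ 2)

/-- `(b + √(b² - a c)) / (-a)`. -/
def gRatio (a b c : ℝ) : ℝ := (b + √(b ^ 2 - a * c)) / (-a)

/-- `g` as a function of `V̂_N` and of the coefficients `a, b, c`. -/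
def gFun (VN a b c : ℝ) : ℝ := VN * gRatio a b c

/-- `u_td = √(u_rd² + v_r²)`. -/
def utd (ud v : ℝ) : ℝ := √(ud ^ 2 + v ^ 2)

def coefA (ud v VN : ℝ) : ℝ := -(utd ud v ^ 2 - VN ^ 2)

def coefB (VN y : ℝ) : ℝ := y * VN

def coefC (μ x y : ℝ) : ℝ := lookahead μ x y ^ 2 + y ^ 2

/-- The value of `g`. -/
def gVal (μ ud v VN x y : ℝ) : ℝ := gFun VN (coefA ud v VN) (coefB VN y) (coefC μ x y)

/-- The line-of-sight angle `arctan ((y + g) / Δ)`. -/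
def losAngle (μ ud v VN x y : ℝ) : ℝ :=
  Real.arctan ((y + gVal μ ud v VN x y) / lookahead μ x y)

/-! ### The yaw-rate reference `r_d` as a function of its arguments -/

/-- The arguments of `r_d`: `h = (θ, v_r, u_r, u_rd, u̇_rd, V̂_T, V̂_N)`, then
`y_{b/p}, x_{b/p}, ψ̃, x̃, ỹ`. -/
structure Args where
  (θ v u ud dud VT VN : ℝ)
  (y x ψe xe ye : ℝ)

namespace Setup
variable (S : Setup)

/-- The update law `u_t cos (χ - γ) + kδ x / √(1 + x²) + V̂_T`, with `φ = ψ - γ`. Since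
`u_t (cos β, sin β) = (u, v)`, one has `u_t cos (χ - γ) = u cos φ - v sin φ`. -/
def updateLaw (u v φ x VT : ℝ) : ℝ :=
  u * Real.cos φ - v * Real.sin φ + S.kδ * x / √(1 + x ^ 2) + VT

/-- `Δ`. -/
def Δ (q : Args) : ℝ := lookahead S.μ q.x q.y

/-- `∂Δ/∂x_{b/p}`. -/
def Δx (q : Args) : ℝ := deriv (fun s => lookahead S.μ s q.y) q.x

/-- `∂Δ/∂y_{b/p}`. -/
def Δy (q : Args) : ℝ := deriv (fun s => lookahead S.μ q.x s) q.y

/-- `g`. -/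
def g (q : Args) : ℝ := gVal S.μ q.ud q.v q.VN q.x q.y

/-- `(b + √(b² - a c)) / (-a)`, which equals `g / V̂_N` for `V̂_N ≠ 0`. -/
def ratio (q : Args) : ℝ :=
  gRatio (coefA q.ud q.v q.VN) (coefB q.VN q.y) (coefC S.μ q.x q.y)

/-- `∂g/∂a`. -/
def ga (q : Args) : ℝ :=
  deriv (fun s => gFun q.VN s (coefB q.VN q.y) (coefC S.μ q.x q.y)) (coefA q.ud q.v q.VN)

/-- `∂g/∂b`. -/
def gb (q : Args) : ℝ :=
  deriv (fun s => gFun q.VN (coefA q.ud q.v q.VN) s (coefC S.μ q.x q.y)) (coefB q.VN q.y)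

/-- `∂g/∂c`. -/
def gc (q : Args) : ℝ :=
  deriv (fun s => gFun q.VN (coefA q.ud q.v q.VN) (coefB q.VN q.y) s) (coefC S.μ q.x q.y)

/-- `Δ² + (y + g)²`. -/
def den (q : Args) : ℝ := S.Δ q ^ 2 + (q.y + S.g q) ^ 2

/-- `ψ - γ = ψ̃ + ψ_d - γ`. -/
def relHeading (q : Args) : ℝ :=
  q.ψe - Real.arctan (q.v / q.ud) - losAngle S.μ q.ud q.v q.VN q.x q.y

/-- `θ̇`. -/
def θdot (q : Args) : ℝ := S.updateLaw q.u q.v (S.relHeading q) q.x q.VT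

/-- `C_r`. -/
def Cr (q : Args) : ℝ :=
  1 + (S.X q.u * q.ud / (q.ud ^ 2 + q.v ^ 2) - 2 * S.X q.u * q.v * S.Δ q / S.den q * S.ga q)

/-- Time derivative of `V̂_N = -V̂_x sin γ + V̂_y cos γ`. -/
def VNdot (q : Args) : ℝ :=
  S.ky2 * q.ye * Real.cos (S.γ q.θ) - S.kx2 * q.xe * Real.sin (S.γ q.θ)
    - S.κ q.θ * S.θdot q * q.VT

/-- Time derivative of `V̂_T = V̂_x cos γ + V̂_y sin γ`. -/
def VTdot (q : Args) : ℝ :=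
  S.kx2 * q.xe * Real.cos (S.γ q.θ) + S.ky2 * q.ye * Real.sin (S.γ q.θ)
    + S.κ q.θ * S.θdot q * q.VN

/-- `G₁`. -/
def G1 (q : Args) : ℝ :=
  utd q.ud q.v * (1 - Real.cos q.ψe) * Real.sin (losAngle S.μ q.ud q.v q.VN q.x q.y)
    + (q.u - q.ud) * Real.sin (S.relHeading q)
    + utd q.ud q.v * Real.cos (losAngle S.μ q.ud q.v q.VN q.x q.y) * Real.sin q.ψe

/-- The known part of `ẋ_{b/p}` (without `Ṽ_T`). -/
def xKnown (q : Args) : ℝ :=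
  -S.kδ * q.x / √(1 + q.x ^ 2) + q.y * S.κ q.θ * S.θdot q

/-- The known part of `ẏ_{b/p}` (without `Ṽ_N`). -/
def yKnown (q : Args) : ℝ :=
  -utd q.ud q.v * q.y / √(S.den q) + S.G1 q - q.x * S.κ q.θ * S.θdot q

/-- The known part of `Δ̇`. -/
def ΔKnown (q : Args) : ℝ := S.Δx q * S.xKnown q + S.Δy q * S.yKnown q

/-- The yaw-rate reference `r_d`. The time derivative of `ψ̃` is `C_r r + f`; here `r_d` is
`-f / C_r` with the terms in the unknown `Ṽ_T, Ṽ_N` left out of `f`. -/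
def rd (q : Args) : ℝ :=
  -(S.Cr q)⁻¹ *
    (-S.κ q.θ * S.θdot q
      + (S.Y q.u * q.v * q.ud - q.dud * q.v) / (q.ud ^ 2 + q.v ^ 2)
      + S.Δ q / S.den q *
          (S.VNdot q * S.ratio q
            + S.gb q * (S.VNdot q * q.y)
            + S.ga q * (2 * q.VN * S.VNdot q - 2 * q.ud * q.dud - 2 * S.Y q.u * q.v ^ 2)
            + (1 + 2 * S.gc q * q.y + S.gb q * q.VN) * S.yKnown q
            + S.gc q * (2 * S.Δ q * S.ΔKnown q))
      - (q.y + S.g q) / S.den q * S.ΔKnown q)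

end Setup

/-! ### The closed-loop system -/

/-- State of the closed loop: position, heading, relative surge and sway velocity, yaw rate,
observer states `x̂, ŷ, V̂_x, V̂_y`, path variable. -/
structure State where
  (x y ψ u v r xh yh Vxh Vyh θ : ℝ)

namespace Setup
variable (S : Setup)

/-- Along-path error `x_{b/p}`. -/
def xbp (z : State) : ℝ :=
  Real.cos (S.γ z.θ) * (z.x - S.xp z.θ) + Real.sin (S.γ z.θ) * (z.y - S.yp z.θ)

/-- Cross-path error `y_{b/p}`. -/
def ybp (z : State) : ℝ :=
  -Real.sin (S.γ z.θ) * (z.x - S.xp z.θ) + Real.cos (S.γ z.θ) * (z.y - S.yp z.θ)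

/-- `V̂_T`. -/
def VTh (z : State) : ℝ := z.Vxh * Real.cos (S.γ z.θ) + z.Vyh * Real.sin (S.γ z.θ)

/-- `V̂_N`. -/
def VNh (z : State) : ℝ := -z.Vxh * Real.sin (S.γ z.θ) + z.Vyh * Real.cos (S.γ z.θ)

/-- The guidance law `ψ_d`. -/
def ψd (t : ℝ) (z : State) : ℝ :=
  S.γ z.θ - Real.arctan (z.v / S.urd t)
    - losAngle S.μ (S.urd t) z.v (S.VNh z) (S.xbp z) (S.ybp z)

/-- The arguments of `r_d` at time `t` in state `z`. -/
def args (t : ℝ) (z : State) : Args where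
  θ := z.θ
  v := z.v
  u := z.u
  ud := S.urd t
  dud := deriv S.urd t
  VT := S.VTh z
  VN := S.VNh z
  y := S.ybp z
  x := S.xbp z
  ψe := z.ψ - S.ψd t z
  xe := z.x - z.xh
  ye := z.y - z.yh

/-- Yaw angle error `ψ̃`. -/
def ψerr (t : ℝ) (z : State) : ℝ := z.ψ - S.ψd t z

/-- Yaw rate error `r̃`. -/
def rerr (t : ℝ) (z : State) : ℝ := z.r - S.rd (S.args t z)

/-- Surge controller `τ_u`. -/
def τu (t : ℝ) (z : State) : ℝ :=
  -S.Fu z.v z.r + deriv S.urd t + S.d11 / S.m11 * S.urd t - S.ku * (z.u - S.urd t)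

/-- Right-hand side of the surge equation. -/
def udot (t : ℝ) (z : State) : ℝ := S.Fu z.v z.r - S.d11 / S.m11 * z.u + S.τu t z

/-- Right-hand side of the sway equation. -/
def vdot (z : State) : ℝ := S.X z.u * z.r + S.Y z.u * z.v

/-- The known part of the time derivative of `r_d`: the partial derivatives of `r_d` times the
known parts of the time derivatives of its arguments. -/
def rdKnown (t : ℝ) (z : State) : ℝ :=
  let q := S.args t z
  deriv (fun s => S.rd { q with θ := s }) q.θ * S.θdot q
    + deriv (fun s => S.rd { q with v := s }) q.v * S.vdot z
    + deriv (fun s => S.rd { q with u := s }) q.u * S.udot t z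
    + deriv (fun s => S.rd { q with ud := s }) q.ud * deriv S.urd t
    + deriv (fun s => S.rd { q with dud := s }) q.dud * deriv (deriv S.urd) t
    + deriv (fun s => S.rd { q with VT := s }) q.VT * S.VTdot q
    + deriv (fun s => S.rd { q with VN := s }) q.VN * S.VNdot q
    + deriv (fun s => S.rd { q with x := s }) q.x * S.xKnown q
    + deriv (fun s => S.rd { q with y := s }) q.y * S.yKnown q
    + deriv (fun s => S.rd { q with ψe := s }) q.ψe * (S.Cr q * S.rerr t z)
    + deriv (fun s => S.rd { q with xe := s }) q.xe * (-S.kx1 * q.xe)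
    + deriv (fun s => S.rd { q with ye := s }) q.ye * (-S.ky1 * q.ye)

/-- Yaw-rate controller `τ_r`. -/
def τr (t : ℝ) (z : State) : ℝ :=
  -S.Fr z.u z.v z.r + S.rdKnown t z - S.k1 * S.rerr t z
    - S.k2 * S.Cr (S.args t z) * S.ψerr t z

/-- `C_r` at time `t` in state `z`. -/
def CrAt (t : ℝ) (z : State) : ℝ := S.Cr (S.args t z)

/-- The set of states in which the guidance law and the yaw-rate controller are defined. -/
def Dom (t : ℝ) (z : State) : Prop :=
  S.VNh z ^ 2 < utd (S.urd t) z.v ^ 2 ∧ 0 < S.CrAt t z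

/-- `z` solves the closed loop (vessel model, both controllers, observer and update law) on the
time interval `J`. -/
structure IsSolutionOn (J : Set ℝ) (z : ℝ → State) : Prop where
  dom : ∀ t ∈ J, S.Dom t (z t)
  x : ∀ t ∈ J, HasDerivWithinAt (fun s => (z s).x)
    ((z t).u * Real.cos (z t).ψ - (z t).v * Real.sin (z t).ψ + S.Vx) J t
  y : ∀ t ∈ J, HasDerivWithinAt (fun s => (z s).y)
    ((z t).u * Real.sin (z t).ψ + (z t).v * Real.cos (z t).ψ + S.Vy) J t
  ψ : ∀ t ∈ J, HasDerivWithinAt (fun s => (z s).ψ) (z t).r J t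
  u : ∀ t ∈ J, HasDerivWithinAt (fun s => (z s).u)
    (S.Fu (z t).v (z t).r - S.d11 / S.m11 * (z t).u + S.τu t (z t)) J t
  v : ∀ t ∈ J, HasDerivWithinAt (fun s => (z s).v)
    (S.X (z t).u * (z t).r + S.Y (z t).u * (z t).v) J t
  r : ∀ t ∈ J, HasDerivWithinAt (fun s => (z s).r)
    (S.Fr (z t).u (z t).v (z t).r + S.τr t (z t)) J t
  xh : ∀ t ∈ J, HasDerivWithinAt (fun s => (z s).xh)
    ((z t).u * Real.cos (z t).ψ - (z t).v * Real.sin (z t).ψ + (z t).Vxh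
      + S.kx1 * ((z t).x - (z t).xh)) J t
  yh : ∀ t ∈ J, HasDerivWithinAt (fun s => (z s).yh)
    ((z t).u * Real.sin (z t).ψ + (z t).v * Real.cos (z t).ψ + (z t).Vyh
      + S.ky1 * ((z t).y - (z t).yh)) J t
  Vxh : ∀ t ∈ J, HasDerivWithinAt (fun s => (z s).Vxh) (S.kx2 * ((z t).x - (z t).xh)) J t
  Vyh : ∀ t ∈ J, HasDerivWithinAt (fun s => (z s).Vyh) (S.ky2 * ((z t).y - (z t).yh)) J t
  θ : ∀ t ∈ J, HasDerivWithinAt (fun s => (z s).θ)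
    (S.updateLaw (z t).u (z t).v ((z t).ψ - S.γ (z t).θ) (S.xbp (z t)) (S.VTh (z t))) J t

/-- `z` is a solution on the interval `J` with initial time `t₀ = min J` that cannot be continued
to a larger interval. -/
def IsMaximalSolution (t₀ : ℝ) (J : Set ℝ) (z : ℝ → State) : Prop :=
  IsLeast J t₀ ∧ J.OrdConnected ∧ S.IsSolutionOn J z ∧
    ∀ (J' : Set ℝ) (z' : ℝ → State), IsLeast J' t₀ → J'.OrdConnected → J ⊆ J' →
      EqOn z' z J → S.IsSolutionOn J' z' → J' = J

/-- Admissible observer initialisation. If `kx2 = ky2`, it contains the initialisation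
`(x̂, ŷ, V̂_x, V̂_y) = (x, y, 0, 0)` whenever `‖(Vx, Vy)‖ ≤ Vmax`. -/
def ObserverInit (Vmax : ℝ) (z : State) : Prop :=
  (z.x - z.xh) ^ 2 + (z.y - z.yh) ^ 2 + (1 / S.kx2) * (S.Vx - z.Vxh) ^ 2
    + (1 / S.ky2) * (S.Vy - z.Vyh) ^ 2 ≤ Vmax ^ 2 / max S.kx2 S.ky2

/-- Euclidean norm of the error state
`(y_{b/p}, x_{b/p}, ψ̃, r̃, x̃, ỹ, Ṽ_x, Ṽ_y, ũ)`. -/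
def errNorm (t : ℝ) (z : State) : ℝ :=
  √(S.ybp z ^ 2 + S.xbp z ^ 2 + S.ψerr t z ^ 2 + S.rerr t z ^ 2
    + (z.x - z.xh) ^ 2 + (z.y - z.yh) ^ 2 + (S.Vx - z.Vxh) ^ 2 + (S.Vy - z.Vyh) ^ 2
    + (z.u - S.urd t) ^ 2)

end Setup

end

end VesselPF

open VesselPF

/-!
The closed loop is a cascade. The observer errors and `ũ` obey autonomous linear equations and decay
exponentially. They force the pair `(ψ̃, r̃)`, which obeys
`ψ̃' = C_r r̃ + …`, `r̃' = -k₁ r̃ - k₂ C_r ψ̃ + …`, an oscillator with time-varying coupling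
`C_r ≥ c`. Last come the path-following errors `x_{b/p}, y_{b/p}`, driven by all the others.

*The yaw-rate reference.* What forces `r̃` is the gradient of `r_d` applied to the observer errors, so
this gradient must be controlled without any a priori bound on the position, on `ψ̃` or on the sway
velocity. In the quantities `ν = V̂_N / u_td` and `ζ = y_{b/p} / Δ` the implicit guidance term becomes
`g = Δ ν σ` with an explicit algebraic function `σ` of `ν` and `ζ`, and `r_d / u_td` becomes a
polynomial in functions which are bounded together with their gradients as long as `V̂_N²` stays
uniformly below `u_td²` and `C_r ≥ c`. Such functions form an algebra (`Tame`). Hence `r_d` and its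
gradient grow at most linearly in `v_r` (`rd_bound`), and the quadratic Lyapunov function of the
oscillator (`exists_oscillator_lyapunov`, `exists_headingLyap`) is forced by at most
`(1 + v_r²)` times an exponentially decaying term.

*The sway velocity.* In `v_r' = X r + Y v_r` the yaw rate `r` may grow with `v_r`. The corrected sway
velocity `w = v_r - X(u_r) (ψ - γ)` removes it: since `ψ - γ` differs from `ψ̃` by two arctangents,
`w` and `v_r` differ by a bounded quantity plus a multiple of `ψ̃`, and the rate of `w` contains only
the rotation `κ θ̇` of the path frame, with `|θ̇| ≤ |v_r| + const`. So `w²` is dissipated at the rate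
`Y_min - X_max κ_max > 0` up to bounded terms (`exists_swayCorr_deriv`). A weighted sum of `w²` and the
heading Lyapunov function satisfies a linear differential inequality with an integrable coefficient,
which bounds `v_r`; then the heading errors decay exponentially (`exists_heading_decay`).

*Path following.* The rotation of the path frame does not change `x_{b/p}² + y_{b/p}²`, and the guidance
law dissipates it at a rate proportional to `V / √(1 + V)`, `V = x_{b/p}² + y_{b/p}²`. With
exponentially decaying forcing this bounds `V` first and then gives exponential decay
(`exists_position_decay`). All constants depend only on bounds for the initial errors and the initial
sway velocity, which yields uniform exponential decay of the whole error state
(`exists_errNorm_decay`).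

*Existence.* Maximal solutions exist by Zorn's lemma (`exists_isMaximalSolution`). Along the solutions
considered above the vector field is bounded (`exists_field_bound`), so that a solution on a bounded
interval has a limit at its end point. The limit still lies in the open set in which the control laws
are defined, and the Picard-Lindelöf theorem continues the solution (`IsMaximalSolution.eq_Ici`).
The uniform gap between `V̂_N²` and `u_rd²` needed throughout comes from the energy of the observer
(`IsSolutionOn.exists_gap`) or from small initial errors (`exists_small_isRegular`).
-/

namespace VesselPF

noncomputable section

/-! ### Functions with bounded gradient -/

section Tame

variable {E : Type*} [NormedAddCommGroup E] [NormedSpace ℝ E] {Ω : Set E} {f g W : E → ℝ}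

/-- `f` is twice continuously differentiable near the points of `Ω` and its gradient is bounded
on `Ω`. -/
def GradBdd (Ω : Set E) (f : E → ℝ) : Prop :=
  ∃ C, ∀ q ∈ Ω, ContDiffAt ℝ 2 f q ∧ ‖fderiv ℝ f q‖ ≤ C

/-- `f` is twice continuously differentiable near the points of `Ω`, and `f` and its gradient are
bounded on `Ω`. The tame functions form an algebra. -/
def Tame (Ω : Set E) (f : E → ℝ) : Prop :=
  ∃ C, ∀ q ∈ Ω, ContDiffAt ℝ 2 f q ∧ |f q| ≤ C ∧ ‖fderiv ℝ f q‖ ≤ C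

theorem Tame.gradBdd (hf : Tame Ω f) : GradBdd Ω f := by
  obtain ⟨C, hC⟩ := hf
  exact ⟨C, fun q hq => ⟨(hC q hq).1, (hC q hq).2.2⟩⟩

theorem GradBdd.tame (hf : GradBdd Ω f) {B : ℝ} (hB : ∀ q ∈ Ω, |f q| ≤ B) : Tame Ω f := by
  obtain ⟨C, hC⟩ := hf
  exact ⟨max B C, fun q hq => ⟨(hC q hq).1, (hB q hq).trans (le_max_left _ _),
    (hC q hq).2.trans (le_max_right _ _)⟩⟩

theorem Tame.mono {Ω' : Set E} (hf : Tame Ω f) (h : Ω' ⊆ Ω) : Tame Ω' f :=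
  ⟨hf.choose, fun q hq => hf.choose_spec q (h hq)⟩

theorem Tame.contDiffAt (hf : Tame Ω f) {q : E} (hq : q ∈ Ω) : ContDiffAt ℝ 2 f q :=
  (hf.choose_spec q hq).1

theorem GradBdd.contDiffAt (hf : GradBdd Ω f) {q : E} (hq : q ∈ Ω) : ContDiffAt ℝ 2 f q :=
  (hf.choose_spec q hq).1

theorem Tame.exists_abs_le (hf : Tame Ω f) : ∃ C, 0 ≤ C ∧ ∀ q ∈ Ω, |f q| ≤ C := by
  obtain ⟨C, hC⟩ := hf
  exact ⟨max C 0, le_max_right _ _, fun q hq => (hC q hq).2.1.trans (le_max_left _ _)⟩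

/-- The constant in `GradBdd` can be taken nonnegative, and `f` comes with its derivative. -/
theorem GradBdd.exists_hasFDerivAt (hf : GradBdd Ω f) :
    ∃ C, 0 ≤ C ∧ ∀ q ∈ Ω, ContDiffAt ℝ 2 f q ∧ HasFDerivAt f (fderiv ℝ f q) q ∧
      ‖fderiv ℝ f q‖ ≤ C := by
  obtain ⟨C, hC⟩ := hf
  refine ⟨max C 0, le_max_right _ _, fun q hq => ⟨(hC q hq).1, ?_,
    (hC q hq).2.trans (le_max_left _ _)⟩⟩
  exact ((hC q hq).1.differentiableAt (by norm_num)).hasFDerivAt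

theorem Tame.exists_hasFDerivAt (hf : Tame Ω f) :
    ∃ C, 0 ≤ C ∧ ∀ q ∈ Ω, ContDiffAt ℝ 2 f q ∧ |f q| ≤ C ∧ HasFDerivAt f (fderiv ℝ f q) q ∧
      ‖fderiv ℝ f q‖ ≤ C := by
  obtain ⟨C, h0, hC⟩ := hf.gradBdd.exists_hasFDerivAt
  obtain ⟨D, hD0, hD⟩ := hf.exists_abs_le
  exact ⟨max C D, le_max_of_le_left h0, fun q hq => ⟨(hC q hq).1,
    (hD q hq).trans (le_max_right _ _), (hC q hq).2.1, (hC q hq).2.2.trans (le_max_left _ _)⟩⟩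

theorem GradBdd.of_hasFDerivAt {f' : E → E →L[ℝ] ℝ} {C : ℝ}
    (h : ∀ q ∈ Ω, ContDiffAt ℝ 2 f q ∧ HasFDerivAt f (f' q) q ∧ ‖f' q‖ ≤ C) : GradBdd Ω f :=
  ⟨C, fun q hq => ⟨(h q hq).1, by rw [(h q hq).2.1.fderiv]; exact (h q hq).2.2⟩⟩

theorem Tame.const (a : ℝ) : Tame Ω (fun _ => a) :=
  ⟨|a|, fun q _ => ⟨contDiffAt_const, le_rfl, by simp⟩⟩

theorem Tame.add (hf : Tame Ω f) (hg : Tame Ω g) : Tame Ω (fun q => f q + g q) := by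
  obtain ⟨C, -, hC⟩ := hf.exists_hasFDerivAt
  obtain ⟨D, -, hD⟩ := hg.exists_hasFDerivAt
  refine ⟨C + D, fun q hq => ⟨(hC q hq).1.add (hD q hq).1, ?_, ?_⟩⟩
  · exact (abs_add_le _ _).trans (add_le_add (hC q hq).2.1 (hD q hq).2.1)
  · rw [((hC q hq).2.2.1.fun_add (hD q hq).2.2.1).fderiv]
    exact (norm_add_le _ _).trans (add_le_add (hC q hq).2.2.2 (hD q hq).2.2.2)

theorem Tame.mul (hf : Tame Ω f) (hg : Tame Ω g) : Tame Ω (fun q => f q * g q) := by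
  obtain ⟨C, hC0, hC⟩ := hf.exists_hasFDerivAt
  obtain ⟨D, hD0, hD⟩ := hg.exists_hasFDerivAt
  refine ⟨C * D + C * D, fun q hq => ⟨(hC q hq).1.mul (hD q hq).1, ?_, ?_⟩⟩
  · rw [abs_mul]
    exact (mul_le_mul (hC q hq).2.1 (hD q hq).2.1 (abs_nonneg _) hC0).trans
      (le_add_of_nonneg_right (mul_nonneg hC0 hD0))
  · rw [((hC q hq).2.2.1.fun_mul (hD q hq).2.2.1).fderiv]
    refine (norm_add_le _ _).trans (add_le_add ?_ ?_)
    · rw [norm_smul, Real.norm_eq_abs]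
      exact mul_le_mul (hC q hq).2.1 (hD q hq).2.2.2 (norm_nonneg _) hC0
    · rw [norm_smul, Real.norm_eq_abs, mul_comm C D]
      exact mul_le_mul (hD q hq).2.1 (hC q hq).2.2.2 (norm_nonneg _) hD0

theorem Tame.neg (hf : Tame Ω f) : Tame Ω (fun q => -f q) := by
  simpa using (Tame.const (Ω := Ω) (-1)).mul hf

theorem Tame.sub (hf : Tame Ω f) (hg : Tame Ω g) : Tame Ω (fun q => f q - g q) := by
  simpa [sub_eq_add_neg] using hf.add hg.neg

theorem Tame.pow (hf : Tame Ω f) (n : ℕ) : Tame Ω (fun q => f q ^ n) := by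
  induction n with
  | zero => simpa using Tame.const 1
  | succ n ih => simpa [pow_succ] using ih.mul hf

/-- Quotients of functions with bounded gradient, when the numerator is dominated by the
denominator. -/
theorem GradBdd.div (hf : GradBdd Ω f) (hW : GradBdd Ω W) {C w : ℝ} (hw : 0 < w)
    (hwW : ∀ q ∈ Ω, w ≤ W q) (hfW : ∀ q ∈ Ω, |f q| ≤ C * W q) :
    Tame Ω (fun q => f q / W q) := by
  obtain ⟨A, hA0, hA⟩ := hf.exists_hasFDerivAt
  obtain ⟨D, hD0, hD⟩ := hW.exists_hasFDerivAt
  have hpos : ∀ q ∈ Ω, 0 < W q := fun q hq => hw.trans_le (hwW q hq)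
  have hquot : ∀ q ∈ Ω, |f q / W q| ≤ |C| := fun q hq => by
    rw [abs_div, abs_of_pos (hpos q hq), div_le_iff₀ (hpos q hq)]
    exact (hfW q hq).trans (mul_le_mul_of_nonneg_right (le_abs_self C) (hpos q hq).le)
  refine GradBdd.tame (B := |C|) ⟨w⁻¹ * A + w⁻¹ * (|C| * D), fun q hq => ⟨?_, ?_⟩⟩ hquot
  · exact (hA q hq).1.div (hD q hq).1 (hpos q hq).ne'
  · have hinv : (W q)⁻¹ ≤ w⁻¹ := inv_anti₀ hw (hwW q hq)
    have hq0 := hpos q hq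
    have hd : HasFDerivAt (fun q => f q / W q)
        ((W q)⁻¹ • fderiv ℝ f q - ((W q)⁻¹ * (f q / W q)) • fderiv ℝ W q) q := by
      have h1 : HasFDerivAt (fun q => (W q)⁻¹) (-(W q ^ 2)⁻¹ • fderiv ℝ W q) q :=
        (hasDerivAt_inv hq0.ne').comp_hasFDerivAt q (hD q hq).2.1
      simp only [div_eq_mul_inv]
      refine ((hA q hq).2.1.fun_mul h1).congr_fderiv ?_
      ext e
      simp only [add_apply, sub_apply, smul_apply, smul_eq_mul]
      field_simp
      ring
    rw [hd.fderiv]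
    refine (norm_sub_le _ _).trans (add_le_add ?_ ?_)
    · rw [norm_smul, Real.norm_eq_abs, abs_of_pos (inv_pos.2 hq0)]
      exact mul_le_mul hinv (hA q hq).2.2 (norm_nonneg _) (inv_nonneg.2 hw.le)
    · rw [norm_smul, Real.norm_eq_abs, abs_mul, abs_of_pos (inv_pos.2 hq0), mul_assoc]
      exact mul_le_mul hinv (mul_le_mul (hquot q hq) (hD q hq).2.2 (norm_nonneg _) (abs_nonneg _))
        (mul_nonneg (abs_nonneg _) (norm_nonneg _)) (inv_nonneg.2 hw.le)

theorem Tame.inv_of_le (hf : Tame Ω f) {w : ℝ} (hw : 0 < w) (h : ∀ q ∈ Ω, w ≤ f q) :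
    Tame Ω (fun q => (f q)⁻¹) := by
  have := (Tame.const (Ω := Ω) 1).gradBdd.div hf.gradBdd (C := w⁻¹) hw h (fun q hq => by
    rw [abs_one, inv_mul_eq_div, le_div_iff₀ hw, one_mul]; exact h q hq)
  simpa using this

/-- Composition with a function of one variable having two bounded derivatives on the range. -/
theorem GradBdd.comp_real {h : ℝ → ℝ} {C : ℝ} (hf : GradBdd Ω f)
    (hh : ∀ q ∈ Ω, ContDiffAt ℝ 2 h (f q)) (h1 : ∀ q ∈ Ω, |deriv h (f q)| ≤ C) :
    GradBdd Ω (fun q => h (f q)) := by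
  obtain ⟨A, hA0, hA⟩ := hf.exists_hasFDerivAt
  refine GradBdd.of_hasFDerivAt (C := C * A) (f' := fun q => deriv h (f q) • fderiv ℝ f q)
    fun q hq => ⟨(hh q hq).comp q (hA q hq).1, ?_, ?_⟩
  · exact ((hh q hq).differentiableAt (by norm_num)).hasDerivAt.comp_hasFDerivAt q (hA q hq).2.1
  · rw [norm_smul, Real.norm_eq_abs]
    exact mul_le_mul (h1 q hq) (hA q hq).2.2 (norm_nonneg _) ((abs_nonneg _).trans (h1 q hq))

theorem Tame.sqrt_of_le (hf : Tame Ω f) {w : ℝ} (hw : 0 < w) (h : ∀ q ∈ Ω, w ≤ f q) :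
    Tame Ω (fun q => √(f q)) := by
  obtain ⟨B, -, hB⟩ := hf.exists_abs_le
  refine (hf.gradBdd.comp_real (h := Real.sqrt) (C := 1 / (2 * √w))
    (fun q hq => Real.contDiffAt_sqrt (hw.trans_le (h q hq)).ne') fun q hq => ?_).tame (B := √B)
    fun q hq => ?_
  · have hq0 := hw.trans_le (h q hq)
    rw [(Real.hasDerivAt_sqrt hq0.ne').deriv, abs_of_nonneg (by positivity)]
    have := Real.sqrt_pos.2 hw
    have := Real.sqrt_le_sqrt (h q hq)
    gcongr
  · rw [abs_of_nonneg (Real.sqrt_nonneg _)]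
    exact Real.sqrt_le_sqrt ((le_abs_self _).trans (hB q hq))

theorem GradBdd.sin (hf : GradBdd Ω f) : Tame Ω (fun q => Real.sin (f q)) :=
  (hf.comp_real (h := Real.sin) (C := 1) (fun _ _ => Real.contDiff_sin.contDiffAt)
    fun q _ => by simpa using Real.abs_cos_le_one (f q)).tame (B := 1)
    fun q _ => Real.abs_sin_le_one (f q)

theorem GradBdd.cos (hf : GradBdd Ω f) : Tame Ω (fun q => Real.cos (f q)) :=
  (hf.comp_real (h := Real.cos) (C := 1) (fun _ _ => Real.contDiff_cos.contDiffAt)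
    fun q _ => by simpa using Real.abs_sin_le_one (f q)).tame (B := 1)
    fun q _ => Real.abs_cos_le_one (f q)

theorem gradBdd_clm (L : E →L[ℝ] ℝ) : GradBdd Ω (fun q => L q) :=
  GradBdd.of_hasFDerivAt (C := ‖L‖) fun _ _ => ⟨L.contDiff.contDiffAt, L.hasFDerivAt, le_rfl⟩

/-- The gradient of `√(m + f² + g²)` is bounded when those of `f` and `g` are. -/
theorem GradBdd.sqrt_add_sq (hf : GradBdd Ω f) (hg : GradBdd Ω g) {m : ℝ} (hm : 0 ≤ m)
    (hpos : ∀ q ∈ Ω, 0 < m + f q ^ 2 + g q ^ 2) :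
    GradBdd Ω (fun q => √(m + f q ^ 2 + g q ^ 2)) := by
  obtain ⟨A, hA0, hA⟩ := hf.exists_hasFDerivAt
  obtain ⟨D, hD0, hD⟩ := hg.exists_hasFDerivAt
  refine GradBdd.of_hasFDerivAt (C := A + D)
    (f' := fun q => (f q / √(m + f q ^ 2 + g q ^ 2)) • fderiv ℝ f q
      + (g q / √(m + f q ^ 2 + g q ^ 2)) • fderiv ℝ g q) fun q hq => ⟨?_, ?_, ?_⟩
  · exact (Real.contDiffAt_sqrt (hpos q hq).ne').comp q
      ((contDiffAt_const.add ((hA q hq).1.pow 2)).add ((hD q hq).1.pow 2))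
  · have h1 : HasFDerivAt (fun q => m + f q ^ 2 + g q ^ 2)
        ((2 * f q) • fderiv ℝ f q + (2 * g q) • fderiv ℝ g q) q := by
      have h2 := (((hA q hq).2.1.pow 2).const_add m).fun_add ((hD q hq).2.1.pow 2)
      refine h2.congr_fderiv ?_
      ext e
      simp
      try ring
    have h3 := (Real.hasDerivAt_sqrt (hpos q hq).ne').comp_hasFDerivAt q h1
    refine h3.congr_fderiv ?_
    have := Real.sqrt_pos.2 (hpos q hq)
    ext e
    simp only [add_apply, smul_apply, smul_eq_mul]
    field_simp
  · have hs := Real.sqrt_pos.2 (hpos q hq)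
    have key : ∀ a, a ^ 2 ≤ m + f q ^ 2 + g q ^ 2 → |a / √(m + f q ^ 2 + g q ^ 2)| ≤ 1 := by
      intro a ha
      rw [abs_div, abs_of_pos hs, div_le_one hs]
      exact Real.abs_le_sqrt ha
    refine (norm_add_le _ _).trans (add_le_add ?_ ?_)
    · rw [norm_smul, Real.norm_eq_abs]
      calc _ ≤ 1 * ‖fderiv ℝ f q‖ := mul_le_mul_of_nonneg_right
            (key _ (by nlinarith [sq_nonneg (g q)])) (norm_nonneg _)
        _ ≤ A := by rw [one_mul]; exact (hA q hq).2.2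
    · rw [norm_smul, Real.norm_eq_abs]
      calc _ ≤ 1 * ‖fderiv ℝ g q‖ := mul_le_mul_of_nonneg_right
            (key _ (by nlinarith [sq_nonneg (f q)])) (norm_nonneg _)
        _ ≤ D := by rw [one_mul]; exact (hD q hq).2.2

theorem Tame.congr_of_isOpen {U : Set E} (hU : IsOpen U) (hΩ : Ω ⊆ U) (h : EqOn f g U)
    (hg : Tame Ω g) : Tame Ω f := by
  obtain ⟨C, hC⟩ := hg
  refine ⟨C, fun q hq => ?_⟩
  have he : f =ᶠ[𝓝 q] g := h.eventuallyEq_of_mem (hU.mem_nhds (hΩ hq))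
  rw [he.fderiv_eq, h (hΩ hq)]
  exact ⟨(hC q hq).1.congr_of_eventuallyEq he, (hC q hq).2⟩

end Tame

/-! ### The current-compensating term -/

theorem lookahead_pos {μ : ℝ} (hμ : 0 < μ) (x y : ℝ) : 0 < lookahead μ x y :=
  Real.sqrt_pos.2 (by positivity)

theorem utd_sq (ud v : ℝ) : utd ud v ^ 2 = ud ^ 2 + v ^ 2 := Real.sq_sqrt (by positivity)

theorem utd_pos {ud : ℝ} (h : 0 < ud) (v : ℝ) : 0 < utd ud v := Real.sqrt_pos.2 (by positivity)

/-- Implicit differentiation of `-a s² - 2 b s - c = 0`, whose positive root is `gRatio a b c`. -/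
theorem hasDerivWithinAt_gRatio {a b c : ℝ → ℝ} {a' b' c' t : ℝ} {J : Set ℝ}
    (ha : HasDerivWithinAt a a' J t) (hb : HasDerivWithinAt b b' J t)
    (hc : HasDerivWithinAt c c' J t) (ha0 : a t ≠ 0) (hD : 0 < b t ^ 2 - a t * c t) :
    HasDerivWithinAt (fun s => gRatio (a s) (b s) (c s))
      (gRatio (a t) (b t) (c t) ^ 2 / (2 * √(b t ^ 2 - a t * c t)) * a'
        + gRatio (a t) (b t) (c t) / √(b t ^ 2 - a t * c t) * b'
        + 1 / (2 * √(b t ^ 2 - a t * c t)) * c') J t := by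
  have h1 := ((hb.fun_pow 2).fun_sub (ha.fun_mul hc)).sqrt hD.ne'
  have h2 := (hb.fun_add h1).fun_div ha.fun_neg (neg_ne_zero.2 ha0)
  refine h2.congr_deriv ?_
  have hR := Real.sqrt_pos.2 hD
  have hR2 : √(b t ^ 2 - a t * c t) ^ 2 = b t ^ 2 - a t * c t := Real.sq_sqrt hD.le
  unfold gRatio
  generalize √(b t ^ 2 - a t * c t) = R at *
  have hc' : c t = (b t ^ 2 - R ^ 2) / a t := by rw [hR2]; field_simp; ring
  rw [hc']
  field_simp
  push_cast
  ring

namespace Setup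
variable (S : Setup)

/-! ### Normalised guidance quantities -/

/-- `y_{b/p} / Δ`. -/
def ζ (q : Args) : ℝ := q.y / S.Δ q

/-- `V̂_N / u_td`. -/
def ν (q : Args) : ℝ := q.VN / utd q.ud q.v

/-- `√(b² - a c)` divided by `Δ u_td`. -/
def disc (q : Args) : ℝ := √(1 + S.ζ q ^ 2 - ν q ^ 2)

/-- `√E / Δ`, the secant of the line-of-sight angle. -/
def σ (q : Args) : ℝ := (S.ζ q * ν q + S.disc q) / (1 - ν q ^ 2)

/-- The guidance law is defined: `u_rd > 0` and `V̂_N² < u_td²`. -/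
def Guided (q : Args) : Prop := 0 < q.ud ∧ q.VN ^ 2 < q.ud ^ 2 + q.v ^ 2

variable {S} {q : Args}

theorem Δ_pos (S : Setup) (q : Args) : 0 < S.Δ q := lookahead_pos S.μ_pos _ _

theorem Guided.utd_pos (hq : Guided q) : 0 < utd q.ud q.v := VesselPF.utd_pos hq.1 _

theorem Guided.ν_sq_lt (hq : Guided q) : ν q ^ 2 < 1 := by
  have := hq.utd_pos
  rw [ν, div_pow, div_lt_one (by positivity), utd_sq]
  exact hq.2

theorem Guided.disc_sq (hq : Guided q) : S.disc q ^ 2 = 1 + S.ζ q ^ 2 - ν q ^ 2 :=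
  Real.sq_sqrt (by nlinarith [hq.ν_sq_lt, sq_nonneg (S.ζ q)])

theorem Guided.disc_pos (hq : Guided q) : 0 < S.disc q :=
  Real.sqrt_pos.2 (by nlinarith [hq.ν_sq_lt, sq_nonneg (S.ζ q)])

theorem Guided.σ_pos (hq : Guided q) : 0 < S.σ q := by
  have h1 := hq.ν_sq_lt
  have h2 : |S.ζ q * ν q| < S.disc q := by
    apply abs_lt_of_sq_lt_sq _ (hq.disc_pos).le
    rw [hq.disc_sq]
    nlinarith [mul_pos (sub_pos.2 h1) (by positivity : 0 < 1 + S.ζ q ^ 2)]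
  exact div_pos (by linarith [(abs_lt.1 h2).1]) (by linarith)

/-- The equation that defines the current-compensating term: with `g = Δ ν σ` it says that
`(Δ σ)² = Δ² + (y_{b/p} + g)²`, so `σ` is the secant of the line-of-sight angle. -/
theorem Guided.σ_sq (hq : Guided q) : S.σ q ^ 2 = 1 + (S.ζ q + ν q * S.σ q) ^ 2 := by
  have h1 : 1 - ν q ^ 2 ≠ 0 := (sub_pos.2 (hq.ν_sq_lt)).ne'
  have h2 := hq.disc_sq (S := S)
  have h3 : S.disc q = S.σ q * (1 - ν q ^ 2) - S.ζ q * ν q := by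
    rw [σ]; field_simp; ring
  rw [h3] at h2
  apply mul_left_cancel₀ h1
  linear_combination h2

theorem Guided.one_le_σ (hq : Guided q) : 1 ≤ S.σ q := by
  nlinarith [hq.σ_pos (S := S), hq.σ_sq (S := S), sq_nonneg (S.ζ q + ν q * S.σ q)]

theorem y_eq (S : Setup) (q : Args) : q.y = S.Δ q * S.ζ q := by
  have := S.Δ_pos q
  rw [ζ]; field_simp

theorem Guided.VN_eq (hq : Guided q) : q.VN = utd q.ud q.v * ν q := by
  have := hq.utd_pos
  rw [ν]; field_simp

theorem Guided.coefA_eq (hq : Guided q) :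
    coefA q.ud q.v q.VN = -(utd q.ud q.v ^ 2 * (1 - ν q ^ 2)) := by
  rw [coefA, hq.VN_eq]; ring

theorem Guided.coefA_ne (hq : Guided q) : coefA q.ud q.v q.VN ≠ 0 := by
  rw [coefA, utd_sq]; linarith [hq.2]

theorem coefC_eq (S : Setup) (q : Args) :
    coefC S.μ q.x q.y = S.Δ q ^ 2 * (1 + S.ζ q ^ 2) := by
  change S.Δ q ^ 2 + q.y ^ 2 = _
  conv_lhs => rw [S.y_eq q]
  ring

theorem Guided.discr_eq (S : Setup) (hq : Guided q) :
    coefB q.VN q.y ^ 2 - coefA q.ud q.v q.VN * coefC S.μ q.x q.y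
      = (S.Δ q * utd q.ud q.v * S.disc q) ^ 2 := by
  rw [hq.coefA_eq, S.coefC_eq, mul_pow, hq.disc_sq, coefB, hq.VN_eq, S.y_eq q]
  have : S.ζ q ^ 2 * ν q ^ 2 + (1 - ν q ^ 2) * (1 + S.ζ q ^ 2) = 1 + S.ζ q ^ 2 - ν q ^ 2 := by
    ring
  rw [← this]; ring

theorem Guided.discr_pos (S : Setup) (hq : Guided q) :
    0 < coefB q.VN q.y ^ 2 - coefA q.ud q.v q.VN * coefC S.μ q.x q.y := by
  rw [hq.discr_eq S]
  have := hq.utd_pos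
  have := hq.disc_pos (S := S)
  have := S.Δ_pos q
  positivity

theorem Guided.sqrt_discr (S : Setup) (hq : Guided q) :
    √(coefB q.VN q.y ^ 2 - coefA q.ud q.v q.VN * coefC S.μ q.x q.y)
      = S.Δ q * utd q.ud q.v * S.disc q := by
  have := hq.utd_pos
  have := hq.disc_pos (S := S)
  have := S.Δ_pos q
  rw [hq.discr_eq S, Real.sqrt_sq (by positivity)]

theorem Guided.ratio_eq (hq : Guided q) : S.ratio q = S.Δ q * S.σ q / utd q.ud q.v := by
  have h1 : 1 - ν q ^ 2 ≠ 0 := (sub_pos.2 (hq.ν_sq_lt)).ne'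
  have := hq.utd_pos
  rw [ratio, gRatio, hq.sqrt_discr S, hq.coefA_eq, coefB, σ]
  conv_lhs => rw [hq.VN_eq, S.y_eq q]
  field_simp

theorem Guided.g_eq (hq : Guided q) : S.g q = S.Δ q * (ν q * S.σ q) := by
  have := hq.utd_pos
  have h : S.g q = q.VN * S.ratio q := rfl
  rw [h, hq.ratio_eq, hq.VN_eq]; field_simp

theorem Guided.den_eq (hq : Guided q) : S.den q = (S.Δ q * S.σ q) ^ 2 := by
  rw [den, hq.g_eq, S.y_eq q, mul_pow, hq.σ_sq]; ring

theorem Guided.sqrt_den (hq : Guided q) : √(S.den q) = S.Δ q * S.σ q := by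
  have := hq.σ_pos (S := S)
  have := S.Δ_pos q
  rw [hq.den_eq, Real.sqrt_sq (by positivity)]

theorem Guided.ga_eq (hq : Guided q) :
    S.ga q = S.Δ q * ν q * S.σ q ^ 2 / (2 * utd q.ud q.v ^ 2 * S.disc q) := by
  have h := hasDerivWithinAt_gRatio (J := univ) (hasDerivWithinAt_id (coefA q.ud q.v q.VN) univ)
    (hasDerivWithinAt_const _ _ (coefB q.VN q.y)) (hasDerivWithinAt_const _ _ (coefC S.μ q.x q.y))
    hq.coefA_ne (hq.discr_pos S)
  have h' := (h.hasDerivAt univ_mem).const_mul q.VN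
  simp only [id] at h'
  rw [ga, show (fun s => gFun q.VN s (coefB q.VN q.y) (coefC S.μ q.x q.y)) = fun s => q.VN *
    gRatio s (coefB q.VN q.y) (coefC S.μ q.x q.y) from rfl, h'.deriv, hq.sqrt_discr S]
  have h3 : gRatio (coefA q.ud q.v q.VN) (coefB q.VN q.y) (coefC S.μ q.x q.y) = S.ratio q := rfl
  rw [h3, hq.ratio_eq]
  have := hq.utd_pos
  have := hq.disc_pos (S := S)
  have := S.Δ_pos q
  conv_lhs => rw [hq.VN_eq]
  field_simp
  ring

theorem Guided.gb_eq (hq : Guided q) :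
    S.gb q = ν q * S.σ q / (utd q.ud q.v * S.disc q) := by
  have h := hasDerivWithinAt_gRatio (J := univ) (hasDerivWithinAt_const (coefB q.VN q.y) univ
    (coefA q.ud q.v q.VN)) (hasDerivWithinAt_id _ _) (hasDerivWithinAt_const _ _
    (coefC S.μ q.x q.y)) hq.coefA_ne (hq.discr_pos S)
  have h' := (h.hasDerivAt univ_mem).const_mul q.VN
  simp only [id] at h'
  rw [gb, show (fun s => gFun q.VN (coefA q.ud q.v q.VN) s (coefC S.μ q.x q.y)) = fun s => q.VN *
    gRatio (coefA q.ud q.v q.VN) s (coefC S.μ q.x q.y) from rfl, h'.deriv, hq.sqrt_discr S]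
  have h3 : gRatio (coefA q.ud q.v q.VN) (coefB q.VN q.y) (coefC S.μ q.x q.y) = S.ratio q := rfl
  rw [h3, hq.ratio_eq]
  have := hq.utd_pos
  have := hq.disc_pos (S := S)
  have := S.Δ_pos q
  conv_lhs => rw [hq.VN_eq]
  field_simp
  ring

theorem Guided.gc_eq (hq : Guided q) : S.gc q = ν q / (2 * S.Δ q * S.disc q) := by
  have h := hasDerivWithinAt_gRatio (J := univ) (hasDerivWithinAt_const (coefC S.μ q.x q.y) univ
    (coefA q.ud q.v q.VN)) (hasDerivWithinAt_const _ _ (coefB q.VN q.y))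
    (hasDerivWithinAt_id _ _) hq.coefA_ne (hq.discr_pos S)
  have h' := (h.hasDerivAt univ_mem).const_mul q.VN
  simp only [id] at h'
  rw [gc, show (fun s => gFun q.VN (coefA q.ud q.v q.VN) (coefB q.VN q.y) s) = fun s => q.VN *
    gRatio (coefA q.ud q.v q.VN) (coefB q.VN q.y) s from rfl, h'.deriv, hq.sqrt_discr S]
  have := hq.utd_pos
  have := hq.disc_pos (S := S)
  have := S.Δ_pos q
  conv_lhs => rw [hq.VN_eq]
  field_simp
  ring

theorem Δx_eq (S : Setup) (q : Args) : S.Δx q = q.x / S.Δ q := by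
  have h : HasDerivAt (fun s => lookahead S.μ s q.y) (q.x / S.Δ q) q.x := by
    have h1 := (((hasDerivAt_id q.x).fun_pow 2).const_add S.μ).add_const (q.y ^ 2)
    have hp : S.μ + q.x ^ 2 + q.y ^ 2 ≠ 0 := by have := S.μ_pos; positivity
    refine (h1.sqrt hp).congr_deriv ?_
    simp only [id, Δ, lookahead]
    have := Real.sqrt_pos.2 (show 0 < S.μ + q.x ^ 2 + q.y ^ 2 by have := S.μ_pos; positivity)
    field_simp
    push_cast
    ring
  exact h.deriv

theorem Δy_eq (S : Setup) (q : Args) : S.Δy q = q.y / S.Δ q := by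
  have h : HasDerivAt (fun s => lookahead S.μ q.x s) (q.y / S.Δ q) q.y := by
    have h1 := ((hasDerivAt_id q.y).fun_pow 2).const_add (S.μ + q.x ^ 2)
    have hp : S.μ + q.x ^ 2 + q.y ^ 2 ≠ 0 := by have := S.μ_pos; positivity
    refine (h1.sqrt hp).congr_deriv ?_
    simp only [id, Δ, lookahead]
    have := Real.sqrt_pos.2 (show 0 < S.μ + q.x ^ 2 + q.y ^ 2 by have := S.μ_pos; positivity)
    field_simp
    push_cast
    ring
  exact h.deriv

theorem Guided.losAngle_eq (hq : Guided q) :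
    losAngle S.μ q.ud q.v q.VN q.x q.y = Real.arctan (S.ζ q + ν q * S.σ q) := by
  have h : losAngle S.μ q.ud q.v q.VN q.x q.y = Real.arctan ((q.y + S.g q) / S.Δ q) := rfl
  have := S.Δ_pos q
  rw [h, hq.g_eq]
  conv_lhs => rw [S.y_eq q]
  congr 1
  field_simp

theorem Guided.cos_los (hq : Guided q) :
    Real.cos (losAngle S.μ q.ud q.v q.VN q.x q.y) = (S.σ q)⁻¹ := by
  rw [hq.losAngle_eq, Real.cos_arctan, ← hq.σ_sq, Real.sqrt_sq (hq.σ_pos).le, one_div]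

theorem Guided.sin_los (hq : Guided q) :
    Real.sin (losAngle S.μ q.ud q.v q.VN q.x q.y) = (S.ζ q + ν q * S.σ q) * (S.σ q)⁻¹ := by
  rw [hq.losAngle_eq, Real.sin_arctan, ← hq.σ_sq, Real.sqrt_sq (hq.σ_pos).le, div_eq_mul_inv]

theorem Guided.sqrt_one_add_sq (hq : Guided q) :
    √(1 + (q.v / q.ud) ^ 2) = utd q.ud q.v / q.ud := by
  have := hq.1
  rw [utd, Real.sqrt_eq_iff_mul_self_eq (by positivity) (by positivity)]
  have h := Real.mul_self_sqrt (show 0 ≤ q.ud ^ 2 + q.v ^ 2 by positivity)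
  field_simp
  linear_combination -h

theorem Guided.cos_crab (hq : Guided q) :
    Real.cos (Real.arctan (q.v / q.ud)) = q.ud / utd q.ud q.v := by
  rw [Real.cos_arctan, hq.sqrt_one_add_sq, one_div_div]

theorem Guided.sin_crab (hq : Guided q) :
    Real.sin (Real.arctan (q.v / q.ud)) = q.v / utd q.ud q.v := by
  have := hq.1
  have := hq.utd_pos
  rw [Real.sin_arctan, hq.sqrt_one_add_sq]
  field_simp

/-- In normalised quantities `C_r` is polynomial in bounded functions. -/
theorem Guided.Cr_eq (hq : Guided q) :
    S.Cr q = 1 + S.X q.u * (1 / utd q.ud q.v) * (q.ud / utd q.ud q.v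
      - q.v / utd q.ud q.v * ν q * (S.disc q)⁻¹) := by
  have := hq.utd_pos
  have := hq.disc_pos (S := S)
  have := hq.σ_pos (S := S)
  have := S.Δ_pos q
  rw [Cr, hq.ga_eq, hq.den_eq, ← utd_sq]
  field_simp

end Setup

namespace Setup
variable (S : Setup) (q : Args)

/-! ### The yaw-rate reference divided by the total speed -/

/-- `cos (ψ - γ)`, expanded. -/
def cosRel : ℝ :=
  Real.cos q.ψe * (q.ud / utd q.ud q.v * (S.σ q)⁻¹
      - q.v / utd q.ud q.v * ((S.ζ q + ν q * S.σ q) * (S.σ q)⁻¹))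
    + Real.sin q.ψe * (q.v / utd q.ud q.v * (S.σ q)⁻¹
      + q.ud / utd q.ud q.v * ((S.ζ q + ν q * S.σ q) * (S.σ q)⁻¹))

/-- `sin (ψ - γ)`, expanded. -/
def sinRel : ℝ :=
  Real.sin q.ψe * (q.ud / utd q.ud q.v * (S.σ q)⁻¹
      - q.v / utd q.ud q.v * ((S.ζ q + ν q * S.σ q) * (S.σ q)⁻¹))
    - Real.cos q.ψe * (q.v / utd q.ud q.v * (S.σ q)⁻¹
      + q.ud / utd q.ud q.v * ((S.ζ q + ν q * S.σ q) * (S.σ q)⁻¹))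

/-- `θ̇ / u_td`. -/
def θdotN : ℝ :=
  q.u * (1 / utd q.ud q.v) * S.cosRel q - q.v / utd q.ud q.v * S.sinRel q
    + S.kδ * (q.x / √(1 + q.x ^ 2)) * (1 / utd q.ud q.v) + q.VT * (1 / utd q.ud q.v)

/-- The rate of `V̂_N` divided by `u_td`. -/
def VNdotN : ℝ :=
  (S.ky2 * q.ye * Real.cos (S.γ q.θ) - S.kx2 * q.xe * Real.sin (S.γ q.θ)) * (1 / utd q.ud q.v)
    - S.κ q.θ * S.θdotN q * q.VT

/-- `G₁ / u_td`. -/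
def G1N : ℝ :=
  (1 - Real.cos q.ψe) * ((S.ζ q + ν q * S.σ q) * (S.σ q)⁻¹)
    + (q.u - q.ud) * S.sinRel q * (1 / utd q.ud q.v) + (S.σ q)⁻¹ * Real.sin q.ψe

/-- The known rate of `x_{b/p}` divided by `Δ u_td`. -/
def xKnownN : ℝ :=
  -S.kδ * (q.x / √(1 + q.x ^ 2)) * (1 / S.Δ q) * (1 / utd q.ud q.v)
    + S.ζ q * S.κ q.θ * S.θdotN q

/-- The known rate of `y_{b/p}` divided by `Δ u_td`. -/
def yKnownN : ℝ :=
  1 / S.Δ q * (-S.ζ q * (S.σ q)⁻¹ + S.G1N q) - q.x / S.Δ q * S.κ q.θ * S.θdotN q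

/-- The known rate of `Δ` divided by `Δ u_td`. -/
def ΔKnownN : ℝ := q.x / S.Δ q * S.xKnownN q + S.ζ q * S.yKnownN q

/-- `r_d / u_td`, a polynomial in quantities that stay bounded together with their gradients. -/
def rdN : ℝ :=
  -(S.Cr q)⁻¹ *
    (-S.κ q.θ * S.θdotN q
      + (S.Y q.u * (q.v / utd q.ud q.v) * (q.ud / utd q.ud q.v)
          - q.dud * (q.v / utd q.ud q.v) * (1 / utd q.ud q.v)) * (1 / utd q.ud q.v)
      + S.VNdotN q * (1 / utd q.ud q.v) * (S.σ q)⁻¹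
      + S.VNdotN q * ν q * (1 / utd q.ud q.v) * S.ζ q * (S.disc q)⁻¹ * (S.σ q)⁻¹
      + ν q * (S.disc q)⁻¹ * (1 / utd q.ud q.v) ^ 2
          * (q.VN * S.VNdotN q - q.ud / utd q.ud q.v * q.dud)
      - ν q * (S.disc q)⁻¹ * (1 / utd q.ud q.v) * S.Y q.u * (q.v / utd q.ud q.v) ^ 2
      + (S.σ q)⁻¹ ^ 2 * (1 + ν q * S.ζ q * (S.disc q)⁻¹ + ν q ^ 2 * S.σ q * (S.disc q)⁻¹)
          * S.yKnownN q
      + ν q * (S.disc q)⁻¹ * (S.σ q)⁻¹ ^ 2 * S.ΔKnownN q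
      - (S.ζ q + ν q * S.σ q) * (S.σ q)⁻¹ ^ 2 * S.ΔKnownN q)

variable {S q}

theorem Guided.cos_relHeading (hq : Guided q) : Real.cos (S.relHeading q) = S.cosRel q := by
  rw [relHeading, sub_sub, Real.cos_sub, Real.cos_add, Real.sin_add, hq.cos_los, hq.sin_los,
    hq.cos_crab, hq.sin_crab, cosRel]

theorem Guided.sin_relHeading (hq : Guided q) : Real.sin (S.relHeading q) = S.sinRel q := by
  rw [relHeading, sub_sub, Real.sin_sub, Real.cos_add, Real.sin_add, hq.cos_los, hq.sin_los,
    hq.cos_crab, hq.sin_crab, sinRel]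

theorem Guided.θdot_eq (hq : Guided q) : S.θdot q = utd q.ud q.v * S.θdotN q := by
  have := hq.utd_pos
  rw [θdot, updateLaw, hq.cos_relHeading, hq.sin_relHeading, θdotN]
  field_simp

theorem Guided.VNdot_eq (hq : Guided q) : S.VNdot q = utd q.ud q.v * S.VNdotN q := by
  have := hq.utd_pos
  rw [VNdot, hq.θdot_eq, VNdotN]
  field_simp

theorem Guided.G1_eq (hq : Guided q) : S.G1 q = utd q.ud q.v * S.G1N q := by
  have := hq.utd_pos
  rw [G1, hq.sin_relHeading, hq.sin_los, hq.cos_los, G1N]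
  field_simp

theorem Guided.xKnown_eq (hq : Guided q) :
    S.xKnown q = utd q.ud q.v * S.Δ q * S.xKnownN q := by
  have := hq.utd_pos
  have := S.Δ_pos q
  rw [xKnown, hq.θdot_eq, xKnownN]
  conv_lhs => rw [S.y_eq q]
  field_simp

theorem Guided.yKnown_eq (hq : Guided q) :
    S.yKnown q = utd q.ud q.v * S.Δ q * S.yKnownN q := by
  have := hq.utd_pos
  have := S.Δ_pos q
  have := hq.σ_pos (S := S)
  rw [yKnown, hq.θdot_eq, hq.G1_eq, hq.sqrt_den, yKnownN]
  conv_lhs => rw [S.y_eq q]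
  field_simp

theorem Guided.ΔKnown_eq (hq : Guided q) :
    S.ΔKnown q = utd q.ud q.v * S.Δ q * S.ΔKnownN q := by
  rw [ΔKnown, hq.xKnown_eq, hq.yKnown_eq, Δx_eq, Δy_eq, ΔKnownN, ζ]
  ring

/-- The factorisation of `r_d` that shows its linear growth in the sway velocity. -/
theorem Guided.rd_eq (hq : Guided q) : S.rd q = utd q.ud q.v * S.rdN q := by
  have := hq.utd_pos
  have := S.Δ_pos q
  have := hq.σ_pos (S := S)
  have := hq.disc_pos (S := S)
  rw [rd, rdN, mul_left_comm (utd q.ud q.v)]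
  congr 1
  rw [hq.θdot_eq, hq.VNdot_eq, hq.yKnown_eq, hq.ΔKnown_eq, hq.ratio_eq, hq.ga_eq, hq.gb_eq,
    hq.gc_eq, hq.g_eq, hq.den_eq, ← utd_sq]
  have hy := S.y_eq q
  have hv : q.VN = utd q.ud q.v * ν q := hq.VN_eq
  generalize S.VNdotN q = A1 at *
  generalize S.θdotN q = A2 at *
  generalize S.yKnownN q = A3 at *
  generalize S.ΔKnownN q = A4 at *
  generalize S.Y q.u = A5 at *
  rw [hy, hv]
  generalize S.σ q = A6 at *
  generalize S.Δ q = A7 at *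
  generalize S.disc q = A8 at *
  generalize S.ζ q = A9 at *
  generalize ν q = A10 at *
  generalize utd q.ud q.v = A11 at *
  field_simp
  ring

end Setup

/-! ### Bounds on the yaw-rate reference and its gradient -/

/-- The arguments of `r_d` as a vector. -/
def toArgs (e : Fin 12 → ℝ) : Args :=
  ⟨e 0, e 1, e 2, e 3, e 4, e 5, e 6, e 7, e 8, e 9, e 10, e 11⟩

/-- Bounds on all the arguments of `r_d` except `θ, v_r, x_{b/p}, y_{b/p}, ψ̃`, which are left free,
together with a quantitative form of `V̂_N² < u_td²`. -/
structure InTube (η B : ℝ) (q : Args) : Prop where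
  ud_ge : η ≤ q.ud
  ud_le : |q.ud| ≤ B
  dud_le : |q.dud| ≤ B
  u_le : |q.u| ≤ B
  VT_le : |q.VT| ≤ B
  VN_le : |q.VN| ≤ B
  xe_le : |q.xe| ≤ B
  ye_le : |q.ye| ≤ B
  gap : η + q.VN ^ 2 ≤ q.ud ^ 2 + q.v ^ 2

/-- The vectors of arguments that satisfy the bounds `InTube`. -/
def tube (η B : ℝ) : Set (Fin 12 → ℝ) := {e | InTube η B (toArgs e)}

/-- The vectors of arguments for which the guidance law is defined. -/
def guidedSet : Set (Fin 12 → ℝ) := {e | Setup.Guided (toArgs e)}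

theorem isOpen_guidedSet : IsOpen guidedSet := by
  have : guidedSet = {e | 0 < e 3} ∩ {e : Fin 12 → ℝ | e 6 ^ 2 < e 3 ^ 2 + e 1 ^ 2} := rfl
  rw [this]
  exact (isOpen_lt (by fun_prop) (by fun_prop)).inter (isOpen_lt (by fun_prop) (by fun_prop))

section Tube

variable {η B : ℝ}

theorem tube_subset_guidedSet (hη : 0 < η) : tube η B ⊆ guidedSet := fun _ he =>
  ⟨hη.trans_le he.ud_ge, by linarith [he.gap]⟩

theorem le_utd {q : Args} (h : η ≤ q.ud) : η ≤ utd q.ud q.v :=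
  h.trans (Real.le_sqrt_of_sq_le (by nlinarith [sq_nonneg q.v]))

namespace Setup

section Atoms

theorem gradBdd_coord {Ω : Set (Fin 12 → ℝ)} (i : Fin 12) : GradBdd Ω (fun e => e i) :=
  gradBdd_clm (ContinuousLinearMap.proj (R := ℝ) (φ := fun _ : Fin 12 => ℝ) i)

theorem tame_coord {Ω : Set (Fin 12 → ℝ)} (i : Fin 12) (h : ∀ e ∈ Ω, |e i| ≤ B) :
    Tame Ω (fun e => e i) :=
  (gradBdd_coord i).tame h

theorem gradBdd_utd (hη : 0 < η) :
    GradBdd (tube η B) (fun e => utd (toArgs e).ud (toArgs e).v) := by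
  have := (gradBdd_coord (Ω := tube η B) 3).sqrt_add_sq (gradBdd_coord 1) (m := 0) le_rfl
    (fun e he => by
      have : 0 < e 3 := hη.trans_le he.ud_ge
      positivity)
  simpa only [zero_add] using! this

theorem gradBdd_Δ (S : Setup) : GradBdd (tube η B) (fun e => S.Δ (toArgs e)) :=
  (gradBdd_coord (Ω := tube η B) 8).sqrt_add_sq (gradBdd_coord 7) S.μ_pos.le
    (fun e he => by have := S.μ_pos; positivity)

theorem tame_div_utd (hη : 0 < η) {f : (Fin 12 → ℝ) → ℝ} (hf : GradBdd (tube η B) f) {C : ℝ}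
    (h : ∀ e ∈ tube η B, |f e| ≤ C * utd (toArgs e).ud (toArgs e).v) :
    Tame (tube η B) (fun e => f e / utd (toArgs e).ud (toArgs e).v) :=
  hf.div (gradBdd_utd hη) hη (fun _ he => le_utd he.ud_ge) h

theorem tame_div_Δ (S : Setup) {f : (Fin 12 → ℝ) → ℝ} (hf : GradBdd (tube η B) f) {C : ℝ}
    (h : ∀ e ∈ tube η B, |f e| ≤ C * S.Δ (toArgs e)) :
    Tame (tube η B) (fun e => f e / S.Δ (toArgs e)) :=
  hf.div S.gradBdd_Δ (Real.sqrt_pos.2 S.μ_pos)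
    (fun e _ => Real.sqrt_le_sqrt (by nlinarith [sq_nonneg (toArgs e).x, sq_nonneg (toArgs e).y])) h

theorem tame_p (hη : 0 < η) :
    Tame (tube η B) (fun e => 1 / utd (toArgs e).ud (toArgs e).v) :=
  tame_div_utd hη (Tame.const 1).gradBdd (C := η⁻¹) fun e he => by
    rw [abs_one, inv_mul_eq_div, le_div_iff₀ hη, one_mul]; exact le_utd he.ud_ge

theorem abs_ud_le_utd (ud v : ℝ) : |ud| ≤ utd ud v :=
  Real.abs_le_sqrt (by nlinarith [sq_nonneg v])

theorem abs_v_le_utd (ud v : ℝ) : |v| ≤ utd ud v :=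
  Real.abs_le_sqrt (by nlinarith [sq_nonneg ud])

theorem tame_cosCrab (hη : 0 < η) :
    Tame (tube η B) (fun e => (toArgs e).ud / utd (toArgs e).ud (toArgs e).v) :=
  tame_div_utd hη (gradBdd_coord 3) (C := 1) fun e _ => by
    rw [one_mul]; exact abs_ud_le_utd _ _

theorem tame_sinCrab (hη : 0 < η) :
    Tame (tube η B) (fun e => (toArgs e).v / utd (toArgs e).ud (toArgs e).v) :=
  tame_div_utd hη (gradBdd_coord 1) (C := 1) fun e _ => by
    rw [one_mul]; exact abs_v_le_utd _ _

theorem tame_ν (hη : 0 < η) : Tame (tube η B) (fun e => ν (toArgs e)) :=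
  tame_div_utd hη (gradBdd_coord 6) (C := 1) fun e he => by
    rw [one_mul]; exact Real.abs_le_sqrt (show (toArgs e).VN ^ 2 ≤ _ by linarith [he.gap, hη])

theorem tame_ξ (S : Setup) : Tame (tube η B) (fun e => (toArgs e).x / S.Δ (toArgs e)) :=
  tame_div_Δ S (gradBdd_coord 8) (C := 1) fun e _ => by
    rw [one_mul]
    refine Real.abs_le_sqrt ?_
    change e 8 ^ 2 ≤ S.μ + e 8 ^ 2 + e 7 ^ 2
    nlinarith [S.μ_pos, sq_nonneg (e 7)]

theorem tame_ζ (S : Setup) : Tame (tube η B) (fun e => S.ζ (toArgs e)) :=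
  tame_div_Δ S (gradBdd_coord 7) (C := 1) fun e _ => by
    rw [one_mul]
    refine Real.abs_le_sqrt ?_
    change e 7 ^ 2 ≤ S.μ + e 8 ^ 2 + e 7 ^ 2
    nlinarith [S.μ_pos, sq_nonneg (e 8)]

theorem tame_invΔ (S : Setup) : Tame (tube η B) (fun e => 1 / S.Δ (toArgs e)) := by
  have hm := Real.sqrt_pos.2 S.μ_pos
  refine tame_div_Δ S (Tame.const 1).gradBdd (C := (√S.μ)⁻¹) fun e _ => ?_
  rw [abs_one, inv_mul_eq_div, le_div_iff₀ hm, one_mul]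
  exact Real.sqrt_le_sqrt (by nlinarith [sq_nonneg (toArgs e).x, sq_nonneg (toArgs e).y])

theorem tame_sat : Tame (tube η B) (fun e => (toArgs e).x / √(1 + (toArgs e).x ^ 2)) := by
  have hW := (gradBdd_coord (Ω := tube η B) 8).sqrt_add_sq (Tame.const 0).gradBdd (m := 1)
    zero_le_one
    (fun e he => by positivity)
  simp only [ne_eq, OfNat.ofNat_ne_zero, not_false_eq_true, zero_pow, add_zero] at hW
  refine (gradBdd_coord (Ω := tube η B) 8).div hW one_pos (C := 1) (fun e _ => ?_) fun e _ => ?_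
  · exact Real.le_sqrt_of_sq_le (by nlinarith [sq_nonneg (e 8)])
  · rw [one_mul]; exact Real.abs_le_sqrt (show e 8 ^ 2 ≤ 1 + e 8 ^ 2 by linarith)

theorem tame_comp_θ {h : ℝ → ℝ} {C D : ℝ} (hh : ContDiff ℝ 2 h) (hC : ∀ θ, |h θ| ≤ C)
    (hD : ∀ θ, |deriv h θ| ≤ D) : Tame (tube η B) (fun e => h (toArgs e).θ) :=
  ((gradBdd_coord 0).comp_real (fun _ _ => hh.contDiffAt) fun _ _ => hD _).tame fun _ _ => hC _

theorem two_le_infty : (2 : WithTop ℕ∞) ≤ ∞ := WithTop.coe_le_coe.2 le_top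

theorem contDiff_κ (S : Setup) : ContDiff ℝ ∞ S.κ :=
  (contDiff_infty_iff_deriv.1 S.smooth).2

end Atoms

variable {S : Setup} {Kκ Kκ' : ℝ}

theorem InTube.le_one_sub_ν_sq (hη : 0 < η) {q : Args} (hq : InTube η B q) :
    η / (η + B ^ 2) ≤ 1 - ν q ^ 2 := by
  have hW : 0 < utd q.ud q.v ^ 2 := by have := utd_pos (hη.trans_le hq.ud_ge) q.v; positivity
  have h1 := utd_sq q.ud q.v
  have h2 : q.VN ^ 2 ≤ B ^ 2 := sq_le_sq' (by linarith [(abs_le.1 hq.VN_le).1])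
    (abs_le.1 hq.VN_le).2
  have h3 := hq.gap
  rw [ν, div_pow, le_sub_iff_add_le, div_add_div _ _ (by positivity) hW.ne',
    div_le_one (by positivity)]
  nlinarith [mul_nonneg (sub_nonneg.2 h2) hη.le, mul_nonneg (sub_nonneg.2 h3) (sq_nonneg B),
    sq_nonneg B]

theorem tame_one_sub_inv (hη : 0 < η) :
    Tame (tube η B) (fun e => (1 - ν (toArgs e) ^ 2)⁻¹) :=
  ((Tame.const 1).sub ((tame_ν hη).pow 2)).inv_of_le (w := η / (η + B ^ 2)) (by positivity)
    fun _ he => InTube.le_one_sub_ν_sq hη he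

theorem tame_disc (S : Setup) (hη : 0 < η) : Tame (tube η B) (fun e => S.disc (toArgs e)) :=
  (((Tame.const 1).add ((tame_ζ S).pow 2)).sub ((tame_ν hη).pow 2)).sqrt_of_le
    (w := η / (η + B ^ 2)) (by positivity) fun e he => by
      nlinarith [InTube.le_one_sub_ν_sq hη he, sq_nonneg (S.ζ (toArgs e))]

theorem tame_disc_inv (S : Setup) (hη : 0 < η) :
    Tame (tube η B) (fun e => (S.disc (toArgs e))⁻¹) :=
  (tame_disc S hη).inv_of_le (w := √(η / (η + B ^ 2))) (Real.sqrt_pos.2 (by positivity))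
    fun e he => Real.sqrt_le_sqrt (by
      nlinarith [InTube.le_one_sub_ν_sq hη he, sq_nonneg (S.ζ (toArgs e))])

theorem tame_σ (S : Setup) (hη : 0 < η) : Tame (tube η B) (fun e => S.σ (toArgs e)) := by
  have := (((tame_ζ S).mul (tame_ν hη)).add (tame_disc S hη)).mul (tame_one_sub_inv (B := B) hη)
  simp only [← div_eq_mul_inv] at this
  exact this

theorem tame_σ_inv (S : Setup) (hη : 0 < η) :
    Tame (tube η B) (fun e => (S.σ (toArgs e))⁻¹) :=
  (tame_σ S hη).inv_of_le one_pos fun _ he => (tube_subset_guidedSet hη he).one_le_σ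

theorem tame_X (S : Setup) : Tame (tube η B) (fun e => S.X (toArgs e).u) :=
  ((Tame.const _).mul (tame_coord 2 fun _ he => he.u_le)).add (Tame.const _)

theorem tame_Y (S : Setup) : Tame (tube η B) (fun e => S.Y (toArgs e).u) :=
  ((Tame.const _).mul (tame_coord 2 fun _ he => he.u_le)).sub (Tame.const _)

theorem tame_Cr (S : Setup) (hη : 0 < η) : Tame (tube η B) (fun e => S.Cr (toArgs e)) := by
  refine Tame.congr_of_isOpen isOpen_guidedSet (tube_subset_guidedSet hη)
    (fun e he => Guided.Cr_eq he) ?_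
  exact (Tame.const 1).add (((tame_X S).mul (tame_p hη)).mul ((tame_cosCrab hη).sub
    (((tame_sinCrab hη).mul (tame_ν hη)).mul (tame_disc_inv S hη))))

/-- Arguments in the tube at which `C_r` is bounded below. -/
def tubeCr (S : Setup) (η B c : ℝ) : Set (Fin 12 → ℝ) := tube η B ∩ {e | c ≤ S.Cr (toArgs e)}

theorem tame_cosRel (S : Setup) (hη : 0 < η) : Tame (tube η B) (fun e => S.cosRel (toArgs e)) := by
  have h1 := tame_cosCrab (B := B) hη
  have h2 := tame_sinCrab (B := B) hη
  have h3 := tame_σ_inv (B := B) S hη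
  have h4 := (((tame_ζ S).add ((tame_ν hη).mul (tame_σ S hη))).mul h3)
  have h5 := (gradBdd_coord (Ω := tube η B) 9).cos
  have h6 := (gradBdd_coord (Ω := tube η B) 9).sin
  exact (h5.mul ((h1.mul h3).sub (h2.mul h4))).add (h6.mul ((h2.mul h3).add (h1.mul h4)))

theorem tame_sinRel (S : Setup) (hη : 0 < η) : Tame (tube η B) (fun e => S.sinRel (toArgs e)) := by
  have h1 := tame_cosCrab (B := B) hη
  have h2 := tame_sinCrab (B := B) hη
  have h3 := tame_σ_inv (B := B) S hη
  have h4 := (((tame_ζ S).add ((tame_ν hη).mul (tame_σ S hη))).mul h3)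
  have h5 := (gradBdd_coord (Ω := tube η B) 9).cos
  have h6 := (gradBdd_coord (Ω := tube η B) 9).sin
  exact (h6.mul ((h1.mul h3).sub (h2.mul h4))).sub (h5.mul ((h2.mul h3).add (h1.mul h4)))

theorem tame_θdotN (S : Setup) (hη : 0 < η) :
    Tame (tube η B) (fun e => S.θdotN (toArgs e)) := by
  have hp := tame_p (B := B) hη
  have hu := tame_coord (Ω := tube η B) 2 fun _ he => he.u_le
  have hVT := tame_coord (Ω := tube η B) 5 fun _ he => he.VT_le
  exact ((((hu.mul hp).mul (tame_cosRel S hη)).sub ((tame_sinCrab hη).mul (tame_sinRel S hη))).add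
    (((Tame.const _).mul tame_sat).mul hp)).add (hVT.mul hp)

theorem tame_κ (hκ : ∀ θ, |S.κ θ| ≤ Kκ) (hκ' : ∀ θ, |deriv S.κ θ| ≤ Kκ') :
    Tame (tube η B) (fun e => S.κ (toArgs e).θ) :=
  tame_comp_θ (S.contDiff_κ.of_le two_le_infty) hκ hκ'

theorem hasDerivAt_γ (S : Setup) (θ : ℝ) : HasDerivAt S.γ (S.κ θ) θ :=
  ((S.smooth.differentiable (by norm_num)) θ).hasDerivAt

theorem gradBdd_γ (hκ : ∀ θ, |S.κ θ| ≤ Kκ) :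
    GradBdd (tube η B) (fun e => S.γ (toArgs e).θ) :=
  (gradBdd_coord 0).comp_real
    (fun _ _ => (S.smooth.of_le two_le_infty).contDiffAt) fun _ _ => hκ _

theorem tame_VNdotN (hη : 0 < η) (hκ : ∀ θ, |S.κ θ| ≤ Kκ) (hκ' : ∀ θ, |deriv S.κ θ| ≤ Kκ') :
    Tame (tube η B) (fun e => S.VNdotN (toArgs e)) := by
  have hVT := tame_coord (Ω := tube η B) 5 fun _ he => he.VT_le
  have hxe := tame_coord (Ω := tube η B) 10 fun _ he => he.xe_le
  have hye := tame_coord (Ω := tube η B) 11 fun _ he => he.ye_le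
  exact (((((Tame.const _).mul hye).mul (gradBdd_γ hκ).cos).sub
    (((Tame.const _).mul hxe).mul (gradBdd_γ hκ).sin)).mul (tame_p hη)).sub
    (((tame_κ hκ hκ').mul (tame_θdotN S hη)).mul hVT)

theorem tame_G1N (S : Setup) (hη : 0 < η) : Tame (tube η B) (fun e => S.G1N (toArgs e)) := by
  have h3 := tame_σ_inv (B := B) S hη
  have h4 := (((tame_ζ S).add ((tame_ν hη).mul (tame_σ S hη))).mul h3)
  have h5 := (gradBdd_coord (Ω := tube η B) 9).cos
  have h6 := (gradBdd_coord (Ω := tube η B) 9).sin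
  have hu := tame_coord (Ω := tube η B) 2 fun _ he => he.u_le
  have hud := tame_coord (Ω := tube η B) 3 fun _ he => he.ud_le
  exact ((((Tame.const 1).sub h5).mul h4).add
    (((hu.sub hud).mul (tame_sinRel S hη)).mul (tame_p hη))).add (h3.mul h6)

theorem tame_yKnownN (hη : 0 < η) (hκ : ∀ θ, |S.κ θ| ≤ Kκ) (hκ' : ∀ θ, |deriv S.κ θ| ≤ Kκ') :
    Tame (tube η B) (fun e => S.yKnownN (toArgs e)) :=
  ((tame_invΔ S).mul (((tame_ζ S).neg.mul (tame_σ_inv S hη)).add (tame_G1N S hη))).sub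
    (((tame_ξ S).mul (tame_κ hκ hκ')).mul (tame_θdotN S hη))

theorem tame_xKnownN (hη : 0 < η) (hκ : ∀ θ, |S.κ θ| ≤ Kκ) (hκ' : ∀ θ, |deriv S.κ θ| ≤ Kκ') :
    Tame (tube η B) (fun e => S.xKnownN (toArgs e)) :=
  ((((Tame.const _).mul tame_sat).mul (tame_invΔ S)).mul (tame_p hη)).add
    (((tame_ζ S).mul (tame_κ hκ hκ')).mul (tame_θdotN S hη))

theorem tame_ΔKnownN (hη : 0 < η) (hκ : ∀ θ, |S.κ θ| ≤ Kκ) (hκ' : ∀ θ, |deriv S.κ θ| ≤ Kκ') :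
    Tame (tube η B) (fun e => S.ΔKnownN (toArgs e)) :=
  ((tame_ξ S).mul (tame_xKnownN hη hκ hκ')).add ((tame_ζ S).mul (tame_yKnownN hη hκ hκ'))

theorem tame_rdN (hη : 0 < η) (hκ : ∀ θ, |S.κ θ| ≤ Kκ) (hκ' : ∀ θ, |deriv S.κ θ| ≤ Kκ') {c : ℝ}
    (hc : 0 < c) : Tame (tubeCr S η B c) (fun e => S.rdN (toArgs e)) := by
  have hsub : tubeCr S η B c ⊆ tube η B := inter_subset_left
  have hCr := ((tame_Cr (B := B) S hη).mono hsub).inv_of_le hc fun _ he => he.2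
  refine hCr.neg.mul (Tame.mono ?_ hsub)
  have hp := tame_p (B := B) hη
  have hs := tame_sinCrab (B := B) hη
  have hcc := tame_cosCrab (B := B) hη
  have hν := tame_ν (B := B) hη
  have hζ := tame_ζ (η := η) (B := B) S
  have hσ := tame_σ (B := B) S hη
  have hσi := tame_σ_inv (B := B) S hη
  have hdi := tame_disc_inv (B := B) S hη
  have hY := tame_Y (η := η) (B := B) S
  have hVN := tame_VNdotN (B := B) hη hκ hκ'
  have hyk := tame_yKnownN (B := B) hη hκ hκ'
  have hΔk := tame_ΔKnownN (B := B) hη hκ hκ'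
  have hdud := tame_coord (Ω := tube η B) 4 fun _ he => he.dud_le
  have hVNc := tame_coord (Ω := tube η B) 6 fun _ he => he.VN_le
  -- the summands of `rdN`, in the order of its definition
  have t1 := (tame_κ (B := B) (η := η) hκ hκ').neg.mul (tame_θdotN S hη)
  have t2 := (((hY.mul hs).mul hcc).sub ((hdud.mul hs).mul hp)).mul hp
  have t3 := (hVN.mul hp).mul hσi
  have t4 := ((((hVN.mul hν).mul hp).mul hζ).mul hdi).mul hσi
  have t5 := ((hν.mul hdi).mul (hp.pow 2)).mul ((hVNc.mul hVN).sub (hcc.mul hdud))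
  have t6 := (((hν.mul hdi).mul hp).mul hY).mul (hs.pow 2)
  have t7 := ((hσi.pow 2).mul (((Tame.const 1).add ((hν.mul hζ).mul hdi)).add
    (((hν.pow 2).mul hσ).mul hdi))).mul hyk
  have t8 := ((hν.mul hdi).mul (hσi.pow 2)).mul hΔk
  have t9 := ((hζ.add (hν.mul hσ)).mul (hσi.pow 2)).mul hΔk
  exact (((((((t1.add t2).add t3).add t4).add t5).sub t6).add t7).add t8).sub t9

/-- Uniformly in `θ`, in the position errors and in `ψ̃`, the yaw-rate reference and its gradient
grow at most linearly in the sway velocity. -/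
theorem rd_bound (hη : 0 < η) (hκ : ∀ θ, |S.κ θ| ≤ Kκ) (hκ' : ∀ θ, |deriv S.κ θ| ≤ Kκ') {c : ℝ}
    (hc : 0 < c) : ∃ C, 0 ≤ C ∧ ∀ e ∈ tubeCr S η B c,
      ContDiffAt ℝ 2 (fun e => S.rd (toArgs e)) e ∧
      |S.rd (toArgs e)| ≤ C * (1 + |(toArgs e).v|) ∧
      ‖fderiv ℝ (fun e => S.rd (toArgs e)) e‖ ≤ C * (1 + |(toArgs e).v|) := by
  obtain ⟨C, hC0, hC⟩ := (tame_rdN (B := B) hη hκ hκ' hc).exists_hasFDerivAt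
  obtain ⟨D, hD0, hD⟩ := (gradBdd_utd (B := B) hη).exists_hasFDerivAt
  refine ⟨C * max B 1 + C * D, by positivity, fun e he => ?_⟩
  have heq : (fun e => S.rd (toArgs e)) =ᶠ[𝓝 e]
      fun e => utd (toArgs e).ud (toArgs e).v * S.rdN (toArgs e) :=
    Filter.eventuallyEq_of_mem (isOpen_guidedSet.mem_nhds (tube_subset_guidedSet hη he.1))
      fun e he => Guided.rd_eq he
  have hmax : 0 ≤ max B 1 := le_max_of_le_right zero_le_one
  have hv := abs_nonneg (toArgs e).v
  have hutd : utd (toArgs e).ud (toArgs e).v ≤ max B 1 * (1 + |(toArgs e).v|) := by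
    have h1 : utd (toArgs e).ud (toArgs e).v ≤ |(toArgs e).ud| + |(toArgs e).v| := by
      refine Real.sqrt_le_iff.2 ⟨by positivity, ?_⟩
      rw [← sq_abs, ← sq_abs (toArgs e).v]
      nlinarith [mul_nonneg (abs_nonneg (toArgs e).ud) hv]
    nlinarith [he.1.ud_le, le_max_left B 1, le_max_right B 1]
  have hutd0 := (tube_subset_guidedSet hη he.1 : Guided (toArgs e)).utd_pos.le
  have hf := (hD e he.1).2.1.fun_mul (hC e he).2.2.1
  refine ⟨((hD e he.1).1.mul (hC e he).1).congr_of_eventuallyEq heq, ?_, ?_⟩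
  · rw [heq.eq_of_nhds, abs_mul, abs_of_nonneg hutd0]
    have := mul_le_mul hutd (hC e he).2.1 (abs_nonneg _) (by positivity)
    nlinarith [mul_nonneg (mul_nonneg hC0 hD0) (by positivity : 0 ≤ 1 + |(toArgs e).v|)]
  · rw [heq.fderiv_eq, hf.fderiv]
    refine (norm_add_le _ _).trans ?_
    rw [norm_smul, norm_smul, Real.norm_eq_abs, Real.norm_eq_abs, abs_of_nonneg hutd0]
    have h1 := mul_le_mul hutd (hC e he).2.2.2 (norm_nonneg _) (by positivity)
    have h2 := mul_le_mul (hC e he).2.1 (hD e he.1).2.2 (norm_nonneg _) hC0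
    nlinarith [mul_nonneg (mul_nonneg hC0 hD0) hv]

end Setup

end Tube

/-! ### Differential inequalities on an interval -/

section Comparison

variable {J : Set ℝ} {t₀ : ℝ} {f f' : ℝ → ℝ}

theorem antitoneOn_of_hasDerivWithinAt_nonpos (hJ : J.OrdConnected)
    (hf : ∀ t ∈ J, HasDerivWithinAt f (f' t) J t) (hf' : ∀ t ∈ J, f' t ≤ 0) : AntitoneOn f J := by
  have hint : ∀ t ∈ interior J, HasDerivAt f (f' t) t := fun t ht =>
    (hf t (interior_subset ht)).hasDerivAt (mem_interior_iff_mem_nhds.1 ht)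
  exact antitoneOn_of_deriv_nonpos hJ.convex (fun t ht => (hf t ht).continuousWithinAt)
    (fun t ht => (hint t ht).differentiableAt.differentiableWithinAt)
    (fun t ht => by rw [(hint t ht).deriv]; exact hf' t (interior_subset ht))

theorem hasDerivAt_exp_mul_sub (a t₀ t : ℝ) :
    HasDerivAt (fun s => Real.exp (a * (s - t₀))) (a * Real.exp (a * (t - t₀))) t := by
  have h := (((hasDerivAt_id t).sub_const t₀).const_mul a).exp
  simp only [id, mul_one] at h
  rw [mul_comm]; exact h

/-- A forced linear decay inequality, with a forcing that decays more slowly. -/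
theorem le_exp_of_deriv_le (hJ : J.OrdConnected) (ht₀ : IsLeast J t₀)
    {lam rate K : ℝ} (hlam : rate < lam) (hK : 0 ≤ K) (h0 : 0 ≤ f t₀)
    (hf : ∀ t ∈ J, ∃ d, HasDerivWithinAt f d J t ∧
      d ≤ -lam * f t + K * Real.exp (-rate * (t - t₀))) :
    ∀ t ∈ J, f t ≤ (f t₀ + K / (lam - rate)) * Real.exp (-rate * (t - t₀)) := by
  choose! f' hf hf' using hf
  intro t ht
  have hpos : 0 < lam - rate := sub_pos.2 hlam
  have hanti := antitoneOn_of_hasDerivWithinAt_nonpos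
    (f := fun s => f s * Real.exp (lam * (s - t₀))
      - K / (lam - rate) * Real.exp ((lam - rate) * (s - t₀)))
    hJ (fun s hs => ((hf s hs).fun_mul (hasDerivAt_exp_mul_sub lam t₀ s).hasDerivWithinAt).fun_sub
      ((hasDerivAt_exp_mul_sub (lam - rate) t₀ s).hasDerivWithinAt.const_mul (K / (lam - rate))))
    (fun s hs => by
      have h1 : Real.exp ((lam - rate) * (s - t₀))
          = Real.exp (-rate * (s - t₀)) * Real.exp (lam * (s - t₀)) := by
        rw [← Real.exp_add]; ring_nf
      have h2 : K / (lam - rate) * ((lam - rate) * Real.exp ((lam - rate) * (s - t₀)))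
          = K * Real.exp (-rate * (s - t₀)) * Real.exp (lam * (s - t₀)) := by
        rw [h1]; field_simp
      rw [h2]
      nlinarith [mul_le_mul_of_nonneg_right (hf' s hs) (Real.exp_pos (lam * (s - t₀))).le])
  have h := hanti ht₀.1 ht (ht₀.2 ht)
  simp only [sub_self, mul_zero, Real.exp_zero, mul_one] at h
  have hτ : 0 ≤ t - t₀ := sub_nonneg.2 (ht₀.2 ht)
  have hKd : 0 ≤ K / (lam - rate) := div_nonneg hK hpos.le
  have e1 : Real.exp ((lam - rate) * (t - t₀)) * Real.exp (-lam * (t - t₀))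
      = Real.exp (-rate * (t - t₀)) := by rw [← Real.exp_add]; ring_nf
  have e2 : Real.exp (lam * (t - t₀)) * Real.exp (-lam * (t - t₀)) = 1 := by
    rw [← Real.exp_add]; ring_nf; exact Real.exp_zero
  have e3 : Real.exp (-lam * (t - t₀)) ≤ Real.exp (-rate * (t - t₀)) :=
    Real.exp_le_exp.2 (by nlinarith)
  have h4 := mul_le_mul_of_nonneg_right h (Real.exp_pos (-lam * (t - t₀))).le
  have h5 : f t = (f t * Real.exp (lam * (t - t₀))
      - K / (lam - rate) * Real.exp ((lam - rate) * (t - t₀))) * Real.exp (-lam * (t - t₀))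
      + K / (lam - rate) * Real.exp (-rate * (t - t₀)) := by
    rw [sub_mul, mul_assoc, e2, mul_assoc, e1]; ring
  rw [h5]
  nlinarith [mul_le_mul_of_nonneg_left e3 h0, mul_nonneg hKd (Real.exp_pos (-lam * (t - t₀))).le]

/-- The integrating factor that absorbs the integrable coefficient `K e^{-rate (t - t₀)}`. -/
theorem hasDerivWithinAt_mul_exp_exp {rate K t : ℝ} (hrate : rate ≠ 0)
    (hf : HasDerivWithinAt f (f' t) J t) :
    HasDerivWithinAt (fun s => (1 + f s) * Real.exp (K / rate * Real.exp (-rate * (s - t₀))))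
      ((f' t - K * Real.exp (-rate * (t - t₀)) * (1 + f t))
        * Real.exp (K / rate * Real.exp (-rate * (t - t₀)))) J t := by
  have h1 := (((hasDerivAt_exp_mul_sub (-rate) t₀ t).const_mul (K / rate)).exp).hasDerivWithinAt
    (s := J)
  refine ((hf.const_add 1).fun_mul h1).congr_deriv ?_
  field_simp
  ring

theorem exp_exp_bounds {rate K t : ℝ} (hrate : 0 < rate) (hK : 0 ≤ K) (ht : t₀ ≤ t) :
    1 ≤ Real.exp (K / rate * Real.exp (-rate * (t - t₀))) ∧
      Real.exp (K / rate * Real.exp (-rate * (t - t₀))) ≤ Real.exp (K / rate) := by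
  refine ⟨Real.one_le_exp (by positivity), Real.exp_le_exp.2 ?_⟩
  have h : Real.exp (-rate * (t - t₀)) ≤ 1 :=
    Real.exp_le_one_iff.2 (by nlinarith)
  exact mul_le_of_le_one_right (by positivity) h

/-- Boundedness from an inequality with an integrable growth rate. -/
theorem le_of_deriv_le_integrable (hJ : J.OrdConnected) (ht₀ : IsLeast J t₀)
    (hf0 : ∀ t ∈ J, 0 ≤ f t) {rate K : ℝ} (hrate : 0 < rate) (hK : 0 ≤ K)
    (hf : ∀ t ∈ J, ∃ d, HasDerivWithinAt f d J t ∧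
      d ≤ K * Real.exp (-rate * (t - t₀)) * (1 + f t)) :
    ∀ t ∈ J, f t ≤ (1 + f t₀) * Real.exp (K / rate) := by
  choose! f' hf hf' using hf
  intro t ht
  have hanti := antitoneOn_of_hasDerivWithinAt_nonpos hJ
    (fun s hs => hasDerivWithinAt_mul_exp_exp (t₀ := t₀) (K := K) hrate.ne' (hf s hs))
    (fun s hs => mul_nonpos_of_nonpos_of_nonneg (by linarith [hf' s hs]) (Real.exp_pos _).le)
  have h := hanti ht₀.1 ht (ht₀.2 ht)
  simp only [sub_self, mul_zero, Real.exp_zero, mul_one] at h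
  nlinarith [(exp_exp_bounds hrate hK (ht₀.2 ht)).1, hf0 t ht]

/-- Boundedness from an inequality with a constant forcing, linear decay and an integrable growth
rate. -/
theorem le_of_deriv_le_integrable_add (hJ : J.OrdConnected) (ht₀ : IsLeast J t₀)
    (hf0 : ∀ t ∈ J, 0 ≤ f t) {lam A rate K : ℝ}
    (hlam : 0 < lam) (hA : 0 ≤ A) (hrate : 0 < rate) (hK : 0 ≤ K)
    (hf : ∀ t ∈ J, ∃ d, HasDerivWithinAt f d J t ∧
      d ≤ -lam * f t + A + K * Real.exp (-rate * (t - t₀)) * (1 + f t)) :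
    ∀ t ∈ J, f t ≤ (1 + f t₀ + (lam + A) / lam) * Real.exp (K / rate) := by
  choose! f' hf hf' using hf
  intro t ht
  have hle := le_exp_of_deriv_le hJ ht₀
    (f := fun s => (1 + f s) * Real.exp (K / rate * Real.exp (-rate * (s - t₀))))
    (lam := lam) (rate := 0) (K := (lam + A) * Real.exp (K / rate)) hlam (by positivity)
    (by have := hf0 t₀ ht₀.1; positivity)
    (fun s hs => by
      refine ⟨_, hasDerivWithinAt_mul_exp_exp (t₀ := t₀) (K := K) hrate.ne' (hf s hs), ?_⟩
      obtain ⟨h1, h2⟩ := exp_exp_bounds hrate hK (ht₀.2 hs)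
      simp only [neg_zero, zero_mul, Real.exp_zero, mul_one]
      nlinarith [mul_le_mul_of_nonneg_right (hf' s hs) (zero_le_one.trans h1),
        mul_le_mul_of_nonneg_left h2 (add_nonneg hlam.le hA)]) t ht
  simp only [neg_zero, zero_mul, sub_zero, sub_self, mul_zero, Real.exp_zero, mul_one] at hle
  have h1 := (exp_exp_bounds hrate hK (ht₀.2 ht)).1
  have h2 : (lam + A) * Real.exp (K / rate) / lam = (lam + A) / lam * Real.exp (K / rate) := by ring
  rw [h2] at hle
  nlinarith [hf0 t ht]

end Comparison

/-! ### A damped oscillator with time-varying coupling -/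

/-- The quadratic form `k₂ p² + q² + 2 ε p q` is a strict Lyapunov function, uniformly in the
coupling `C ∈ [c, Cb]`, for `ṗ = C q + a`, `q̇ = -k₁ q - k₂ C p + b`. -/
theorem exists_oscillator_lyapunov {k1 k2 c Cb : ℝ} (hk1 : 0 < k1) (hk2 : 0 < k2) (hc : 0 < c)
    (hCb : 0 ≤ Cb) :
    ∃ ε lam K m M : ℝ, 0 < lam ∧ 0 < K ∧ 0 < m ∧ 0 < M ∧
      (∀ p q C a b : ℝ, c ≤ C → C ≤ Cb →
        2 * k2 * p * (C * q + a) + 2 * q * (-k1 * q - k2 * C * p + b)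
          + 2 * ε * ((C * q + a) * q + p * (-k1 * q - k2 * C * p + b))
          ≤ -lam * (k2 * p ^ 2 + q ^ 2 + 2 * ε * (p * q)) + K * (a ^ 2 + b ^ 2)) ∧
      (∀ p q : ℝ, m * (p ^ 2 + q ^ 2) ≤ k2 * p ^ 2 + q ^ 2 + 2 * ε * (p * q)) ∧
      (∀ p q : ℝ, k2 * p ^ 2 + q ^ 2 + 2 * ε * (p * q) ≤ M * (p ^ 2 + q ^ 2)) := by
  obtain ⟨ε, hε, hε1, hε2⟩ : ∃ ε : ℝ, 0 < ε ∧ ε * (2 * Cb + k1 ^ 2 / (k2 * c)) ≤ k1 ∧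
      ε ^ 2 ≤ k2 / 4 := by
    refine ⟨min (k1 / (2 * Cb + k1 ^ 2 / (k2 * c))) (√k2 / 2), by positivity, ?_, ?_⟩
    · rw [← le_div_iff₀ (by positivity)]; exact min_le_left _ _
    · calc _ ≤ (√k2 / 2) ^ 2 := pow_le_pow_left₀ (by positivity) (min_le_right _ _) 2
        _ = k2 / 4 := by rw [div_pow, Real.sq_sqrt hk2.le]; norm_num
  have hδ : 0 < min k1 (ε * k2 * c) := by positivity
  set δ := min k1 (ε * k2 * c) with hδdef
  have hM : 0 < k2 + 1 + ε := by positivity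
  have hup : ∀ p q : ℝ, k2 * p ^ 2 + q ^ 2 + 2 * ε * (p * q) ≤ (k2 + 1 + ε) * (p ^ 2 + q ^ 2) :=
    fun p q => by
      nlinarith [mul_nonneg hε.le (sq_nonneg (p - q)), mul_nonneg hk2.le (sq_nonneg q), sq_nonneg p]
  refine ⟨ε, δ / 2 / (k2 + 1 + ε), 4 * (k2 ^ 2 + 1 + ε ^ 2) / δ, min k2 1 / 2, k2 + 1 + ε,
    by positivity, by positivity, by positivity, hM, ?_, ?_, hup⟩
  · intro p q C a b hcC hCCb
    have h1 : -(2 * ε * k1 * (p * q)) ≤ ε * (k2 * c * p ^ 2 + k1 ^ 2 / (k2 * c) * q ^ 2) := by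
      have : k2 * c * p ^ 2 + k1 ^ 2 / (k2 * c) * q ^ 2 + 2 * k1 * (p * q)
          = (k2 * c * p + k1 * q) ^ 2 / (k2 * c) := by field_simp; ring
      have h2 : 0 ≤ (k2 * c * p + k1 * q) ^ 2 / (k2 * c) := by positivity
      rw [← this] at h2
      nlinarith [mul_nonneg hε.le h2]
    have young : ∀ x y s : ℝ, 2 * s * (x * y) ≤ δ / 4 * x ^ 2 + 4 * s ^ 2 / δ * y ^ 2 := by
      intro x y s
      have : δ / 4 * x ^ 2 + 4 * s ^ 2 / δ * y ^ 2 - 2 * s * (x * y)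
          = (δ * x - 4 * s * y) ^ 2 / (4 * δ) := by field_simp; ring
      have h2 : 0 ≤ (δ * x - 4 * s * y) ^ 2 / (4 * δ) := by positivity
      linarith
    have y1 := young p a k2
    have y2 := young q b 1
    have y3 := young q a ε
    have y4 := young p b ε
    have hδ1 : δ * q ^ 2 ≤ k1 * q ^ 2 :=
      mul_le_mul_of_nonneg_right (min_le_left _ _) (sq_nonneg q)
    have hδ2 : δ * p ^ 2 ≤ ε * k2 * c * p ^ 2 :=
      mul_le_mul_of_nonneg_right (min_le_right _ _) (sq_nonneg p)
    have h3 : ε * C * q ^ 2 ≤ ε * Cb * q ^ 2 := by gcongr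
    have h4 : ε * k2 * c * p ^ 2 ≤ ε * k2 * C * p ^ 2 := by gcongr
    have h5 : ε * (2 * Cb + k1 ^ 2 / (k2 * c)) * q ^ 2 ≤ k1 * q ^ 2 :=
      mul_le_mul_of_nonneg_right hε1 (sq_nonneg q)
    have h6 : -(δ / 2) * (p ^ 2 + q ^ 2)
        ≤ -(δ / 2 / (k2 + 1 + ε)) * (k2 * p ^ 2 + q ^ 2 + 2 * ε * (p * q)) := by
      have := mul_le_mul_of_nonneg_left (hup p q) (by positivity : 0 ≤ δ / 2 / (k2 + 1 + ε))
      have h7 : δ / 2 / (k2 + 1 + ε) * ((k2 + 1 + ε) * (p ^ 2 + q ^ 2))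
          = δ / 2 * (p ^ 2 + q ^ 2) := by
        field_simp
      linarith
    have h8 : 4 * (k2 ^ 2 + 1 + ε ^ 2) / δ * (a ^ 2 + b ^ 2)
        = 4 * k2 ^ 2 / δ * a ^ 2 + 4 * 1 ^ 2 / δ * b ^ 2 + 4 * ε ^ 2 / δ * a ^ 2
          + 4 * ε ^ 2 / δ * b ^ 2 + (4 / δ * a ^ 2 + 4 * k2 ^ 2 / δ * b ^ 2) := by ring
    have h9 : 0 ≤ 4 / δ * a ^ 2 + 4 * k2 ^ 2 / δ * b ^ 2 := by positivity
    rw [h8]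
    nlinarith
  · intro p q
    have h1 : min k2 1 * p ^ 2 ≤ k2 * p ^ 2 :=
      mul_le_mul_of_nonneg_right (min_le_left _ _) (sq_nonneg p)
    have h2 : min k2 1 * q ^ 2 ≤ 1 * q ^ 2 :=
      mul_le_mul_of_nonneg_right (min_le_right _ _) (sq_nonneg q)
    nlinarith [sq_nonneg (2 * ε * p + q), mul_le_mul_of_nonneg_right hε2 (sq_nonneg p)]

namespace Setup
variable {S : Setup} {J : Set ℝ} {z : ℝ → State} {t : ℝ}

/-! ### Error dynamics along a solution -/

/-- `Ṽ_T`. -/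
def VTerr (S : Setup) (z : State) : ℝ :=
  (S.Vx - z.Vxh) * Real.cos (S.γ z.θ) + (S.Vy - z.Vyh) * Real.sin (S.γ z.θ)

/-- `Ṽ_N`. -/
def VNerr (S : Setup) (z : State) : ℝ :=
  -(S.Vx - z.Vxh) * Real.sin (S.γ z.θ) + (S.Vy - z.Vyh) * Real.cos (S.γ z.θ)

/-- The coefficient of `Ṽ_T` in the rate of `ψ̃`. -/
def headingGainT (S : Setup) (q : Args) : ℝ :=
  S.Δ q / S.den q * (S.gc q * (2 * S.Δ q * S.Δx q)) - (q.y + S.g q) / S.den q * S.Δx q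

/-- The coefficient of `Ṽ_N` in the rate of `ψ̃`. -/
def headingGainN (S : Setup) (q : Args) : ℝ :=
  S.Δ q / S.den q * (1 + 2 * S.gc q * q.y + S.gb q * q.VN + S.gc q * (2 * S.Δ q * S.Δy q))
    - (q.y + S.g q) / S.den q * S.Δy q

theorem relHeading_args (S : Setup) (t : ℝ) (z : State) :
    S.relHeading (S.args t z) = z.ψ - S.γ z.θ := by
  simp only [relHeading, args, ψd]; ring

theorem θdot_args (S : Setup) (t : ℝ) (z : State) :
    S.θdot (S.args t z) = S.updateLaw z.u z.v (z.ψ - S.γ z.θ) (S.xbp z) (S.VTh z) := by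
  rw [θdot, relHeading_args]; rfl

theorem Dom.guided {z : State} (h : S.Dom t z) (hud : 0 < S.urd t) : Guided (S.args t z) :=
  ⟨hud, by rw [← utd_sq]; exact h.1⟩

/-- `V̂_N ∂s/∂a = ∂g/∂a`, also where `V̂_N = 0`. -/
theorem Guided.ga_mul (S : Setup) {q : Args} (hq : Guided q) :
    q.VN * (S.ratio q ^ 2
      / (2 * √(coefB q.VN q.y ^ 2 - coefA q.ud q.v q.VN * coefC S.μ q.x q.y))) = S.ga q := by
  have := hq.utd_pos
  have := hq.disc_pos (S := S)
  have := S.Δ_pos q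
  rw [hq.ga_eq, hq.ratio_eq, hq.sqrt_discr]
  conv_lhs => rw [hq.VN_eq]
  field_simp

/-- `V̂_N ∂s/∂b = ∂g/∂b`. -/
theorem Guided.gb_mul (S : Setup) {q : Args} (hq : Guided q) :
    q.VN * (S.ratio q
      / √(coefB q.VN q.y ^ 2 - coefA q.ud q.v q.VN * coefC S.μ q.x q.y)) = S.gb q := by
  have := hq.utd_pos
  have := hq.disc_pos (S := S)
  have := S.Δ_pos q
  rw [hq.gb_eq, hq.ratio_eq, hq.sqrt_discr]
  conv_lhs => rw [hq.VN_eq]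
  field_simp

/-- `V̂_N ∂s/∂c = ∂g/∂c`. -/
theorem Guided.gc_mul (S : Setup) {q : Args} (hq : Guided q) :
    q.VN * (1
      / (2 * √(coefB q.VN q.y ^ 2 - coefA q.ud q.v q.VN * coefC S.μ q.x q.y))) = S.gc q := by
  have := hq.utd_pos
  have := hq.disc_pos (S := S)
  have := S.Δ_pos q
  rw [hq.gc_eq, hq.sqrt_discr]
  conv_lhs => rw [hq.VN_eq]
  field_simp

theorem hasDerivWithinAt_Δ {Q : ℝ → Args} {x' y' : ℝ}
    (hx : HasDerivWithinAt (fun s => (Q s).x) x' J t)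
    (hy : HasDerivWithinAt (fun s => (Q s).y) y' J t) :
    HasDerivWithinAt (fun s => S.Δ (Q s)) (S.Δx (Q t) * x' + S.Δy (Q t) * y') J t := by
  have hp : S.μ + (Q t).x ^ 2 + (Q t).y ^ 2 ≠ 0 := by have := S.μ_pos; positivity
  have h := (((hx.fun_pow 2).const_add S.μ).fun_add (hy.fun_pow 2)).sqrt hp
  refine h.congr_deriv ?_
  rw [Δx_eq, Δy_eq]
  have : √(S.μ + (Q t).x ^ 2 + (Q t).y ^ 2) = S.Δ (Q t) := rfl
  rw [this]
  have := S.Δ_pos (Q t)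
  field_simp
  push_cast
  ring

/-- Chain rule for `g = V̂_N s(a, b, c)`. The rate of the factor `V̂_N` contributes the first term. -/
theorem hasDerivWithinAt_g {Q : ℝ → Args} {ud' v' VN' x' y' : ℝ} (hq : Guided (Q t))
    (hud : HasDerivWithinAt (fun s => (Q s).ud) ud' J t)
    (hv : HasDerivWithinAt (fun s => (Q s).v) v' J t)
    (hVN : HasDerivWithinAt (fun s => (Q s).VN) VN' J t)
    (hx : HasDerivWithinAt (fun s => (Q s).x) x' J t)
    (hy : HasDerivWithinAt (fun s => (Q s).y) y' J t) :
    HasDerivWithinAt (fun s => S.g (Q s))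
      (VN' * S.ratio (Q t)
        + S.ga (Q t) * (2 * (Q t).VN * VN' - 2 * (Q t).ud * ud' - 2 * (Q t).v * v')
        + S.gb (Q t) * (y' * (Q t).VN + (Q t).y * VN')
        + S.gc (Q t) * (2 * S.Δ (Q t) * (S.Δx (Q t) * x' + S.Δy (Q t) * y') + 2 * (Q t).y * y'))
      J t := by
  have ha : HasDerivWithinAt (fun s => coefA (Q s).ud (Q s).v (Q s).VN)
      (2 * (Q t).VN * VN' - 2 * (Q t).ud * ud' - 2 * (Q t).v * v') J t := by
    have h := ((hVN.fun_pow 2).fun_sub (hud.fun_pow 2)).fun_sub (hv.fun_pow 2)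
    have heq : (fun s => coefA (Q s).ud (Q s).v (Q s).VN)
        = fun s => (Q s).VN ^ 2 - (Q s).ud ^ 2 - (Q s).v ^ 2 := by
      funext s; rw [coefA, utd_sq]; ring
    rw [heq]
    refine h.congr_deriv ?_
    push_cast
    ring
  have hb : HasDerivWithinAt (fun s => coefB (Q s).VN (Q s).y)
      (y' * (Q t).VN + (Q t).y * VN') J t := hy.fun_mul hVN
  have hc : HasDerivWithinAt (fun s => coefC S.μ (Q s).x (Q s).y)
      (2 * S.Δ (Q t) * (S.Δx (Q t) * x' + S.Δy (Q t) * y') + 2 * (Q t).y * y') J t := by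
    have h := ((hasDerivWithinAt_Δ (S := S) hx hy).fun_pow 2).fun_add (hy.fun_pow 2)
    refine h.congr_deriv ?_
    push_cast
    ring
  have h := hVN.fun_mul (hasDerivWithinAt_gRatio ha hb hc hq.coefA_ne (hq.discr_pos S))
  refine h.congr_deriv ?_
  rw [← hq.ga_mul S, ← hq.gb_mul S, ← hq.gc_mul S]
  simp only [ratio]
  ring

theorem hasDerivWithinAt_losAngle {Q : ℝ → Args} {ud' v' VN' x' y' : ℝ} (hq : Guided (Q t))
    (hud : HasDerivWithinAt (fun s => (Q s).ud) ud' J t)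
    (hv : HasDerivWithinAt (fun s => (Q s).v) v' J t)
    (hVN : HasDerivWithinAt (fun s => (Q s).VN) VN' J t)
    (hx : HasDerivWithinAt (fun s => (Q s).x) x' J t)
    (hy : HasDerivWithinAt (fun s => (Q s).y) y' J t) :
    HasDerivWithinAt (fun s => losAngle S.μ (Q s).ud (Q s).v (Q s).VN (Q s).x (Q s).y)
      (S.Δ (Q t) / S.den (Q t) * (y' + (VN' * S.ratio (Q t)
        + S.ga (Q t) * (2 * (Q t).VN * VN' - 2 * (Q t).ud * ud' - 2 * (Q t).v * v')
        + S.gb (Q t) * (y' * (Q t).VN + (Q t).y * VN')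
        + S.gc (Q t) * (2 * S.Δ (Q t) * (S.Δx (Q t) * x' + S.Δy (Q t) * y')
          + 2 * (Q t).y * y')))
        - ((Q t).y + S.g (Q t)) / S.den (Q t) * (S.Δx (Q t) * x' + S.Δy (Q t) * y')) J t := by
  have hΔ := S.Δ_pos (Q t)
  have h := ((hy.fun_add (hasDerivWithinAt_g (S := S) hq hud hv hVN hx hy)).fun_div
    (hasDerivWithinAt_Δ (S := S) hx hy) hΔ.ne').arctan
  refine h.congr_deriv ?_
  have hden : 0 < S.den (Q t) := by rw [den]; positivity
  have h1 : 1 + (((Q t).y + S.g (Q t)) / S.Δ (Q t)) ^ 2 = S.den (Q t) / S.Δ (Q t) ^ 2 := by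
    rw [den]; field_simp
  rw [h1]
  field_simp

theorem hasDerivWithinAt_crab {Q : ℝ → Args} {ud' v' : ℝ} (hq : Guided (Q t))
    (hud : HasDerivWithinAt (fun s => (Q s).ud) ud' J t)
    (hv : HasDerivWithinAt (fun s => (Q s).v) v' J t) :
    HasDerivWithinAt (fun s => Real.arctan ((Q s).v / (Q s).ud))
      ((v' * (Q t).ud - ud' * (Q t).v) / ((Q t).ud ^ 2 + (Q t).v ^ 2)) J t := by
  have := hq.1
  refine (hv.fun_div hud hq.1.ne').arctan.congr_deriv ?_
  field_simp

variable (hz : S.IsSolutionOn J z) (ht : t ∈ J)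
include hz ht

theorem IsSolutionOn.hasDeriv_θ :
    HasDerivWithinAt (fun s => (z s).θ) (S.θdot (S.args t (z t))) J t := by
  rw [θdot_args]; exact hz.θ t ht

theorem IsSolutionOn.hasDeriv_γ :
    HasDerivWithinAt (fun s => S.γ (z s).θ)
      (S.κ (z t).θ * S.θdot (S.args t (z t))) J t :=
  (S.hasDerivAt_γ (z t).θ).comp_hasDerivWithinAt t (hz.hasDeriv_θ ht)

/-- The rate of `x_{b/p}` is its known part plus the tangential current estimation error: the update
law for `θ` cancels the vessel velocity along the path. -/
theorem IsSolutionOn.hasDeriv_xbp :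
    HasDerivWithinAt (fun s => S.xbp (z s)) (S.xKnown (S.args t (z t)) + S.VTerr (z t)) J t := by
  have hx := (hz.x t ht).fun_sub
    ((S.hasDerivAt_xp (z t).θ).comp_hasDerivWithinAt t (hz.hasDeriv_θ ht))
  have hy := (hz.y t ht).fun_sub
    ((S.hasDerivAt_yp (z t).θ).comp_hasDerivWithinAt t (hz.hasDeriv_θ ht))
  have hγ := hz.hasDeriv_γ ht
  refine ((hγ.cos.fun_mul hx).fun_add (hγ.sin.fun_mul hy)).congr_deriv ?_
  have hθ := S.θdot_args t (z t)
  rw [xKnown]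
  simp only [updateLaw, Real.cos_sub, Real.sin_sub] at hθ
  have e1 : (S.args t (z t)).x = S.xbp (z t) := rfl
  have e2 : (S.args t (z t)).y = S.ybp (z t) := rfl
  have e3 : (S.args t (z t)).θ = (z t).θ := rfl
  rw [e1, e2, e3]
  have hsc := Real.sin_sq_add_cos_sq (S.γ (z t).θ)
  simp only [VTerr, VTh, ybp] at *
  generalize S.θdot (S.args t (z t)) = Θ at *
  simp only [Function.comp]
  linear_combination (-Θ) * hsc - hθ

/-- The rate of `y_{b/p}` is its known part plus the normal current estimation error: since
`u_td g / √E = V̂_N`, the term `g` in the guidance law cancels the estimated current. -/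
theorem IsSolutionOn.hasDeriv_ybp (hq : Guided (S.args t (z t))) :
    HasDerivWithinAt (fun s => S.ybp (z s)) (S.yKnown (S.args t (z t)) + S.VNerr (z t)) J t := by
  have hx := (hz.x t ht).fun_sub
    ((S.hasDerivAt_xp (z t).θ).comp_hasDerivWithinAt t (hz.hasDeriv_θ ht))
  have hy := (hz.y t ht).fun_sub
    ((S.hasDerivAt_yp (z t).θ).comp_hasDerivWithinAt t (hz.hasDeriv_θ ht))
  have hγ := hz.hasDeriv_γ ht
  refine ((hγ.sin.fun_neg.fun_mul hx).fun_add (hγ.cos.fun_mul hy)).congr_deriv ?_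
  have e1 : (S.args t (z t)).x = S.xbp (z t) := rfl
  have e2 : (S.args t (z t)).y = S.ybp (z t) := rfl
  have e3 : (S.args t (z t)).θ = (z t).θ := rfl
  have hrel := S.relHeading_args t (z t)
  -- the known part of the rate, with the guidance law substituted
  have hk : S.yKnown (S.args t (z t))
      = (z t).u * Real.sin ((z t).ψ - S.γ (z t).θ) + (z t).v * Real.cos ((z t).ψ - S.γ (z t).θ)
        + S.VNh (z t) - S.xbp (z t) * S.κ (z t).θ * S.θdot (S.args t (z t)) := by
    have hψ : (S.args t (z t)).ψe = ((z t).ψ - S.γ (z t).θ)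
        + Real.arctan ((S.args t (z t)).v / (S.args t (z t)).ud)
        + losAngle S.μ (S.args t (z t)).ud (S.args t (z t)).v (S.args t (z t)).VN
          (S.args t (z t)).x (S.args t (z t)).y := by
      rw [← hrel, relHeading]; ring
    have h1 := hq.cos_los (S := S)
    have h2 := hq.sin_los (S := S)
    have hσ := hq.σ_pos (S := S)
    have hΔ := S.Δ_pos (S.args t (z t))
    have hW := hq.utd_pos
    have hsc := Real.sin_sq_add_cos_sq (losAngle S.μ (S.args t (z t)).ud (S.args t (z t)).v
      (S.args t (z t)).VN (S.args t (z t)).x (S.args t (z t)).y)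
    have hcc := hq.cos_crab
    have hcs := hq.sin_crab
    have hVN : S.VNh (z t) = utd (S.args t (z t)).ud (S.args t (z t)).v * ν (S.args t (z t)) :=
      hq.VN_eq
    have hu : (S.args t (z t)).u = (z t).u := rfl
    have hv : (z t).v = (S.args t (z t)).v := rfl
    have hy' : utd (S.args t (z t)).ud (S.args t (z t)).v * (S.args t (z t)).y
        / (S.Δ (S.args t (z t)) * S.σ (S.args t (z t))) = utd (S.args t (z t)).ud (S.args t (z t)).v
          * (Real.sin (losAngle S.μ (S.args t (z t)).ud (S.args t (z t)).v
      (S.args t (z t)).VN (S.args t (z t)).x (S.args t (z t)).y)) - S.VNh (z t) := by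
      rw [h2, hVN, ζ]; field_simp; ring
    rw [yKnown, hq.sqrt_den, G1, hrel, e1, e3, hu, neg_mul, neg_div, hy']
    -- `u_td sin (ψ̃ - φ) = u_rd sin (ψ - γ) + v_r cos (ψ - γ)`
    have hkey : utd (S.args t (z t)).ud (S.args t (z t)).v
        * Real.sin ((S.args t (z t)).ψe - losAngle S.μ (S.args t (z t)).ud (S.args t (z t)).v
          (S.args t (z t)).VN (S.args t (z t)).x (S.args t (z t)).y)
        = (S.args t (z t)).ud * Real.sin ((z t).ψ - S.γ (z t).θ)
          + (z t).v * Real.cos ((z t).ψ - S.γ (z t).θ) := by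
      rw [hψ, add_sub_cancel_right, Real.sin_add, hcc, hcs, hv]
      field_simp
    rw [Real.sin_sub] at hkey
    simp only [e1] at hkey ⊢
    linear_combination hkey
  rw [hk]
  have hsc := Real.sin_sq_add_cos_sq (S.γ (z t).θ)
  simp only [VNerr, VNh, xbp, Real.cos_sub, Real.sin_sub] at *
  generalize S.θdot (S.args t (z t)) = Θ at *
  simp only [Function.comp]
  linear_combination (0:ℝ) * hsc

theorem IsSolutionOn.hasDeriv_VTh :
    HasDerivWithinAt (fun s => S.VTh (z s)) (S.VTdot (S.args t (z t))) J t := by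
  have hγ := hz.hasDeriv_γ ht
  refine (((hz.Vxh t ht).fun_mul hγ.cos).fun_add ((hz.Vyh t ht).fun_mul hγ.sin)).congr_deriv ?_
  simp only [VTdot, args, VNh]
  ring

theorem IsSolutionOn.hasDeriv_VNh :
    HasDerivWithinAt (fun s => S.VNh (z s)) (S.VNdot (S.args t (z t))) J t := by
  have hγ := hz.hasDeriv_γ ht
  refine (((hz.Vxh t ht).fun_neg.fun_mul hγ.sin).fun_add
    ((hz.Vyh t ht).fun_mul hγ.cos)).congr_deriv ?_
  simp only [VNdot, args, VTh]
  ring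

/-- The yaw-rate reference is chosen so that only `C_r r̃` and the current estimation errors remain
in the rate of the heading error. -/
theorem IsSolutionOn.hasDeriv_ψerr (hurd : ContDiff ℝ 2 S.urd) (hq : Guided (S.args t (z t))) :
    HasDerivWithinAt (fun s => S.ψerr s (z s))
      (S.CrAt t (z t) * S.rerr t (z t) + (S.headingGainT (S.args t (z t)) * S.VTerr (z t)
        + S.headingGainN (S.args t (z t)) * S.VNerr (z t))) J t := by
  have hud : HasDerivWithinAt (fun s => (S.args s (z s)).ud) (deriv S.urd t) J t :=
    ((hurd.differentiable (by norm_num)) t).hasDerivAt.hasDerivWithinAt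
  have hv : HasDerivWithinAt (fun s => (S.args s (z s)).v) (S.vdot (z t)) J t := hz.v t ht
  have hlos := hasDerivWithinAt_losAngle (S := S) (Q := fun s => S.args s (z s)) hq hud hv
    (hz.hasDeriv_VNh ht) (hz.hasDeriv_xbp ht) (hz.hasDeriv_ybp ht hq)
  have hcrab := hasDerivWithinAt_crab (Q := fun s => S.args s (z s)) hq hud hv
  refine ((hz.ψ t ht).fun_sub (((hz.hasDeriv_γ ht).fun_sub hcrab).fun_sub hlos)).congr_deriv ?_
  have hCr0 : S.Cr (S.args t (z t)) ≠ 0 := (hz.dom t ht).2.ne'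
  have e1 : (S.args t (z t)).dud = deriv S.urd t := rfl
  have e2 : (S.args t (z t)).θ = (z t).θ := rfl
  have e3 : (S.args t (z t)).u = (z t).u := rfl
  have e4 : (S.args t (z t)).v = (z t).v := rfl
  have hCr : S.Cr (S.args t (z t)) = 1 + (S.X (S.args t (z t)).u * (S.args t (z t)).ud
      / ((S.args t (z t)).ud ^ 2 + (S.args t (z t)).v ^ 2) - 2 * S.X (S.args t (z t)).u
      * (S.args t (z t)).v * S.Δ (S.args t (z t)) / S.den (S.args t (z t))
      * S.ga (S.args t (z t))) := rfl
  rw [CrAt, rerr, mul_sub (S.Cr (S.args t (z t))), rd, neg_mul, mul_neg,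
    mul_inv_cancel_left₀ hCr0]
  rw [hCr, headingGainT, headingGainN, ΔKnown, vdot, e1, e2, e3, e4]
  ring

theorem IsSolutionOn.hasDeriv_uerr (hurd : ContDiff ℝ 2 S.urd) :
    HasDerivWithinAt (fun s => (z s).u - S.urd s)
      (-(S.d11 / S.m11 + S.ku) * ((z t).u - S.urd t)) J t := by
  refine ((hz.u t ht).fun_sub
    ((hurd.differentiable (by norm_num)) t).hasDerivAt.hasDerivWithinAt).congr_deriv ?_
  rw [τu]; ring

theorem IsSolutionOn.hasDeriv_xe :
    HasDerivWithinAt (fun s => (z s).x - (z s).xh)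
      (-S.kx1 * ((z t).x - (z t).xh) + (S.Vx - (z t).Vxh)) J t :=
  ((hz.x t ht).fun_sub (hz.xh t ht)).congr_deriv (by ring)

theorem IsSolutionOn.hasDeriv_ye :
    HasDerivWithinAt (fun s => (z s).y - (z s).yh)
      (-S.ky1 * ((z t).y - (z t).yh) + (S.Vy - (z t).Vyh)) J t :=
  ((hz.y t ht).fun_sub (hz.yh t ht)).congr_deriv (by ring)

theorem IsSolutionOn.hasDeriv_Vxe :
    HasDerivWithinAt (fun s => S.Vx - (z s).Vxh) (-S.kx2 * ((z t).x - (z t).xh)) J t :=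
  ((hz.Vxh t ht).const_sub S.Vx).congr_deriv (by ring)

theorem IsSolutionOn.hasDeriv_Vye :
    HasDerivWithinAt (fun s => S.Vy - (z s).Vyh) (-S.ky2 * ((z t).y - (z t).yh)) J t :=
  ((hz.Vyh t ht).const_sub S.Vy).congr_deriv (by ring)

omit hz ht

/-- The arguments of `r_d` in a state, as a vector. -/
def argsVec (S : Setup) (t : ℝ) (z : State) : Fin 12 → ℝ :=
  ![z.θ, z.v, z.u, S.urd t, deriv S.urd t, S.VTh z, S.VNh z, S.ybp z, S.xbp z, S.ψerr t z,
    z.x - z.xh, z.y - z.yh]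

/-- The known parts of the rates of the arguments of `r_d`. -/
def knownVec (S : Setup) (t : ℝ) (z : State) : Fin 12 → ℝ :=
  ![S.θdot (S.args t z), S.vdot z, S.udot t z, deriv S.urd t, deriv (deriv S.urd) t,
    S.VTdot (S.args t z), S.VNdot (S.args t z), S.yKnown (S.args t z), S.xKnown (S.args t z),
    S.CrAt t z * S.rerr t z, -S.kx1 * (z.x - z.xh), -S.ky1 * (z.y - z.yh)]

/-- The unknown parts of the rates of the arguments of `r_d`. -/
def unknownVec (S : Setup) (t : ℝ) (z : State) : Fin 12 → ℝ :=
  ![0, 0, 0, 0, 0, 0, 0, S.VNerr z, S.VTerr z,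
    S.headingGainT (S.args t z) * S.VTerr z + S.headingGainN (S.args t z) * S.VNerr z,
    S.Vx - z.Vxh, S.Vy - z.Vyh]

/-- `r_d` as a function of a vector of arguments. -/
def rdVec (S : Setup) (e : Fin 12 → ℝ) : ℝ := S.rd (toArgs e)

/-- The rates of the arguments of `r_d` along a solution, split into known and unknown parts. -/
theorem hasDerivWithinAt_argsVec (hz : S.IsSolutionOn J z) (ht : t ∈ J)
    (hurd : ContDiff ℝ 2 S.urd) (hq : Guided (S.args t (z t))) :
    HasDerivWithinAt (fun s => S.argsVec s (z s))
      (S.knownVec t (z t) + S.unknownVec t (z t)) J t := by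
  have hurd' : ContDiff ℝ 1 (deriv S.urd) := (contDiff_succ_iff_deriv (n := 1)).1 hurd |>.2.2
  rw [hasDerivWithinAt_pi]
  intro i
  fin_cases i
  · simpa [argsVec, knownVec, unknownVec] using hz.hasDeriv_θ ht
  · simpa [argsVec, knownVec, unknownVec] using! hz.v t ht
  · simpa [argsVec, knownVec, unknownVec] using! hz.u t ht
  · simpa [argsVec, knownVec, unknownVec] using
      ((hurd.differentiable (by norm_num)) t).hasDerivAt.hasDerivWithinAt
  · simpa [argsVec, knownVec, unknownVec] using
      ((hurd'.differentiable (by norm_num)) t).hasDerivAt.hasDerivWithinAt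
  · simpa [argsVec, knownVec, unknownVec] using hz.hasDeriv_VTh ht
  · simpa [argsVec, knownVec, unknownVec] using hz.hasDeriv_VNh ht
  · simpa [argsVec, knownVec, unknownVec] using hz.hasDeriv_ybp ht hq
  · simpa [argsVec, knownVec, unknownVec] using hz.hasDeriv_xbp ht
  · simpa [argsVec, knownVec, unknownVec] using hz.hasDeriv_ψerr ht hurd hq
  · simpa [argsVec, knownVec, unknownVec] using hz.hasDeriv_xe ht
  · simpa [argsVec, knownVec, unknownVec] using hz.hasDeriv_ye ht

theorem deriv_update {f : (Fin 12 → ℝ) → ℝ} {e : Fin 12 → ℝ} (hf : DifferentiableAt ℝ f e)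
    (i : Fin 12) :
    deriv (fun s => f (Function.update e i s)) (e i) = fderiv ℝ f e (Pi.single i 1) := by
  have h := (hf.hasFDerivAt.congr_fderiv rfl)
  have h1 : HasDerivAt (fun s => Function.update e i s) (Pi.single i (1 : ℝ)) (e i) := by
    simpa using hasDerivAt_update e i (e i)
  have h2 : HasFDerivAt f (fderiv ℝ f e) (Function.update e i (e i)) := by
    rw [Function.update_eq_self]; exact h
  exact (h2.comp_hasDerivAt (e i) h1).deriv

/-- The sum of partial derivatives times known rates is the gradient of `r_d` applied to the vector
of known rates. -/
theorem rdKnown_eq {t : ℝ} {z : State} (hd : DifferentiableAt ℝ S.rdVec (S.argsVec t z)) :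
    S.rdKnown t z = fderiv ℝ S.rdVec (S.argsVec t z) (S.knownVec t z) := by
  have hsum := (fderiv ℝ S.rdVec (S.argsVec t z)).toLinearMap.pi_apply_eq_sum_univ (S.knownVec t z)
  have hs : ∀ i : Fin 12, (fun j => if i = j then (1 : ℝ) else 0) = Pi.single i 1 := by
    intro i; ext j; simp [Pi.single_apply, eq_comm]
  simp only [ContinuousLinearMap.coe_coe, hs, smul_eq_mul] at hsum
  have d0 : deriv (fun s => S.rd { S.args t z with θ := s }) (S.args t z).θ
      = fderiv ℝ S.rdVec (S.argsVec t z) (Pi.single 0 1) := deriv_update hd 0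
  have d1 : deriv (fun s => S.rd { S.args t z with v := s }) (S.args t z).v
      = fderiv ℝ S.rdVec (S.argsVec t z) (Pi.single 1 1) := deriv_update hd 1
  have d2 : deriv (fun s => S.rd { S.args t z with u := s }) (S.args t z).u
      = fderiv ℝ S.rdVec (S.argsVec t z) (Pi.single 2 1) := deriv_update hd 2
  have d3 : deriv (fun s => S.rd { S.args t z with ud := s }) (S.args t z).ud
      = fderiv ℝ S.rdVec (S.argsVec t z) (Pi.single 3 1) := deriv_update hd 3
  have d4 : deriv (fun s => S.rd { S.args t z with dud := s }) (S.args t z).dud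
      = fderiv ℝ S.rdVec (S.argsVec t z) (Pi.single 4 1) := deriv_update hd 4
  have d5 : deriv (fun s => S.rd { S.args t z with VT := s }) (S.args t z).VT
      = fderiv ℝ S.rdVec (S.argsVec t z) (Pi.single 5 1) := deriv_update hd 5
  have d6 : deriv (fun s => S.rd { S.args t z with VN := s }) (S.args t z).VN
      = fderiv ℝ S.rdVec (S.argsVec t z) (Pi.single 6 1) := deriv_update hd 6
  have d7 : deriv (fun s => S.rd { S.args t z with y := s }) (S.args t z).y
      = fderiv ℝ S.rdVec (S.argsVec t z) (Pi.single 7 1) := deriv_update hd 7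
  have d8 : deriv (fun s => S.rd { S.args t z with x := s }) (S.args t z).x
      = fderiv ℝ S.rdVec (S.argsVec t z) (Pi.single 8 1) := deriv_update hd 8
  have d9 : deriv (fun s => S.rd { S.args t z with ψe := s }) (S.args t z).ψe
      = fderiv ℝ S.rdVec (S.argsVec t z) (Pi.single 9 1) := deriv_update hd 9
  have d10 : deriv (fun s => S.rd { S.args t z with xe := s }) (S.args t z).xe
      = fderiv ℝ S.rdVec (S.argsVec t z) (Pi.single 10 1) := deriv_update hd 10
  have d11 : deriv (fun s => S.rd { S.args t z with ye := s }) (S.args t z).ye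
      = fderiv ℝ S.rdVec (S.argsVec t z) (Pi.single 11 1) := deriv_update hd 11
  simp only [rdKnown]
  rw [d0, d1, d2, d3, d4, d5, d6, d7, d8, d9, d10, d11, hsum]
  simp only [Fin.sum_univ_succ, Fin.sum_univ_zero]
  simp [knownVec, CrAt, args]
  ring

end Setup

namespace Setup

/-! ### The observer and surge errors -/

/-- Squared norm of the observer and surge velocity errors. -/
def obsSq (S : Setup) (t : ℝ) (z : State) : ℝ :=
  (z.x - z.xh) ^ 2 + (z.y - z.yh) ^ 2 + (S.Vx - z.Vxh) ^ 2 + (S.Vy - z.Vyh) ^ 2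
    + (z.u - S.urd t) ^ 2

/-- Square of `errNorm`. -/
def errSq (S : Setup) (t : ℝ) (z : State) : ℝ :=
  S.ybp z ^ 2 + S.xbp z ^ 2 + S.ψerr t z ^ 2 + S.rerr t z ^ 2
    + (z.x - z.xh) ^ 2 + (z.y - z.yh) ^ 2 + (S.Vx - z.Vxh) ^ 2 + (S.Vy - z.Vyh) ^ 2
    + (z.u - S.urd t) ^ 2

theorem errSq_nonneg (S : Setup) (t : ℝ) (z : State) : 0 ≤ S.errSq t z := by
  rw [errSq]; positivity

theorem obsSq_nonneg (S : Setup) (t : ℝ) (z : State) : 0 ≤ S.obsSq t z := by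
  rw [obsSq]; positivity

theorem errSq_eq (S : Setup) (t : ℝ) (z : State) :
    S.errSq t z = S.ybp z ^ 2 + S.xbp z ^ 2 + S.ψerr t z ^ 2 + S.rerr t z ^ 2 + S.obsSq t z := by
  rw [errSq, obsSq]; ring

theorem errNorm_sq (S : Setup) (t : ℝ) (z : State) : S.errNorm t z ^ 2 = S.errSq t z :=
  Real.sq_sqrt (S.errSq_nonneg t z)

/-- Assumptions on the desired surge velocity, the sway dynamics and the path, in the form in which
they enter the estimates. -/
structure Standing (S : Setup) (u0 Bu Ymin Xmax κmax κ'max : ℝ) : Prop where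
  smooth : ContDiff ℝ 2 S.urd
  u0_pos : 0 < u0
  urd_ge : ∀ t, 0 ≤ t → u0 ≤ S.urd t
  urd_le : ∀ t, 0 ≤ t → |S.urd t| ≤ Bu
  deriv_urd_le : ∀ t, 0 ≤ t → |deriv S.urd t| ≤ Bu
  deriv2_urd_le : ∀ t, 0 ≤ t → |deriv (deriv S.urd) t| ≤ Bu
  Y_le : ∀ t, 0 ≤ t → S.Y (S.urd t) ≤ -Ymin
  X_le : ∀ t, 0 ≤ t → |S.X (S.urd t)| ≤ Xmax
  κ_le : ∀ θ, |S.κ θ| ≤ κmax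
  κ'_le : ∀ θ, |deriv S.κ θ| ≤ κ'max
  damping : Xmax * κmax < Ymin

/-- A solution on an interval with least element `t₀` along which `C_r ≥ c` and
`V̂_N² ≤ u_rd² - η`, starting with errors and sway velocity bounded by `R`. -/
structure IsRegular (S : Setup) (η c R : ℝ) (J : Set ℝ) (t₀ : ℝ) (z : ℝ → State) : Prop where
  ordConnected : J.OrdConnected
  isLeast : IsLeast J t₀
  t₀_nonneg : 0 ≤ t₀
  sol : S.IsSolutionOn J z
  Cr_ge : ∀ t ∈ J, c ≤ S.CrAt t (z t)
  gap : ∀ t ∈ J, η + S.VNh (z t) ^ 2 ≤ S.urd t ^ 2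
  v_le : |(z t₀).v| ≤ R
  err_le : S.errNorm t₀ (z t₀) ≤ R

/-- Exponential decay of an unforced damped oscillator. -/
theorem oscillator_decay {k1 k2 : ℝ} (hk1 : 0 < k1) (hk2 : 0 < k2) :
    ∃ K rate : ℝ, 0 < K ∧ 0 < rate ∧ ∀ (J : Set ℝ) (t₀ : ℝ) (p q : ℝ → ℝ), J.OrdConnected →
      IsLeast J t₀ → (∀ t ∈ J, HasDerivWithinAt p (-k2 * q t) J t) →
      (∀ t ∈ J, HasDerivWithinAt q (-k1 * q t + p t) J t) →
      ∀ t ∈ J, p t ^ 2 + q t ^ 2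
        ≤ K * (p t₀ ^ 2 + q t₀ ^ 2) * Real.exp (-rate * (t - t₀)) := by
  obtain ⟨ε, lam, K, m, M, hlam, hK, hm, hM, h1, h2, h3⟩ :=
    exists_oscillator_lyapunov hk1 hk2 one_pos zero_le_one
  refine ⟨M * (1 + k2 ^ 2) / (m * min 1 (k2 ^ 2)), lam / 2, by positivity, by positivity, ?_⟩
  intro J t₀ p q hJ ht₀ hp hq t ht
  -- in the variables `p` and `-k₂ q` the system has the form of the Lyapunov lemma with `C = 1`
  have hdec := le_exp_of_deriv_le hJ ht₀
    (f := fun s => k2 * p s ^ 2 + (-k2 * q s) ^ 2 + 2 * ε * (p s * (-k2 * q s)))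
    (lam := lam) (rate := lam / 2) (K := 0) (by linarith) le_rfl
    ((by positivity : 0 ≤ m * (p t₀ ^ 2 + (-k2 * q t₀) ^ 2)).trans (h2 _ _))
    (fun s hs => by
      have hq' := (hq s hs).const_mul (-k2)
      refine ⟨_, ((((hp s hs).fun_pow 2).const_mul k2).fun_add (hq'.fun_pow 2)).fun_add
        (((hp s hs).fun_mul hq').const_mul (2 * ε)), ?_⟩
      have := h1 (p s) (-k2 * q s) 1 0 0 le_rfl le_rfl
      refine le_trans (le_of_eq ?_) (this.trans (le_of_eq ?_)) <;> push_cast <;> ring) t ht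
  simp only [zero_div, add_zero] at hdec
  have hup := h3 (p t₀) (-k2 * q t₀)
  have hlow := h2 (p t) (-k2 * q t)
  have hexp := Real.exp_pos (-(lam / 2) * (t - t₀))
  have ha : m * min 1 (k2 ^ 2) * (p t ^ 2 + q t ^ 2) ≤ m * (p t ^ 2 + (-k2 * q t) ^ 2) := by
    rw [mul_assoc]
    refine mul_le_mul_of_nonneg_left ?_ hm.le
    have e1 := mul_le_mul_of_nonneg_right (min_le_left 1 (k2 ^ 2)) (sq_nonneg (p t))
    have e2 := mul_le_mul_of_nonneg_right (min_le_right 1 (k2 ^ 2)) (sq_nonneg (q t))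
    nlinarith
  have hb : M * (p t₀ ^ 2 + (-k2 * q t₀) ^ 2) ≤ M * (1 + k2 ^ 2) * (p t₀ ^ 2 + q t₀ ^ 2) := by
    rw [mul_assoc]
    refine mul_le_mul_of_nonneg_left ?_ hM.le
    nlinarith [mul_nonneg (sq_nonneg k2) (sq_nonneg (p t₀)), sq_nonneg (q t₀)]
  rw [div_mul_eq_mul_div, div_mul_eq_mul_div, le_div_iff₀ (by positivity), mul_comm]
  calc _ ≤ _ := ha.trans (hlow.trans hdec)
    _ ≤ _ := mul_le_mul_of_nonneg_right (hup.trans hb) hexp.le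

variable {S : Setup} {u0 Bu Ymin Xmax κmax κ'max η c R : ℝ}

theorem exp_rate_mono {a b t t₀ : ℝ} (hab : a ≤ b) (ht : t₀ ≤ t) :
    Real.exp (-b * (t - t₀)) ≤ Real.exp (-a * (t - t₀)) :=
  Real.exp_le_exp.2 (by nlinarith)

/-- The observer errors form two damped oscillators and `ũ` obeys `ũ' = -k_u ũ`; none of the
other states enters. -/
theorem obsSq_decay (S : Setup) (hsm : ContDiff ℝ 2 S.urd) :
    ∃ K rate : ℝ, 0 < K ∧ 0 < rate ∧ ∀ (J : Set ℝ) (t₀ : ℝ) (z : ℝ → State), J.OrdConnected →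
      IsLeast J t₀ → S.IsSolutionOn J z → ∀ t ∈ J,
        S.obsSq t (z t) ≤ K * S.obsSq t₀ (z t₀) * Real.exp (-rate * (t - t₀)) := by
  obtain ⟨K1, r1, hK1, hr1, h1⟩ := oscillator_decay S.kx1_pos S.kx2_pos
  obtain ⟨K2, r2, hK2, hr2, h2⟩ := oscillator_decay S.ky1_pos S.ky2_pos
  refine ⟨K1 + K2 + 1, min (min r1 r2) S.ku, by positivity,
    lt_min (lt_min hr1 hr2) S.ku_pos, ?_⟩
  intro J t₀ z hJ ht₀ hz t ht
  have a1 := h1 J t₀ (fun s => S.Vx - (z s).Vxh) (fun s => (z s).x - (z s).xh) hJ ht₀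
    (fun s hs => hz.hasDeriv_Vxe hs) (fun s hs => hz.hasDeriv_xe hs) t ht
  have a2 := h2 J t₀ (fun s => S.Vy - (z s).Vyh) (fun s => (z s).y - (z s).yh) hJ ht₀
    (fun s hs => hz.hasDeriv_Vye hs) (fun s hs => hz.hasDeriv_ye hs) t ht
  have hd : 0 ≤ S.d11 / S.m11 := div_nonneg S.d11_nonneg S.m11_pos.le
  have hku := S.ku_pos
  have a3 := le_exp_of_deriv_le hJ ht₀ (f := fun s => ((z s).u - S.urd s) ^ 2)
    (lam := 2 * S.ku) (rate := S.ku) (K := 0) (by linarith) le_rfl (sq_nonneg _)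
    (fun s hs => ⟨_, (hz.hasDeriv_uerr hs hsm).fun_pow 2, by
      push_cast
      nlinarith [mul_nonneg hd (sq_nonneg ((z s).u - S.urd s))]⟩) t ht
  simp only [zero_div, add_zero] at a3
  have ht' := ht₀.2 ht
  have e1 := exp_rate_mono ((min_le_left (min r1 r2) S.ku).trans (min_le_left _ _)) ht'
  have e2 := exp_rate_mono ((min_le_left (min r1 r2) S.ku).trans (min_le_right _ _)) ht'
  have e3 := exp_rate_mono (min_le_right (min r1 r2) S.ku) ht'
  set X := Real.exp (-min (min r1 r2) S.ku * (t - t₀)) with hX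
  have hX0 : 0 ≤ X := (Real.exp_pos _).le
  have b1 := a1.trans (mul_le_mul_of_nonneg_left e1 (by positivity))
  have b2 := a2.trans (mul_le_mul_of_nonneg_left e2 (by positivity))
  have b3 := a3.trans (mul_le_mul_of_nonneg_left e3 (sq_nonneg _))
  rw [obsSq, obsSq]
  have p1 := mul_nonneg (sq_nonneg ((z t₀).x - (z t₀).xh)) hX0
  have p2 := mul_nonneg (sq_nonneg ((z t₀).y - (z t₀).yh)) hX0
  have p3 := mul_nonneg (sq_nonneg (S.Vx - (z t₀).Vxh)) hX0
  have p4 := mul_nonneg (sq_nonneg (S.Vy - (z t₀).Vyh)) hX0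
  have p5 := mul_nonneg (sq_nonneg ((z t₀).u - S.urd t₀)) hX0
  nlinarith [mul_nonneg hK1.le p2, mul_nonneg hK1.le p4, mul_nonneg hK1.le p5,
    mul_nonneg hK2.le p1, mul_nonneg hK2.le p3, mul_nonneg hK2.le p5]

theorem obsSq_le_errSq (S : Setup) (t : ℝ) (z : State) : S.obsSq t z ≤ S.errSq t z := by
  rw [errSq_eq]; nlinarith [sq_nonneg (S.ybp z), sq_nonneg (S.xbp z), sq_nonneg (S.ψerr t z),
    sq_nonneg (S.rerr t z)]

theorem IsRegular.errSq_le {J : Set ℝ} {t₀ : ℝ} {z : ℝ → State} (h : S.IsRegular η c R J t₀ z) :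
    S.errSq t₀ (z t₀) ≤ R ^ 2 := by
  rw [← errNorm_sq]
  exact pow_le_pow_left₀ (Real.sqrt_nonneg _) h.err_le 2

theorem abs_le_sqrt_obsSq (S : Setup) (t : ℝ) (z : State) :
    |z.x - z.xh| ≤ √(S.obsSq t z) ∧ |z.y - z.yh| ≤ √(S.obsSq t z) ∧
    |S.Vx - z.Vxh| ≤ √(S.obsSq t z) ∧ |S.Vy - z.Vyh| ≤ √(S.obsSq t z) ∧
    |z.u - S.urd t| ≤ √(S.obsSq t z) := by
  have h1 := sq_nonneg (z.x - z.xh)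
  have h2 := sq_nonneg (z.y - z.yh)
  have h3 := sq_nonneg (S.Vx - z.Vxh)
  have h4 := sq_nonneg (S.Vy - z.Vyh)
  have h5 := sq_nonneg (z.u - S.urd t)
  refine ⟨?_, ?_, ?_, ?_, ?_⟩ <;> refine Real.abs_le_sqrt ?_ <;> rw [obsSq] <;> linarith

theorem abs_mul_cos_add_mul_sin_le (a b φ : ℝ) :
    |a * Real.cos φ + b * Real.sin φ| ≤ |a| + |b| := by
  refine (abs_add_le _ _).trans (add_le_add ?_ ?_) <;> rw [abs_mul]
  · exact mul_le_of_le_one_right (abs_nonneg _) (Real.abs_cos_le_one _)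
  · exact mul_le_of_le_one_right (abs_nonneg _) (Real.abs_sin_le_one _)

theorem abs_neg_mul_sin_add_mul_cos_le (a b φ : ℝ) :
    |-a * Real.sin φ + b * Real.cos φ| ≤ |a| + |b| := by
  have := abs_mul_cos_add_mul_sin_le b (-a) φ
  rw [abs_neg] at this
  rw [add_comm, add_comm |a|]; exact this

theorem abs_VTerr_le (S : Setup) (t : ℝ) (z : State) : |S.VTerr z| ≤ 2 * √(S.obsSq t z) := by
  obtain ⟨-, -, h1, h2, -⟩ := S.abs_le_sqrt_obsSq t z
  exact (abs_mul_cos_add_mul_sin_le _ _ _).trans (by linarith)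

theorem abs_VNerr_le (S : Setup) (t : ℝ) (z : State) : |S.VNerr z| ≤ 2 * √(S.obsSq t z) := by
  obtain ⟨-, -, h1, h2, -⟩ := S.abs_le_sqrt_obsSq t z
  exact (abs_neg_mul_sin_add_mul_cos_le _ _ _).trans (by linarith)

/-- Regular solutions keep the arguments of `r_d` in a fixed tube. -/
theorem exists_tube (H : S.Standing u0 Bu Ymin Xmax κmax κ'max) (η c R : ℝ) (hη : 0 < η) :
    ∃ η' B : ℝ, 0 < η' ∧ ∀ (J : Set ℝ) (t₀ : ℝ) (z : ℝ → State), S.IsRegular η c R J t₀ z →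
      ∀ t ∈ J, S.argsVec t (z t) ∈ S.tubeCr η' B c := by
  obtain ⟨K, rate, hK, hrate, hdec⟩ := S.obsSq_decay H.smooth
  set r := √(K * R ^ 2) with hr
  refine ⟨min η u0, Bu + |S.Vx| + |S.Vy| + 2 * r, lt_min hη H.u0_pos, ?_⟩
  intro J t₀ z hz t ht
  have ht0 : 0 ≤ t := hz.t₀_nonneg.trans (hz.isLeast.2 ht)
  have hobs : √(S.obsSq t (z t)) ≤ r := by
    refine Real.sqrt_le_sqrt ((hdec J t₀ z hz.ordConnected hz.isLeast hz.sol t ht).trans ?_)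
    have h1 : Real.exp (-rate * (t - t₀)) ≤ 1 :=
      Real.exp_le_one_iff.2 (by nlinarith [hz.isLeast.2 ht])
    have h2 := (S.obsSq_le_errSq t₀ (z t₀)).trans hz.errSq_le
    calc _ ≤ K * S.obsSq t₀ (z t₀) * 1 := mul_le_mul_of_nonneg_left h1
          (mul_nonneg hK.le (S.obsSq_nonneg _ _))
      _ ≤ K * R ^ 2 := by rw [mul_one]; exact mul_le_mul_of_nonneg_left h2 hK.le
  have hr0 : 0 ≤ r := Real.sqrt_nonneg _
  obtain ⟨h1, h2, h3, h4, h5⟩ := S.abs_le_sqrt_obsSq t (z t)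
  have hVx : |(z t).Vxh| ≤ |S.Vx| + r := by
    have := abs_sub_abs_le_abs_sub (z t).Vxh S.Vx
    rw [abs_sub_comm] at this; linarith
  have hVy : |(z t).Vyh| ≤ |S.Vy| + r := by
    have := abs_sub_abs_le_abs_sub (z t).Vyh S.Vy
    rw [abs_sub_comm] at this; linarith
  have hu : |(z t).u| ≤ |S.urd t| + r := by
    have := abs_sub_abs_le_abs_sub (z t).u (S.urd t)
    linarith
  have hBu := H.urd_le t ht0
  have hBu' := H.deriv_urd_le t ht0
  have hBu0 : 0 ≤ Bu := (abs_nonneg _).trans hBu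
  have n1 := abs_nonneg S.Vx
  have n2 := abs_nonneg S.Vy
  refine ⟨?_, hz.Cr_ge t ht⟩
  constructor
  · exact (min_le_right _ _).trans (H.urd_ge t ht0)
  · exact hBu.trans (by linarith)
  · exact hBu'.trans (by linarith)
  · exact hu.trans (by linarith)
  · exact (abs_mul_cos_add_mul_sin_le _ _ _).trans (by linarith)
  · exact (abs_neg_mul_sin_add_mul_cos_le _ _ _).trans (by linarith)
  · exact h1.trans (by linarith)
  · exact h2.trans (by linarith)
  · have := hz.gap t ht
    have h6 := min_le_left η u0
    change min η u0 + S.VNh (z t) ^ 2 ≤ S.urd t ^ 2 + (z t).v ^ 2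
    nlinarith [sq_nonneg (z t).v]

theorem headingGains_bound (S : Setup) {η' B : ℝ} (hη : 0 < η') :
    ∃ C, 0 ≤ C ∧ ∀ e ∈ tube η' B, |S.headingGainT (toArgs e)| ≤ C ∧
      |S.headingGainN (toArgs e)| ≤ C := by
  have hν := tame_ν (B := B) hη
  have hζ := tame_ζ (η := η') (B := B) S
  have hξ := tame_ξ (η := η') (B := B) S
  have hσ := tame_σ (B := B) S hη
  have hσi := tame_σ_inv (B := B) S hη
  have hdi := tame_disc_inv (B := B) S hη
  have hΔi := tame_invΔ (η := η') (B := B) S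
  obtain ⟨C1, hC1, h1⟩ := ((hΔi.mul (hσi.pow 2)).mul
    (((hν.mul hdi).mul hξ).sub ((hζ.add (hν.mul hσ)).mul hξ))).exists_abs_le
  obtain ⟨C2, hC2, h2⟩ := ((hΔi.mul (hσi.pow 2)).mul
    (((((Tame.const 1).add ((hν.mul hζ).mul hdi)).add (((hν.pow 2).mul hσ).mul hdi)).add
      ((hν.mul hdi).mul hζ)).sub ((hζ.add (hν.mul hσ)).mul hζ))).exists_abs_le
  refine ⟨max C1 C2, le_max_of_le_left hC1, fun e he => ?_⟩
  have hq : Guided (toArgs e) := tube_subset_guidedSet hη he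
  have := hq.utd_pos
  have := S.Δ_pos (toArgs e)
  have := hq.σ_pos (S := S)
  have := hq.disc_pos (S := S)
  have hy := S.y_eq (toArgs e)
  constructor
  · refine le_trans (le_of_eq ?_) ((h1 e he).trans (le_max_left _ _))
    congr 1
    rw [headingGainT, hq.gc_eq, hq.g_eq, hq.den_eq, Δx_eq, hy]
    field_simp
  · refine le_trans (le_of_eq ?_) ((h2 e he).trans (le_max_right _ _))
    congr 1
    have hVN : (toArgs e).VN = utd (toArgs e).ud (toArgs e).v * ν (toArgs e) := hq.VN_eq
    rw [headingGainN, hq.gc_eq, hq.gb_eq, hq.g_eq, hq.den_eq, Δy_eq, hVN, hy]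
    field_simp

/-- The unknown parts of the rates are linear in the observer errors. -/
theorem norm_unknownVec_le {C t : ℝ} {z : State} (hC : 0 ≤ C)
    (h1 : |S.headingGainT (S.args t z)| ≤ C) (h2 : |S.headingGainN (S.args t z)| ≤ C) :
    |S.headingGainT (S.args t z) * S.VTerr z + S.headingGainN (S.args t z) * S.VNerr z|
        ≤ 4 * C * √(S.obsSq t z) ∧
      ‖S.unknownVec t z‖ ≤ (2 + 4 * C) * √(S.obsSq t z) := by
  have hT := S.abs_VTerr_le t z
  have hN := S.abs_VNerr_le t z
  have ho := Real.sqrt_nonneg (S.obsSq t z)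
  obtain ⟨-, -, h3, h4, -⟩ := S.abs_le_sqrt_obsSq t z
  have hmul := mul_nonneg hC ho
  have ha : |S.headingGainT (S.args t z) * S.VTerr z + S.headingGainN (S.args t z) * S.VNerr z|
      ≤ 4 * C * √(S.obsSq t z) := by
    refine (abs_add_le _ _).trans ?_
    rw [abs_mul, abs_mul]
    nlinarith [mul_le_mul h1 hT (abs_nonneg _) hC, mul_le_mul h2 hN (abs_nonneg _) hC]
  refine ⟨ha, ?_⟩
  rw [pi_norm_le_iff_of_nonneg (by positivity)]
  have hz : ‖(0 : ℝ)‖ ≤ (2 + 4 * C) * √(S.obsSq t z) := by rw [norm_zero]; positivity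
  intro i
  fin_cases i
  iterate 7 exact hz
  all_goals simp only [unknownVec, Real.norm_eq_abs]
  · exact hN.trans (by nlinarith)
  · exact hT.trans (by nlinarith)
  · exact ha.trans (by nlinarith)
  · exact h3.trans (by nlinarith)
  · exact h4.trans (by nlinarith)

end Setup

namespace Setup
variable {S : Setup} {u0 Bu Ymin Xmax κmax κ'max η c R : ℝ}

/-! ### The heading subsystem -/

theorem sq_le_sq_of_abs_le {a b : ℝ} (h : |a| ≤ b) : a ^ 2 ≤ b ^ 2 := by
  rw [← sq_abs]; exact pow_le_pow_left₀ (abs_nonneg _) h 2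

theorem IsRegular.guided {J : Set ℝ} {t₀ : ℝ} {z : ℝ → State} {t : ℝ}
    (H : S.Standing u0 Bu Ymin Xmax κmax κ'max) (hz : S.IsRegular η c R J t₀ z) (ht : t ∈ J) :
    Guided (S.args t (z t)) :=
  (hz.sol.dom t ht).guided
    (H.u0_pos.trans_le (H.urd_ge t (hz.t₀_nonneg.trans (hz.isLeast.2 ht))))

/-- The yaw rate error satisfies the second oscillator equation, forced by the observer errors
through the gradient of `r_d`. -/
theorem IsRegular.hasDeriv_rerr {J : Set ℝ} {t₀ : ℝ} {z : ℝ → State} {t : ℝ}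
    (H : S.Standing u0 Bu Ymin Xmax κmax κ'max) (hz : S.IsRegular η c R J t₀ z) (ht : t ∈ J)
    (hd : DifferentiableAt ℝ S.rdVec (S.argsVec t (z t))) :
    HasDerivWithinAt (fun s => S.rerr s (z s))
      (-S.k1 * S.rerr t (z t) - S.k2 * S.CrAt t (z t) * S.ψerr t (z t)
        + -fderiv ℝ S.rdVec (S.argsVec t (z t)) (S.unknownVec t (z t))) J t := by
  have h1 := hd.hasFDerivAt.comp_hasDerivWithinAt t
    (hasDerivWithinAt_argsVec hz.sol ht H.smooth (hz.guided H ht))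
  refine ((hz.sol.r t ht).fun_sub h1).congr_deriv ?_
  rw [τr, rdKnown_eq hd, map_add, CrAt]
  ring

/-- Lyapunov function of the heading subsystem. -/
def headingLyap (S : Setup) (ε t : ℝ) (z : State) : ℝ :=
  S.k2 * S.ψerr t z ^ 2 + S.rerr t z ^ 2 + 2 * ε * (S.ψerr t z * S.rerr t z)

/-- Along regular solutions the heading Lyapunov function is dissipated, with a forcing by the observer
errors whose coefficient grows like `1 + v_r²` because the gradient of `r_d` grows like `1 + |v_r|`. -/
theorem exists_headingLyap (H : S.Standing u0 Bu Ymin Xmax κmax κ'max) (hη : 0 < η) (hc : 0 < c)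
    (R : ℝ) :
    ∃ ε lam m M C : ℝ, 0 < lam ∧ 0 < m ∧ 0 < M ∧ 0 ≤ C ∧
      (∀ t z, m * (S.ψerr t z ^ 2 + S.rerr t z ^ 2) ≤ S.headingLyap ε t z) ∧
      (∀ t z, S.headingLyap ε t z ≤ M * (S.ψerr t z ^ 2 + S.rerr t z ^ 2)) ∧
      ∀ (J : Set ℝ) (t₀ : ℝ) (z : ℝ → State), S.IsRegular η c R J t₀ z → ∀ t ∈ J,
        ∃ d, HasDerivWithinAt (fun s => S.headingLyap ε s (z s)) d J t ∧
          d ≤ -lam * S.headingLyap ε t (z t) + C * (1 + (z t).v ^ 2) * S.obsSq t (z t) := by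
  obtain ⟨η', B, hη', htube⟩ := exists_tube H η c R hη
  obtain ⟨C1, hC1, hrd⟩ := rd_bound (B := B) hη' H.κ_le H.κ'_le hc
  obtain ⟨Cb, hCb, hCr⟩ := (tame_Cr (B := B) S hη').exists_abs_le
  obtain ⟨C2, hC2, hgain⟩ := S.headingGains_bound (B := B) hη'
  obtain ⟨ε, lam, K, m, M, hlam, hK, hm, hM, h1, h2, h3⟩ :=
    exists_oscillator_lyapunov S.k1_pos S.k2_pos hc hCb
  refine ⟨ε, lam, m, M, K * ((4 * C2) ^ 2 + 2 * (C1 * (2 + 4 * C2)) ^ 2), hlam, hm, hM,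
    by positivity, fun t z => h2 _ _, fun t z => h3 _ _, ?_⟩
  intro J t₀ z hz t ht
  have he := htube J t₀ z hz t ht
  have hr := hrd _ he
  have hd : DifferentiableAt ℝ S.rdVec (S.argsVec t (z t)) := hr.1.differentiableAt (by norm_num)
  have hψ := hz.sol.hasDeriv_ψerr ht H.smooth (hz.guided H ht)
  have hre := hz.hasDeriv_rerr H ht hd
  refine ⟨_, (((hψ.fun_pow 2).const_mul S.k2).fun_add (hre.fun_pow 2)).fun_add
    ((hψ.fun_mul hre).const_mul (2 * ε)), ?_⟩
  obtain ⟨ha, hb⟩ := norm_unknownVec_le hC2 (hgain _ he.1).1 (hgain _ he.1).2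
  have hkey := h1 (S.ψerr t (z t)) (S.rerr t (z t)) (S.CrAt t (z t))
    (S.headingGainT (S.args t (z t)) * S.VTerr (z t)
      + S.headingGainN (S.args t (z t)) * S.VNerr (z t))
    (-fderiv ℝ S.rdVec (S.argsVec t (z t)) (S.unknownVec t (z t)))
    (hz.Cr_ge t ht) ((le_abs_self _).trans (hCr _ he.1))
  have hb' : |-fderiv ℝ S.rdVec (S.argsVec t (z t)) (S.unknownVec t (z t))|
      ≤ C1 * (1 + |(z t).v|) * ((2 + 4 * C2) * √(S.obsSq t (z t))) := by
    rw [abs_neg, ← Real.norm_eq_abs]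
    exact (ContinuousLinearMap.le_opNorm _ _).trans
      (mul_le_mul hr.2.2 hb (norm_nonneg _) (by positivity))
  have ho := Real.sq_sqrt (S.obsSq_nonneg t (z t))
  have ha2 := sq_le_sq_of_abs_le ha
  have hb2 := sq_le_sq_of_abs_le hb'
  have hb3 : (C1 * (1 + |(z t).v|) * ((2 + 4 * C2) * √(S.obsSq t (z t)))) ^ 2
      ≤ 2 * (C1 * (2 + 4 * C2)) ^ 2 * ((1 + (z t).v ^ 2) * S.obsSq t (z t)) := by
    have : (1 + |(z t).v|) ^ 2 ≤ 2 * (1 + (z t).v ^ 2) := by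
      nlinarith only [sq_abs (z t).v, sq_nonneg (1 - |(z t).v|)]
    have e : (C1 * (1 + |(z t).v|) * ((2 + 4 * C2) * √(S.obsSq t (z t)))) ^ 2
        = (C1 * (2 + 4 * C2)) ^ 2 * √(S.obsSq t (z t)) ^ 2 * (1 + |(z t).v|) ^ 2 := by ring
    rw [e, ho]
    calc _ ≤ (C1 * (2 + 4 * C2)) ^ 2 * S.obsSq t (z t) * (2 * (1 + (z t).v ^ 2)) :=
          mul_le_mul_of_nonneg_left this (mul_nonneg (sq_nonneg _) (S.obsSq_nonneg _ _))
      _ = _ := by ring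
  have ha3 : (4 * C2 * √(S.obsSq t (z t))) ^ 2
      ≤ (4 * C2) ^ 2 * ((1 + (z t).v ^ 2) * S.obsSq t (z t)) := by
    rw [mul_pow, ho]
    refine mul_le_mul_of_nonneg_left ?_ (sq_nonneg _)
    nlinarith only [mul_nonneg (sq_nonneg (z t).v) (S.obsSq_nonneg t (z t))]
  have hsum := mul_le_mul_of_nonneg_left (add_le_add (ha2.trans ha3) (hb2.trans hb3)) hK.le
  rw [headingLyap]
  refine le_trans (le_of_eq ?_) (hkey.trans ?_)
  · push_cast; ring
  · linarith only [hsum]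

/-! ### The sway velocity -/

/-- `ψ - γ`. -/
def courseErr (S : Setup) (z : State) : ℝ := z.ψ - S.γ z.θ

/-- The sway velocity corrected by the part of it that is driven by the rotation relative to the
path. -/
def swayCorr (S : Setup) (z : State) : ℝ := z.v - S.X z.u * S.courseErr z

theorem abs_arctan_lt (x : ℝ) : |Real.arctan x| < Real.pi / 2 :=
  abs_lt.2 ⟨Real.neg_pi_div_two_lt_arctan x, Real.arctan_lt_pi_div_two x⟩

/-- `ψ - γ` and `ψ̃` differ by two arctangents. -/
theorem abs_courseErr_le (S : Setup) (t : ℝ) (z : State) :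
    |S.courseErr z| ≤ |S.ψerr t z| + Real.pi := by
  have h1 : S.courseErr z = S.ψerr t z - Real.arctan (z.v / S.urd t)
      - losAngle S.μ (S.urd t) z.v (S.VNh z) (S.xbp z) (S.ybp z) := by
    simp only [courseErr, ψerr, ψd]; ring
  have h2 := abs_arctan_lt (z.v / S.urd t)
  have h3 : |losAngle S.μ (S.urd t) z.v (S.VNh z) (S.xbp z) (S.ybp z)| < Real.pi / 2 :=
    abs_arctan_lt _
  rw [h1]
  have h4 := abs_sub (S.ψerr t z - Real.arctan (z.v / S.urd t))
    (losAngle S.μ (S.urd t) z.v (S.VNh z) (S.xbp z) (S.ybp z))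
  have h5 := abs_sub (S.ψerr t z) (Real.arctan (z.v / S.urd t))
  linarith

theorem abs_θdot_le (S : Setup) (q : Args) : |S.θdot q| ≤ |q.u| + |q.v| + S.kδ + |q.VT| := by
  have h1 := abs_mul_cos_add_mul_sin_le q.u (-q.v) (S.relHeading q)
  rw [abs_neg] at h1
  have hs : 0 < √(1 + q.x ^ 2) := Real.sqrt_pos.2 (by positivity)
  have h2 : |S.kδ * q.x / √(1 + q.x ^ 2)| ≤ S.kδ := by
    rw [abs_div, abs_mul, abs_of_pos S.kδ_pos, abs_of_pos hs, div_le_iff₀ hs]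
    exact mul_le_mul_of_nonneg_left (Real.abs_le_sqrt (by linarith)) S.kδ_pos.le
  have h3 : S.θdot q = (q.u * Real.cos (S.relHeading q) + -q.v * Real.sin (S.relHeading q))
      + S.kδ * q.x / √(1 + q.x ^ 2) + q.VT := by
    rw [θdot, updateLaw]; ring
  rw [h3]
  exact (abs_add_le _ _).trans (add_le_add ((abs_add_le _ _).trans (add_le_add h1 h2)) le_rfl)

/-- The slope of `X`. -/
def Xslope (S : Setup) : ℝ := (S.m23 ^ 2 - S.m11 * S.m33) / (S.m22 * S.m33 - S.m23 ^ 2)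

/-- The slope of `Y`. -/
def Yslope (S : Setup) : ℝ := (S.m22 - S.m11) * S.m23 / (S.m22 * S.m33 - S.m23 ^ 2)

theorem X_eq (S : Setup) (u u' : ℝ) : S.X u = S.X u' + S.Xslope * (u - u') := by
  simp only [Vessel.X, Xslope]; ring

theorem Y_eq (S : Setup) (u u' : ℝ) : S.Y u = S.Y u' + S.Yslope * (u - u') := by
  simp only [Vessel.Y, Yslope]; ring

/-- The yaw rate cancels from the rate of the corrected sway velocity. -/
theorem IsSolutionOn.hasDeriv_swayCorr {J : Set ℝ} {z : ℝ → State} {t : ℝ}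
    (hz : S.IsSolutionOn J z) (ht : t ∈ J) :
    HasDerivWithinAt (fun s => S.swayCorr (z s))
      (S.Y (z t).u * (z t).v + S.X (z t).u * (S.κ (z t).θ * S.θdot (S.args t (z t)))
        - S.Xslope * S.udot t (z t) * S.courseErr (z t)) J t := by
  have hX : HasDerivWithinAt (fun s => S.X (z s).u) (S.Xslope * S.udot t (z t)) J t :=
    ((hz.u t ht).const_mul S.Xslope).add_const _
  refine ((hz.v t ht).fun_sub
    (hX.fun_mul ((hz.ψ t ht).fun_sub (hz.hasDeriv_γ ht)))).congr_deriv ?_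
  rw [courseErr]; ring

/-- Dissipation of `swayCorr`: the rotation of the vessel relative to the path is bounded, so that
only the rotation `κ θ̇` of the path frame competes with the sway damping. -/
theorem exists_swayCorr_deriv (H : S.Standing u0 Bu Ymin Xmax κmax κ'max) (hη : 0 < η) (c R : ℝ) :
    ∃ m C : ℝ, 0 < m ∧ 0 ≤ C ∧
      ∀ (J : Set ℝ) (t₀ : ℝ) (z : ℝ → State), S.IsRegular η c R J t₀ z → ∀ t ∈ J,
        (z t).v ^ 2 ≤ C * (1 + S.swayCorr (z t) ^ 2 + S.ψerr t (z t) ^ 2) ∧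
        S.swayCorr (z t) ^ 2 ≤ C * (1 + (z t).v ^ 2 + S.ψerr t (z t) ^ 2) ∧
        ∃ d, HasDerivWithinAt (fun s => S.swayCorr (z s) ^ 2) d J t ∧
          d ≤ -m * S.swayCorr (z t) ^ 2 + C * (1 + S.ψerr t (z t) ^ 2)
            + C * S.obsSq t (z t) * S.swayCorr (z t) ^ 2 := by
  obtain ⟨η', B, hη', htube⟩ := exists_tube H η c R hη
  obtain ⟨CX, hCX, hX⟩ := (tame_X (η := η') (B := B) S).exists_abs_le
  obtain ⟨CY, hCY, hY⟩ := (tame_Y (η := η') (B := B) S).exists_abs_le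
  have hd : 0 ≤ S.d11 / S.m11 := div_nonneg S.d11_nonneg S.m11_pos.le
  have hku := S.ku_pos
  set D := S.d11 / S.m11 + S.ku with hD
  have hm : 0 < Ymin - Xmax * κmax := sub_pos.2 H.damping
  set m := Ymin - Xmax * κmax with hmdef
  have hκ0 : 0 ≤ κmax := (abs_nonneg _).trans (H.κ_le 0)
  have hBu0 : 0 ≤ Bu := (abs_nonneg _).trans (H.urd_le 0 le_rfl)
  -- the constant in front of `|w| (1 + |ψ - γ|)`
  set A := CY * CX + CX * κmax * (2 * |B| + S.kδ + CX) + |S.Xslope| * (Bu + D * (|B| + Bu)) with hA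
  have hA0 : 0 ≤ A := by have := S.kδ_pos; positivity
  set G := |S.Yslope| + |S.Xslope| * κmax with hG
  have hG0 : 0 ≤ G := by positivity
  set P := Real.pi + 1 with hP
  have hP0 : 0 < P := by positivity
  set C := 2 * G ^ 2 / m + 4 * A ^ 2 / m * P ^ 2 + (2 + 4 * CX ^ 2) * (1 + P ^ 2) with hC
  have hC1 : 2 * G ^ 2 / m ≤ C := by
    have : 0 ≤ 4 * A ^ 2 / m * P ^ 2 + (2 + 4 * CX ^ 2) * (1 + P ^ 2) := by positivity
    linarith
  have hC2 : 4 * A ^ 2 / m * P ^ 2 ≤ C := by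
    have : 0 ≤ 2 * G ^ 2 / m + (2 + 4 * CX ^ 2) * (1 + P ^ 2) := by positivity
    linarith
  have hC3 : (2 + 4 * CX ^ 2) * (1 + P ^ 2) ≤ C := by
    have : 0 ≤ 2 * G ^ 2 / m + 4 * A ^ 2 / m * P ^ 2 := by positivity
    linarith
  refine ⟨m, C, hm, by positivity, ?_⟩
  intro J t₀ z hz t ht
  have ht0 : 0 ≤ t := hz.t₀_nonneg.trans (hz.isLeast.2 ht)
  have he := (htube J t₀ z hz t ht).1
  have hXt : |S.X (z t).u| ≤ CX := hX _ he
  have hYt : |S.Y (z t).u| ≤ CY := hY _ he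
  have hB : B ≤ |B| := le_abs_self B
  have hh := S.abs_courseErr_le t (z t)
  have hθ := S.abs_θdot_le (S.args t (z t))
  have hu : |(z t).u| ≤ |B| := he.u_le.trans hB
  have hVT : |(S.args t (z t)).VT| ≤ |B| := he.VT_le.trans hB
  have hdef : S.swayCorr (z t) = (z t).v - S.X (z t).u * S.courseErr (z t) := rfl
  have hder := (hz.sol.hasDeriv_swayCorr ht).fun_pow 2
  have hudot : |S.udot t (z t)| ≤ Bu + D * (|B| + Bu) := by
    have h1 : S.udot t (z t) = deriv S.urd t - D * ((z t).u - S.urd t) := by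
      simp only [udot, τu, hD]; ring
    have h2 := abs_sub (z t).u (S.urd t)
    rw [h1]
    refine (abs_sub _ _).trans (add_le_add (H.deriv_urd_le t ht0) ?_)
    rw [abs_mul, abs_of_nonneg (by positivity)]
    exact mul_le_mul_of_nonneg_left (h2.trans (add_le_add hu (H.urd_le t ht0))) (by positivity)
  have hYu := S.Y_eq (z t).u (S.urd t)
  have hXu := S.X_eq (z t).u (S.urd t)
  have hYd := H.Y_le t ht0
  have hXd := H.X_le t ht0
  have hκt := H.κ_le (z t).θ
  have hobs := (S.abs_le_sqrt_obsSq t (z t)).2.2.2.2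
  have hobs2 : ((z t).u - S.urd t) ^ 2 ≤ S.obsSq t (z t) := by
    rw [obsSq]
    linarith only [sq_nonneg ((z t).x - (z t).xh), sq_nonneg ((z t).y - (z t).yh),
      sq_nonneg (S.Vx - (z t).Vxh), sq_nonneg (S.Vy - (z t).Vyh)]
  have huv : (S.args t (z t)).u = (z t).u := rfl
  have hvv : (S.args t (z t)).v = (z t).v := rfl
  rw [huv, hvv] at hθ
  generalize S.swayCorr (z t) = w at *
  generalize S.courseErr (z t) = h at *
  generalize S.θdot (S.args t (z t)) = Θ at *
  generalize S.udot t (z t) = U at *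
  generalize S.ψerr t (z t) = p at *
  generalize S.κ (z t).θ = κ at *
  generalize (z t).v = v at *
  generalize (S.args t (z t)).VT = VT at *
  generalize S.obsSq t (z t) = O at *
  have hp0 := abs_nonneg p
  have hh0 := abs_nonneg h
  have hw0 := abs_nonneg w
  have hhP : 1 + |h| ≤ P + |p| := by linarith
  have hhsq : (1 + |h|) ^ 2 ≤ 2 * P ^ 2 + 2 * p ^ 2 := by
    calc _ ≤ (P + |p|) ^ 2 := pow_le_pow_left₀ (by positivity) hhP 2
      _ ≤ _ := by nlinarith only [sq_nonneg (P - |p|), sq_abs p]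
  have hP1 : 1 ≤ P := by have := Real.pi_pos; linarith
  have hhsq' : (1 + |h|) ^ 2 ≤ 2 * P ^ 2 * (1 + p ^ 2) := by
    nlinarith only [hhsq, mul_nonneg (sq_nonneg p) (sub_nonneg.2 (one_le_pow₀ hP1 : 1 ≤ P ^ 2))]
  have hh2 : h ^ 2 ≤ 2 * P ^ 2 * (1 + p ^ 2) := by nlinarith only [hhsq', sq_abs h, hh0]
  have hX2 : S.X (z t).u ^ 2 ≤ CX ^ 2 := sq_le_sq_of_abs_le hXt
  have hXh : (S.X (z t).u * h) ^ 2 ≤ CX ^ 2 * (2 * P ^ 2 * (1 + p ^ 2)) := by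
    rw [mul_pow]; exact mul_le_mul hX2 hh2 (sq_nonneg _) (sq_nonneg _)
  have hv : v = w + S.X (z t).u * h := by rw [hdef]; ring
  have hsq : ∀ a b d : ℝ, a = b + d ∨ a = b - d → d ^ 2 ≤ CX ^ 2 * (2 * P ^ 2 * (1 + p ^ 2)) →
      a ^ 2 ≤ C * (1 + b ^ 2 + p ^ 2) := by
    intro a b d had hd2
    have h1 : a ^ 2 ≤ 2 * b ^ 2 + 2 * d ^ 2 := by
      rcases had with rfl | rfl
      · nlinarith only [sq_nonneg (b - d)]
      · nlinarith only [sq_nonneg (b + d)]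
    have h2 := mul_le_mul_of_nonneg_right hC3 (by positivity : 0 ≤ 1 + b ^ 2 + p ^ 2)
    refine h1.trans (le_trans ?_ h2)
    have h3 : 0 ≤ (2 + 4 * CX ^ 2) * (1 + p ^ 2) := by positivity
    have h4 : 0 ≤ (2 + 4 * CX ^ 2) * P ^ 2 * b ^ 2 + 4 * CX ^ 2 * b ^ 2
      + 2 * P ^ 2 * (1 + p ^ 2) := by positivity
    nlinarith only [hd2, h3, h4]
  refine ⟨hsq _ _ _ (Or.inl hv) hXh, hsq _ _ _ (Or.inr hdef) hXh, _, hder, ?_⟩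
  simp only [Nat.cast_ofNat, pow_one, Nat.succ_sub_succ_eq_sub, tsub_zero]
  -- the coefficient of `w²`
  have hcoef : S.Y (z t).u + |S.X (z t).u| * κmax ≤ -(3 / 4 * m) + G ^ 2 / m * O := by
    have h1 : S.Yslope * ((z t).u - S.urd t) ≤ |S.Yslope| * |(z t).u - S.urd t| := by
      rw [← abs_mul]; exact le_abs_self _
    have h2 : |S.X (z t).u| ≤ Xmax + |S.Xslope| * |(z t).u - S.urd t| := by
      rw [hXu, ← abs_mul]; exact (abs_add_le _ _).trans (add_le_add hXd le_rfl)
    have h3 := mul_le_mul_of_nonneg_right h2 hκ0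
    have h4 : G * |(z t).u - S.urd t| ≤ m / 4 + G ^ 2 / m * O := by
      have h5 : m / 4 + G ^ 2 / m * |(z t).u - S.urd t| ^ 2 - G * |(z t).u - S.urd t|
          = (m - 2 * G * |(z t).u - S.urd t|) ^ 2 / (4 * m) := by field_simp; ring
      have h6 : 0 ≤ (m - 2 * G * |(z t).u - S.urd t|) ^ 2 / (4 * m) := by positivity
      have h7 : G ^ 2 / m * |(z t).u - S.urd t| ^ 2 ≤ G ^ 2 / m * O := by
        rw [sq_abs]; exact mul_le_mul_of_nonneg_left hobs2 (by positivity)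
      linarith only [h5, h6, h7]
    have h8 : G * |(z t).u - S.urd t| = |S.Yslope| * |(z t).u - S.urd t|
        + |S.Xslope| * |(z t).u - S.urd t| * κmax := by rw [hG]; ring
    linarith only [hYu, hYd, h1, h3, h4, h8, hmdef,
      add_mul Xmax (|S.Xslope| * |(z t).u - S.urd t|) κmax]
  have hvabs : |v| ≤ |w| + CX * |h| := by
    rw [hv]; refine (abs_add_le _ _).trans (add_le_add le_rfl ?_)
    rw [abs_mul]; exact mul_le_mul_of_nonneg_right hXt hh0
  have hΘ : |Θ| ≤ |w| + (2 * |B| + S.kδ + CX) * (1 + |h|) := by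
    have := S.kδ_pos
    nlinarith only [hθ, hu, hVT, hvabs, hCX, mul_nonneg (by positivity : 0 ≤ 2 * |B| + S.kδ) hh0]
  have hterm : w * (S.Y (z t).u * v + S.X (z t).u * (κ * Θ) - S.Xslope * U * h)
      ≤ (S.Y (z t).u + |S.X (z t).u| * κmax) * w ^ 2 + A * (|w| * (1 + |h|)) := by
    have t1 : w * (S.Y (z t).u * v) ≤ S.Y (z t).u * w ^ 2 + CY * CX * (|w| * (1 + |h|)) := by
      have : w * (S.Y (z t).u * v) = S.Y (z t).u * w ^ 2 + S.Y (z t).u * S.X (z t).u * (w * h) := by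
        rw [hv]; ring
      rw [this]
      refine add_le_add le_rfl ((le_abs_self _).trans ?_)
      rw [abs_mul, abs_mul, abs_mul]
      have := mul_le_mul hYt hXt (abs_nonneg _) hCY
      exact mul_le_mul this (mul_le_mul_of_nonneg_left (by linarith only) hw0) (by positivity)
        (by positivity)
    have t2 : w * (S.X (z t).u * (κ * Θ)) ≤ |S.X (z t).u| * κmax * w ^ 2
        + CX * κmax * (2 * |B| + S.kδ + CX) * (|w| * (1 + |h|)) := by
      refine (le_abs_self _).trans ?_
      rw [abs_mul, abs_mul, abs_mul]
      have h1 : |κ| * |Θ| ≤ κmax * (|w| + (2 * |B| + S.kδ + CX) * (1 + |h|)) :=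
        mul_le_mul hκt hΘ (abs_nonneg _) hκ0
      have h2 := mul_le_mul_of_nonneg_left (mul_le_mul_of_nonneg_left h1 (abs_nonneg (S.X (z t).u)))
        hw0
      have h3 : 0 ≤ κmax * ((2 * |B| + S.kδ + CX) * (1 + |h|)) * |w| := by
        have := S.kδ_pos; positivity
      have h4 := mul_le_mul_of_nonneg_right hXt h3
      have h5 : |w| * |w| = w ^ 2 := by rw [← sq, sq_abs]
      calc _ ≤ _ := h2
        _ = |S.X (z t).u| * κmax * (|w| * |w|)
            + |S.X (z t).u| * (κmax * ((2 * |B| + S.kδ + CX) * (1 + |h|)) * |w|) := by ring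
        _ ≤ _ := by rw [h5]; refine add_le_add le_rfl (h4.trans (le_of_eq (by ring)))
    have t3 : -(w * (S.Xslope * U * h))
        ≤ |S.Xslope| * (Bu + D * (|B| + Bu)) * (|w| * (1 + |h|)) := by
      refine (neg_le_abs _).trans ?_
      rw [abs_mul, abs_mul, abs_mul]
      have h1 := mul_le_mul_of_nonneg_left hudot (abs_nonneg S.Xslope)
      calc _ = |S.Xslope| * |U| * (|w| * |h|) := by ring
        _ ≤ _ := mul_le_mul h1 (mul_le_mul_of_nonneg_left (by linarith only) hw0) (by positivity)
            (by positivity)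
    have := add_le_add (add_le_add t1 t2) t3
    refine le_trans (le_of_eq (by ring)) (this.trans (le_of_eq (by rw [hA]; ring)))
  have hyoung : A * (|w| * (1 + |h|)) ≤ m / 4 * w ^ 2 + A ^ 2 / m * (1 + |h|) ^ 2 := by
    have h5 : m / 4 * |w| ^ 2 + A ^ 2 / m * (1 + |h|) ^ 2 - A * (|w| * (1 + |h|))
        = (m * |w| - 2 * A * (1 + |h|)) ^ 2 / (4 * m) := by field_simp; ring
    have h6 : 0 ≤ (m * |w| - 2 * A * (1 + |h|)) ^ 2 / (4 * m) := by positivity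
    rw [sq_abs] at h5
    linarith only [h5, h6]
  have hc1 := mul_le_mul_of_nonneg_right hcoef (sq_nonneg w)
  have hO0 : 0 ≤ O := (sq_nonneg _).trans hobs2
  have hc2 := mul_le_mul_of_nonneg_right hC1 (mul_nonneg hO0 (sq_nonneg w))
  have hc3 := mul_le_mul_of_nonneg_right hC2 (by positivity : 0 ≤ 1 + p ^ 2)
  have hc4 := mul_le_mul_of_nonneg_left hhsq' (by positivity : 0 ≤ 2 * A ^ 2 / m)
  have e1 : 2 * A ^ 2 / m * (2 * P ^ 2 * (1 + p ^ 2)) = 4 * A ^ 2 / m * P ^ 2 * (1 + p ^ 2) := by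
    ring
  have e2 : 2 * A ^ 2 / m = 2 * (A ^ 2 / m) := by ring
  have e3 : 2 * G ^ 2 / m = 2 * (G ^ 2 / m) := by ring
  rw [e1, e2] at hc4
  rw [e3] at hc2
  have hfin := mul_le_mul_of_nonneg_left (hterm.trans (add_le_add hc1 hyoung)) zero_le_two
  refine le_trans (le_of_eq ?_) (hfin.trans ?_)
  · ring
  · linarith only [hc2, hc3, hc4]

end Setup

namespace Setup
variable {S : Setup} {u0 Bu Ymin Xmax κmax κ'max η c R : ℝ}

/-! ### Exponential decay of the error state -/

/-- Along regular solutions the sway velocity is bounded, and the heading and observer errors decay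
exponentially, uniformly. -/
theorem exists_heading_decay (H : S.Standing u0 Bu Ymin Xmax κmax κ'max) (hη : 0 < η) (hc : 0 < c)
    (R : ℝ) :
    ∃ Bv K rate : ℝ, 0 ≤ Bv ∧ 0 < K ∧ 0 < rate ∧
      ∀ (J : Set ℝ) (t₀ : ℝ) (z : ℝ → State), S.IsRegular η c R J t₀ z → ∀ t ∈ J,
        |(z t).v| ≤ Bv ∧
        S.ψerr t (z t) ^ 2 + S.rerr t (z t) ^ 2
          ≤ K * S.errSq t₀ (z t₀) * Real.exp (-rate * (t - t₀)) ∧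
        S.obsSq t (z t) ≤ K * S.errSq t₀ (z t₀) * Real.exp (-rate * (t - t₀)) := by
  obtain ⟨ε, lam, m, M, C1, hlam, hm, hM, hC1, hlow, hup, hL⟩ := exists_headingLyap H hη hc R
  obtain ⟨ms, C2, hms, hC2, hS⟩ := exists_swayCorr_deriv H hη c R
  obtain ⟨Ko, ro, hKo, hro, hO⟩ := S.obsSq_decay H.smooth
  -- the weight that makes the dissipation of the heading part dominate its effect on the sway part
  set k := 2 * C2 / (m * lam) + 1 with hk
  have hk1 : 1 ≤ k := by
    have : 0 ≤ 2 * C2 / (m * lam) := by positivity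
    linarith
  set Cv := (1 + C2) * (1 + 1 / m) with hCv
  have hCv0 : 0 ≤ Cv := by positivity
  set lz := min (lam / 2) ms with hlz
  have hlz0 : 0 < lz := lt_min (by positivity) hms
  set C3 := k * C1 * Cv + C2 with hC3
  have hC30 : 0 ≤ C3 := by positivity
  -- initial value and bound of the weighted sum `Z` of the two Lyapunov functions
  set Z0 := k * (M * R ^ 2) + C2 * (1 + R ^ 2 + R ^ 2) with hZ0
  set BZ := (1 + Z0 + (lz + C2) / lz) * Real.exp (C3 * (Ko * R ^ 2) / ro) with hBZ
  have hBZ0 : 0 ≤ BZ := by positivity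
  set s := min ro (lam / 2) with hs
  have hs0 : 0 < s := lt_min hro (by positivity)
  have hslam : s < lam := (min_le_right _ _).trans_lt (by linarith)
  set C4 := C1 * (Cv * (1 + BZ)) * Ko with hC4
  have hC40 : 0 ≤ C4 := by positivity
  refine ⟨√(Cv * (1 + BZ)), (M + C4 / (lam - s)) / m + Ko, s, Real.sqrt_nonneg _, ?_, hs0, ?_⟩
  · have : 0 < lam - s := sub_pos.2 hslam
    positivity
  intro J t₀ z hz
  have hE0 := S.errSq_nonneg t₀ (z t₀)
  have hER := hz.errSq_le
  have hLnn : ∀ t, 0 ≤ S.headingLyap ε t (z t) := fun t =>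
    (mul_nonneg hm.le (by positivity)).trans (hlow t (z t))
  have hp2 : ∀ t, S.ψerr t (z t) ^ 2 ≤ S.headingLyap ε t (z t) / m := fun t => by
    rw [le_div_iff₀ hm]
    nlinarith only [hlow t (z t), mul_nonneg hm.le (sq_nonneg (S.rerr t (z t)))]
  have hOb : ∀ t ∈ J, S.obsSq t (z t)
      ≤ Ko * S.errSq t₀ (z t₀) * Real.exp (-ro * (t - t₀)) := fun t ht =>
    (hO J t₀ z hz.ordConnected hz.isLeast hz.sol t ht).trans
      (mul_le_mul_of_nonneg_right (mul_le_mul_of_nonneg_left (S.obsSq_le_errSq _ _) hKo.le)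
        (Real.exp_pos _).le)
  set Z : ℝ → ℝ := fun t => k * S.headingLyap ε t (z t) + S.swayCorr (z t) ^ 2 with hZ
  have hZnn : ∀ t, 0 ≤ Z t := fun t => by
    have := hLnn t
    positivity
  have hv : ∀ t ∈ J, 1 + (z t).v ^ 2 ≤ Cv * (1 + Z t) := by
    intro t ht
    have h1 := (hS J t₀ z hz t ht).1
    have h2 := hp2 t
    have h3 := hLnn t
    have h4 : S.swayCorr (z t) ^ 2 + S.headingLyap ε t (z t) ≤ Z t := by
      rw [hZ]; nlinarith only [hk1, h3]
    have h5 : 1 + S.swayCorr (z t) ^ 2 + S.ψerr t (z t) ^ 2 ≤ (1 + 1 / m) * (1 + Z t) := by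
      have e : S.headingLyap ε t (z t) / m = 1 / m * S.headingLyap ε t (z t) := by ring
      have hm' : 0 ≤ 1 / m := by positivity
      have h6 := mul_le_mul_of_nonneg_left
        ((le_add_of_nonneg_left (sq_nonneg (S.swayCorr (z t)))).trans h4) hm'
      nlinarith only [h2, e, h6, h4, h3, hm']
    have h7 := mul_le_mul_of_nonneg_left h5 (by positivity : 0 ≤ 1 + C2)
    have h8 : 0 ≤ S.swayCorr (z t) ^ 2 + S.ψerr t (z t) ^ 2 := by positivity
    rw [hCv, mul_assoc]
    nlinarith only [h1, h7, h8]
  have hexp1 : ∀ t ∈ J, Real.exp (-ro * (t - t₀)) ≤ 1 := fun t ht =>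
    Real.exp_le_one_iff.2 (by nlinarith [hz.isLeast.2 ht])
  have hZb : ∀ t ∈ J, Z t ≤ BZ := by
    intro t ht
    have hb := le_of_deriv_le_integrable_add hz.ordConnected hz.isLeast (f := Z)
      (fun t _ => hZnn t) (lam := lz) (A := C2) (rate := ro) (K := C3 * (Ko * R ^ 2)) hlz0 hC2 hro
      (by positivity) (fun t ht => by
        obtain ⟨d1, hd1, hd1'⟩ := hL J t₀ z hz t ht
        obtain ⟨-, -, d2, hd2, hd2'⟩ := hS J t₀ z hz t ht
        refine ⟨_, (hd1.const_mul k).fun_add hd2, ?_⟩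
        have hOt := hOb t ht
        have hO0 := S.obsSq_nonneg t (z t)
        have hvt := hv t ht
        have hLt := hLnn t
        have hpt := hp2 t
        have hZt := hZnn t
        have hw := sq_nonneg (S.swayCorr (z t))
        have hZe : Z t = k * S.headingLyap ε t (z t) + S.swayCorr (z t) ^ 2 := rfl
        generalize Z t = ζ at *
        generalize S.headingLyap ε t (z t) = L at *
        generalize S.swayCorr (z t) ^ 2 = w at *
        generalize S.obsSq t (z t) = O at *
        generalize S.ψerr t (z t) ^ 2 = p at *
        have a1 : C2 * p ≤ k * (lam / 2) * L := by
          have h1 := mul_le_mul_of_nonneg_left hpt hC2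
          have h2 : k * (lam / 2) * L = C2 * (L / m) + lam / 2 * L := by rw [hk]; field_simp
          have h3 : 0 ≤ lam / 2 * L := by positivity
          linarith only [h1, h2, h3]
        have a2 : k * (C1 * (1 + (z t).v ^ 2) * O) ≤ k * C1 * Cv * (O * (1 + ζ)) := by
          have h1 := mul_le_mul_of_nonneg_left hvt (by positivity : 0 ≤ k * C1 * O)
          linarith only [h1]
        have a3 : C2 * O * w ≤ C2 * (O * (1 + ζ)) := by
          have h1 : w ≤ 1 + ζ := by
            have : 0 ≤ k * L := by positivity
            linarith only [hZe, this]
          have h2 := mul_le_mul_of_nonneg_left h1 (by positivity : 0 ≤ C2 * O)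
          linarith only [h2]
        have a4 : lz * ζ ≤ k * (lam / 2) * L + ms * w := by
          have h1 := mul_le_mul_of_nonneg_right (min_le_left (lam / 2) ms)
            (by positivity : 0 ≤ k * L)
          have h2 := mul_le_mul_of_nonneg_right (min_le_right (lam / 2) ms) hw
          rw [hZe]
          linarith only [h1, h2]
        have a5 : C3 * (O * (1 + ζ))
            ≤ C3 * (Ko * R ^ 2) * Real.exp (-ro * (t - t₀)) * (1 + ζ) := by
          have h1 := mul_le_mul_of_nonneg_right (mul_le_mul_of_nonneg_left hER hKo.le)
            (Real.exp_pos (-ro * (t - t₀))).le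
          have h2 := mul_le_mul_of_nonneg_left (mul_le_mul_of_nonneg_right (hOt.trans h1)
            (by positivity : 0 ≤ 1 + ζ)) hC30
          linarith only [h2]
        have a6 : C3 * (O * (1 + ζ)) = k * C1 * Cv * (O * (1 + ζ)) + C2 * (O * (1 + ζ)) := by
          rw [hC3]; ring
        have a7 := mul_le_mul_of_nonneg_left hd1' (zero_le_one.trans hk1)
        linarith only [a1, a2, a3, a4, a5, a6, a7, hd2']) t ht
    refine hb.trans (mul_le_mul_of_nonneg_right ?_ (Real.exp_pos _).le)
    have hz0 : Z t₀ ≤ Z0 := by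
      have h1 := (hup t₀ (z t₀)).trans (mul_le_mul_of_nonneg_left
        (show S.ψerr t₀ (z t₀) ^ 2 + S.rerr t₀ (z t₀) ^ 2 ≤ R ^ 2 by
          rw [errSq_eq] at hER
          linarith only [hER, S.obsSq_nonneg t₀ (z t₀), sq_nonneg (S.ybp (z t₀)),
            sq_nonneg (S.xbp (z t₀))]) hM.le)
      have h2 := (hS J t₀ z hz t₀ hz.isLeast.1).2.1
      have h3 : (z t₀).v ^ 2 ≤ R ^ 2 := sq_le_sq_of_abs_le hz.v_le
      have h4 : S.ψerr t₀ (z t₀) ^ 2 ≤ R ^ 2 := by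
        rw [errSq_eq] at hER
        linarith only [hER, S.obsSq_nonneg t₀ (z t₀), sq_nonneg (S.ybp (z t₀)),
            sq_nonneg (S.xbp (z t₀)), sq_nonneg (S.rerr t₀ (z t₀))]
      have h5 := mul_le_mul_of_nonneg_left h1 (zero_le_one.trans hk1)
      have h6 := mul_le_mul_of_nonneg_left (add_le_add (add_le_add le_rfl h3) h4 :
        1 + (z t₀).v ^ 2 + S.ψerr t₀ (z t₀) ^ 2 ≤ 1 + R ^ 2 + R ^ 2) hC2
      change k * S.headingLyap ε t₀ (z t₀) + S.swayCorr (z t₀) ^ 2 ≤ _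
      linarith only [h2, h5, h6, hZ0]
    linarith only [hz0]
  have hvb : ∀ t ∈ J, 1 + (z t).v ^ 2 ≤ Cv * (1 + BZ) := fun t ht =>
    (hv t ht).trans (mul_le_mul_of_nonneg_left (by linarith only [hZb t ht]) hCv0)
  have hLdec : ∀ t ∈ J, S.headingLyap ε t (z t)
      ≤ (M + C4 / (lam - s)) * S.errSq t₀ (z t₀) * Real.exp (-s * (t - t₀)) := by
    intro t ht
    have h := le_exp_of_deriv_le hz.ordConnected hz.isLeast
      (f := fun t => S.headingLyap ε t (z t)) (lam := lam) (rate := s)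
      (K := C4 * S.errSq t₀ (z t₀)) hslam (by positivity) (hLnn t₀)
      (fun t ht => by
        obtain ⟨d1, hd1, hd1'⟩ := hL J t₀ z hz t ht
        refine ⟨d1, hd1, hd1'.trans (add_le_add le_rfl ?_)⟩
        have h1 := mul_le_mul (mul_le_mul_of_nonneg_left (hvb t ht) hC1)
          ((hOb t ht).trans (mul_le_mul_of_nonneg_left (exp_rate_mono (min_le_left ro (lam / 2))
            (hz.isLeast.2 ht)) (by positivity))) (S.obsSq_nonneg _ _) (by positivity)
        refine h1.trans (le_of_eq ?_)
        rw [hC4]; ring) t ht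
    refine h.trans (mul_le_mul_of_nonneg_right ?_ (Real.exp_pos _).le)
    have h0 : S.headingLyap ε t₀ (z t₀) ≤ M * S.errSq t₀ (z t₀) := by
      refine (hup t₀ (z t₀)).trans (mul_le_mul_of_nonneg_left ?_ hM.le)
      rw [errSq_eq]
      linarith only [S.obsSq_nonneg t₀ (z t₀), sq_nonneg (S.ybp (z t₀)),
            sq_nonneg (S.xbp (z t₀))]
    have e : (M + C4 / (lam - s)) * S.errSq t₀ (z t₀)
        = M * S.errSq t₀ (z t₀) + C4 * S.errSq t₀ (z t₀) / (lam - s) := by ring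
    rw [e]
    linarith only [h0]
  intro t ht
  have hls : 0 < lam - s := sub_pos.2 hslam
  have hpos1 : 0 ≤ (M + C4 / (lam - s)) / m * S.errSq t₀ (z t₀) * Real.exp (-s * (t - t₀)) := by
    positivity
  have hpos2 : 0 ≤ Ko * S.errSq t₀ (z t₀) * Real.exp (-s * (t - t₀)) := by positivity
  refine ⟨Real.abs_le_sqrt (by linarith only [hvb t ht]), ?_, ?_⟩
  · have h1 := (hlow t (z t)).trans (hLdec t ht)
    rw [mul_comm, ← le_div_iff₀ hm] at h1
    refine h1.trans ?_
    have e : (M + C4 / (lam - s)) * S.errSq t₀ (z t₀) * Real.exp (-s * (t - t₀)) / m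
        = (M + C4 / (lam - s)) / m * S.errSq t₀ (z t₀) * Real.exp (-s * (t - t₀)) := by ring
    rw [e]
    linarith only [hpos2]
  · have h1 := (hOb t ht).trans (mul_le_mul_of_nonneg_left (exp_rate_mono
      (min_le_left ro (lam / 2)) (hz.isLeast.2 ht)) (by positivity))
    linarith only [h1, hpos1]

/-- `G₁` is at most linear in the heading and surge errors, uniformly in the position. -/
theorem abs_G1_le (S : Setup) (q : Args) :
    |S.G1 q| ≤ 2 * utd q.ud q.v * |q.ψe| + |q.u - q.ud| := by
  have hW : 0 ≤ utd q.ud q.v := Real.sqrt_nonneg _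
  have hcos : |1 - Real.cos q.ψe| ≤ |q.ψe| := by
    have h1 := Real.one_sub_sq_div_two_le_cos (x := q.ψe)
    have h2 := Real.neg_one_le_cos q.ψe
    rw [abs_of_nonneg (by linarith [Real.cos_le_one q.ψe])]
    rcases le_total |q.ψe| 2 with h | h
    · nlinarith [sq_abs q.ψe, abs_nonneg q.ψe]
    · linarith
  have hsin : |Real.sin q.ψe| ≤ |q.ψe| := Real.abs_sin_le_abs
  set φ := losAngle S.μ q.ud q.v q.VN q.x q.y
  have h1 : |utd q.ud q.v * (1 - Real.cos q.ψe) * Real.sin φ| ≤ utd q.ud q.v * |q.ψe| := by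
    rw [abs_mul, abs_mul, abs_of_nonneg hW]
    have := mul_le_mul_of_nonneg_left hcos hW
    exact (mul_le_of_le_one_right (by positivity) (Real.abs_sin_le_one _)).trans this
  have h2 : |(q.u - q.ud) * Real.sin (S.relHeading q)| ≤ |q.u - q.ud| := by
    rw [abs_mul]
    exact mul_le_of_le_one_right (abs_nonneg _) (Real.abs_sin_le_one _)
  have h3 : |utd q.ud q.v * Real.cos φ * Real.sin q.ψe| ≤ utd q.ud q.v * |q.ψe| := by
    rw [abs_mul, abs_mul, abs_of_nonneg hW]
    exact mul_le_mul (mul_le_of_le_one_right hW (Real.abs_cos_le_one _)) hsin (abs_nonneg _) hW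
  rw [G1]
  exact (abs_add_three _ _ _).trans (by linarith)

/-- The path-following errors decay: the rotation of the path frame does not contribute to the rate
of `x_{b/p}² + y_{b/p}²`, and the guidance law makes both components dissipative. -/
theorem exists_position_decay (H : S.Standing u0 Bu Ymin Xmax κmax κ'max) (hη : 0 < η)
    (hc : 0 < c) (R : ℝ) :
    ∃ K rate : ℝ, 0 < K ∧ 0 < rate ∧
      ∀ (J : Set ℝ) (t₀ : ℝ) (z : ℝ → State), S.IsRegular η c R J t₀ z → ∀ t ∈ J,
        S.xbp (z t) ^ 2 + S.ybp (z t) ^ 2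
          ≤ K * S.errSq t₀ (z t₀) * Real.exp (-rate * (t - t₀)) := by
  obtain ⟨Bv, K, rate, hBv, hK, hrate, hdec⟩ := exists_heading_decay H hη hc R
  obtain ⟨η', B, hη', htube⟩ := exists_tube H η c R hη
  obtain ⟨Cσ, hCσ, hσb⟩ := (tame_σ (B := B) S hη').exists_abs_le
  have hkδ := S.kδ_pos
  have hμ := S.μ_pos
  have hu0 := H.u0_pos
  have hBu0 : 0 ≤ Bu := (abs_nonneg _).trans (H.urd_le 0 le_rfl)
  -- `c4` is the dissipation rate, where `√E = Δ σ` is compared with `√(1 + V)`; `C5` bounds the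
  -- forcing, `BV` bounds `V`, and `c5` is the linear dissipation rate that follows from `V ≤ BV`
  set c4 := min S.kδ (u0 / ((Cσ + 1) * √(1 + S.μ))) with hc4
  have hc40 : 0 < c4 := lt_min hkδ (by positivity)
  set C5 := (2 * (Bu + Bv) + 5) * √K with hC5
  have hC50 : 0 ≤ C5 := by positivity
  set BV := (1 + R ^ 2) * Real.exp (C5 * |R| / (rate / 2)) with hBV
  have hBV0 : 0 ≤ BV := by positivity
  set c5 := c4 / √(1 + BV) with hc5
  have hc50 : 0 < c5 := by positivity
  set s := min rate (c5 / 2) with hs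
  have hs0 : 0 < s := lt_min hrate (by positivity)
  have hsc : s < c5 := (min_le_right _ _).trans_lt (by linarith)
  have hsc' : 0 < c5 - s := sub_pos.2 hsc
  refine ⟨1 + C5 ^ 2 / c5 / (c5 - s), s, by positivity, hs0, ?_⟩
  intro J t₀ z hz
  have hE0 := S.errSq_nonneg t₀ (z t₀)
  have hER := hz.errSq_le
  set V : ℝ → ℝ := fun t => S.xbp (z t) ^ 2 + S.ybp (z t) ^ 2 with hV
  have hVnn : ∀ t, 0 ≤ V t := fun t => by positivity
  set F : ℝ → ℝ := fun t => C5 * √(S.errSq t₀ (z t₀)) * Real.exp (-(rate / 2) * (t - t₀)) with hF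
  have hFnn : ∀ t, 0 ≤ F t := fun t => by positivity
  have hmain : ∀ t ∈ J, ∃ d, HasDerivWithinAt V d J t ∧
      d ≤ 2 * (-c4 * (V t / √(1 + V t)) + √(V t) * F t) := by
    intro t ht
    have ht0 : 0 ≤ t := hz.t₀_nonneg.trans (hz.isLeast.2 ht)
    have hq := hz.guided H ht
    refine ⟨_, ((hz.sol.hasDeriv_xbp ht).fun_pow 2).fun_add
      ((hz.sol.hasDeriv_ybp ht hq).fun_pow 2), ?_⟩
    obtain ⟨hvt, hψr, hobs⟩ := hdec J t₀ z hz t ht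
    have hx : |S.xbp (z t)| ≤ √(V t) := Real.abs_le_sqrt (by
      rw [hV]; linarith only [sq_nonneg (S.ybp (z t))])
    have hy : |S.ybp (z t)| ≤ √(V t) := Real.abs_le_sqrt (by
      rw [hV]; linarith only [sq_nonneg (S.xbp (z t))])
    have hsq : √(K * S.errSq t₀ (z t₀) * Real.exp (-rate * (t - t₀)))
        = √K * √(S.errSq t₀ (z t₀)) * Real.exp (-(rate / 2) * (t - t₀)) := by
      have : Real.exp (-rate * (t - t₀)) = Real.exp (-(rate / 2) * (t - t₀)) ^ 2 := by
        rw [← Real.exp_nat_mul]; push_cast; ring_nf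
      rw [this, Real.sqrt_mul (by positivity), Real.sqrt_mul hK.le,
        Real.sqrt_sq (Real.exp_pos _).le]
    have hψ : |S.ψerr t (z t)| ≤ √K * √(S.errSq t₀ (z t₀)) * Real.exp (-(rate / 2) * (t - t₀)) := by
      rw [← hsq]
      exact Real.abs_le_sqrt (by linarith only [hψr, sq_nonneg (S.rerr t (z t))])
    have hO : √(S.obsSq t (z t))
        ≤ √K * √(S.errSq t₀ (z t₀)) * Real.exp (-(rate / 2) * (t - t₀)) := by
      rw [← hsq]; exact Real.sqrt_le_sqrt hobs
    have hue := (S.abs_le_sqrt_obsSq t (z t)).2.2.2.2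
    have hT := S.abs_VTerr_le t (z t)
    have hN := S.abs_VNerr_le t (z t)
    have hW : utd (S.args t (z t)).ud (S.args t (z t)).v ≤ Bu + Bv := by
      have h1 : (S.args t (z t)).ud ^ 2 ≤ Bu ^ 2 := sq_le_sq_of_abs_le (H.urd_le t ht0)
      have h2 : (S.args t (z t)).v ^ 2 ≤ Bv ^ 2 := sq_le_sq_of_abs_le hvt
      exact Real.sqrt_le_iff.2 ⟨by positivity, by nlinarith only [h1, h2, mul_nonneg hBu0 hBv]⟩
    have hW0 := hq.utd_pos
    have hG1 := S.abs_G1_le (S.args t (z t))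
    have hsum : |S.G1 (S.args t (z t))| + |S.VTerr (z t)| + |S.VNerr (z t)| ≤ F t := by
      have e1 : (S.args t (z t)).ψe = S.ψerr t (z t) := rfl
      have e2 : (S.args t (z t)).u - (S.args t (z t)).ud = (z t).u - S.urd t := rfl
      rw [e1, e2] at hG1
      have h1 := mul_le_mul hW hψ (abs_nonneg _) (by positivity)
      have e3 : F t = 2 * ((Bu + Bv) * (√K * √(S.errSq t₀ (z t₀))
          * Real.exp (-(rate / 2) * (t - t₀))))
          + 5 * (√K * √(S.errSq t₀ (z t₀)) * Real.exp (-(rate / 2) * (t - t₀))) := by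
        simp only [hF, hC5]; ring
      rw [e3]
      linarith only [hG1, hT, hN, hue, hO, h1]
    -- both dissipation terms dominate `c4` times the squared component over `√(1 + V)`
    have hV1 : 0 < √(1 + V t) := Real.sqrt_pos.2 (by linarith only [hVnn t])
    have hdx : c4 * (S.xbp (z t) ^ 2 / √(1 + V t))
        ≤ S.kδ * S.xbp (z t) ^ 2 / √(1 + S.xbp (z t) ^ 2) := by
      have h1 : √(1 + S.xbp (z t) ^ 2) ≤ √(1 + V t) := Real.sqrt_le_sqrt (by
        rw [hV]; linarith only [sq_nonneg (S.ybp (z t))])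
      have h2 : 0 < √(1 + S.xbp (z t) ^ 2) := Real.sqrt_pos.2 (by positivity)
      rw [mul_div_assoc]
      refine mul_le_mul (min_le_left _ _) ?_ (by positivity) hkδ.le
      exact div_le_div_of_nonneg_left (sq_nonneg _) h2 h1
    have hΔ : S.Δ (S.args t (z t)) ≤ √(1 + S.μ) * √(1 + V t) := by
      rw [← Real.sqrt_mul (by positivity)]
      refine Real.sqrt_le_sqrt ?_
      change S.μ + S.xbp (z t) ^ 2 + S.ybp (z t) ^ 2 ≤ _
      have := hVnn t
      simp only [hV] at this ⊢
      nlinarith only [mul_nonneg hμ.le this]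
    have hσ : S.σ (S.args t (z t)) ≤ Cσ + 1 := by
      have h1 := hσb _ (htube J t₀ z hz t ht).1
      exact ((le_abs_self _).trans h1).trans (by linarith only)
    have hσ0 := hq.σ_pos (S := S)
    have hΔ0 := S.Δ_pos (S.args t (z t))
    have hdy : c4 * (S.ybp (z t) ^ 2 / √(1 + V t))
        ≤ utd (S.args t (z t)).ud (S.args t (z t)).v * S.ybp (z t) ^ 2
          / √(S.den (S.args t (z t))) := by
      have h1 : u0 ≤ utd (S.args t (z t)).ud (S.args t (z t)).v := le_utd (H.urd_ge t ht0)
      have h2 : √(S.den (S.args t (z t))) ≤ (Cσ + 1) * √(1 + S.μ) * √(1 + V t) := by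
        rw [hq.sqrt_den]
        have := mul_le_mul hΔ hσ hσ0.le (by positivity)
        linarith only [this]
      have h3 : 0 < √(S.den (S.args t (z t))) := by rw [hq.sqrt_den]; positivity
      calc _ ≤ u0 / ((Cσ + 1) * √(1 + S.μ)) * (S.ybp (z t) ^ 2 / √(1 + V t)) :=
            mul_le_mul_of_nonneg_right (min_le_right _ _) (by positivity)
        _ = u0 * S.ybp (z t) ^ 2 / ((Cσ + 1) * √(1 + S.μ) * √(1 + V t)) := by
            rw [div_mul_div_comm]
        _ ≤ utd (S.args t (z t)).ud (S.args t (z t)).v * S.ybp (z t) ^ 2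
              / ((Cσ + 1) * √(1 + S.μ) * √(1 + V t)) := by gcongr
        _ ≤ _ := div_le_div_of_nonneg_left (by positivity) h3 h2
    -- the terms `± x_{b/p} y_{b/p} κ θ̇` of the rotating frame cancel
    have hsplit : S.xbp (z t) * (S.xKnown (S.args t (z t)) + S.VTerr (z t))
        + S.ybp (z t) * (S.yKnown (S.args t (z t)) + S.VNerr (z t))
        = -(S.kδ * S.xbp (z t) ^ 2 / √(1 + S.xbp (z t) ^ 2))
          - utd (S.args t (z t)).ud (S.args t (z t)).v * S.ybp (z t) ^ 2
            / √(S.den (S.args t (z t)))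
          + (S.ybp (z t) * S.G1 (S.args t (z t)) + S.xbp (z t) * S.VTerr (z t)
            + S.ybp (z t) * S.VNerr (z t)) := by
      have e1 : (S.args t (z t)).x = S.xbp (z t) := rfl
      have e2 : (S.args t (z t)).y = S.ybp (z t) := rfl
      rw [xKnown, yKnown, e1, e2]; ring
    have hpert : S.ybp (z t) * S.G1 (S.args t (z t)) + S.xbp (z t) * S.VTerr (z t)
        + S.ybp (z t) * S.VNerr (z t) ≤ √(V t) * F t := by
      have hb : ∀ a b : ℝ, |a| ≤ √(V t) → a * b ≤ √(V t) * |b| := fun a b hab =>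
        (le_abs_self _).trans (by
          rw [abs_mul]; exact mul_le_mul_of_nonneg_right hab (abs_nonneg _))
      have h1 := hb _ (S.G1 (S.args t (z t))) hy
      have h2 := hb _ (S.VTerr (z t)) hx
      have h3 := hb _ (S.VNerr (z t)) hy
      have h4 := mul_le_mul_of_nonneg_left hsum (Real.sqrt_nonneg (V t))
      linarith only [h1, h2, h3, h4]
    have hVe : V t / √(1 + V t) = S.xbp (z t) ^ 2 / √(1 + V t) + S.ybp (z t) ^ 2 / √(1 + V t) := by
      rw [← add_div]
    rw [hVe]
    push_cast
    simp only [pow_one]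
    linarith only [hsplit, hpert, hdx, hdy]
  have hF2 : ∀ t, F t ^ 2 = C5 ^ 2 * S.errSq t₀ (z t₀) * Real.exp (-rate * (t - t₀)) := fun t => by
    have : Real.exp (-rate * (t - t₀)) = Real.exp (-(rate / 2) * (t - t₀)) ^ 2 := by
      rw [← Real.exp_nat_mul]; push_cast; ring_nf
    simp only [hF, mul_pow]
    rw [Real.sq_sqrt hE0, this]
  -- the dissipation is discarded here: the forcing `2 √V F ≤ (1 + V) F` has an integrable coefficient
  have hVb : ∀ t ∈ J, V t ≤ BV := by
    intro t ht
    have h := le_of_deriv_le_integrable hz.ordConnected hz.isLeast (f := V) (fun t _ => hVnn t)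
      (rate := rate / 2) (K := C5 * |R|) (by positivity) (by positivity) (fun t ht => by
        obtain ⟨d, hd, hd'⟩ := hmain t ht
        refine ⟨d, hd, hd'.trans ?_⟩
        have h1 : 0 ≤ c4 * (V t / √(1 + V t)) := by have := hVnn t; positivity
        have h2 : 2 * √(V t) ≤ 1 + V t := by
          nlinarith only [Real.sq_sqrt (hVnn t), sq_nonneg (1 - √(V t))]
        have h3 := mul_le_mul_of_nonneg_right h2 (hFnn t)
        have h4 : F t ≤ C5 * |R| * Real.exp (-(rate / 2) * (t - t₀)) := by
          have h5 : √(S.errSq t₀ (z t₀)) ≤ |R| := by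
            rw [← Real.sqrt_sq_eq_abs]; exact Real.sqrt_le_sqrt hER
          simp only [hF]
          gcongr
        have h5 := mul_le_mul_of_nonneg_left h4 (by linarith only [hVnn t] : 0 ≤ 1 + V t)
        linarith only [h1, h3, h5]) t ht
    refine h.trans (mul_le_mul_of_nonneg_right ?_ (Real.exp_pos _).le)
    rw [errSq_eq] at hER
    have hVt : V t₀ = S.xbp (z t₀) ^ 2 + S.ybp (z t₀) ^ 2 := rfl
    linarith only [hER, hVt, S.obsSq_nonneg t₀ (z t₀), sq_nonneg (S.ψerr t₀ (z t₀)),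
            sq_nonneg (S.rerr t₀ (z t₀))]
  -- for bounded `V` the dissipation `c4 V / √(1 + V)` is at least `c5 V`
  intro t ht
  have h := le_exp_of_deriv_le hz.ordConnected hz.isLeast (f := V) (lam := c5) (rate := s)
    (K := C5 ^ 2 / c5 * S.errSq t₀ (z t₀)) hsc (by positivity) (hVnn t₀) (fun t ht => by
      obtain ⟨d, hd, hd'⟩ := hmain t ht
      refine ⟨d, hd, hd'.trans ?_⟩
      have h1 : c5 * V t ≤ c4 * (V t / √(1 + V t)) := by
        have h2 : √(1 + V t) ≤ √(1 + BV) := Real.sqrt_le_sqrt (by linarith only [hVb t ht])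
        have h3 : 0 < √(1 + V t) := Real.sqrt_pos.2 (by linarith only [hVnn t])
        have h4 := mul_le_mul_of_nonneg_left
          (div_le_div_of_nonneg_left (hVnn t) h3 h2) hc40.le
        refine le_trans (le_of_eq ?_) h4
        rw [hc5]; ring
      have h2 : 2 * (√(V t) * F t) ≤ c5 * V t + F t ^ 2 / c5 := by
        have e : c5 * √(V t) ^ 2 + F t ^ 2 / c5 - 2 * (√(V t) * F t)
            = (c5 * √(V t) - F t) ^ 2 / c5 := by field_simp; ring
        have e2 : 0 ≤ (c5 * √(V t) - F t) ^ 2 / c5 := by positivity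
        rw [Real.sq_sqrt (hVnn t)] at e
        linarith only [e, e2]
      have h3 : F t ^ 2 / c5 ≤ C5 ^ 2 / c5 * S.errSq t₀ (z t₀) * Real.exp (-s * (t - t₀)) := by
        rw [hF2]
        have h4 := mul_le_mul_of_nonneg_left (exp_rate_mono (min_le_left rate (c5 / 2))
          (hz.isLeast.2 ht)) (by positivity : 0 ≤ C5 ^ 2 / c5 * S.errSq t₀ (z t₀))
        refine le_trans (le_of_eq ?_) h4
        ring
      linarith only [h1, h2, h3]) t ht
  refine h.trans (mul_le_mul_of_nonneg_right ?_ (Real.exp_pos _).le)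
  have h0 : V t₀ ≤ S.errSq t₀ (z t₀) := by
    rw [errSq_eq]
    have hVt : V t₀ = S.xbp (z t₀) ^ 2 + S.ybp (z t₀) ^ 2 := rfl
    linarith only [hVt, S.obsSq_nonneg t₀ (z t₀), sq_nonneg (S.ψerr t₀ (z t₀)),
            sq_nonneg (S.rerr t₀ (z t₀))]
  have e : (1 + C5 ^ 2 / c5 / (c5 - s)) * S.errSq t₀ (z t₀)
      = S.errSq t₀ (z t₀) + C5 ^ 2 / c5 * S.errSq t₀ (z t₀) / (c5 - s) := by ring
  rw [e]
  linarith only [h0]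

/-- Uniform exponential decay of the error state along regular solutions. -/
theorem exists_errNorm_decay (H : S.Standing u0 Bu Ymin Xmax κmax κ'max) (hη : 0 < η)
    (hc : 0 < c) (R : ℝ) :
    ∃ k lam : ℝ, 0 < k ∧ 0 < lam ∧
      ∀ (J : Set ℝ) (t₀ : ℝ) (z : ℝ → State), S.IsRegular η c R J t₀ z → ∀ t ∈ J,
        S.errNorm t (z t) ≤ k * S.errNorm t₀ (z t₀) * Real.exp (-lam * (t - t₀)) := by
  obtain ⟨Bv, K1, r1, -, hK1, hr1, h1⟩ := exists_heading_decay H hη hc R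
  obtain ⟨K2, r2, hK2, hr2, h2⟩ := exists_position_decay H hη hc R
  refine ⟨√(2 * K1 + K2), min r1 r2 / 2, by positivity, by positivity, ?_⟩
  intro J t₀ z hz t ht
  obtain ⟨-, ha, hb⟩ := h1 J t₀ z hz t ht
  have hp := h2 J t₀ z hz t ht
  have hE0 := S.errSq_nonneg t₀ (z t₀)
  have e1 := mul_le_mul_of_nonneg_left (exp_rate_mono (min_le_left r1 r2) (hz.isLeast.2 ht))
    (mul_nonneg hK1.le hE0)
  have e2 := mul_le_mul_of_nonneg_left (exp_rate_mono (min_le_right r1 r2) (hz.isLeast.2 ht))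
    (mul_nonneg hK2.le hE0)
  have hsum : S.errSq t (z t)
      ≤ (2 * K1 + K2) * S.errSq t₀ (z t₀) * Real.exp (-min r1 r2 * (t - t₀)) := by
    rw [errSq_eq S t]
    linarith only [ha, hb, hp, e1, e2]
  have hexp : Real.exp (-min r1 r2 * (t - t₀)) = Real.exp (-(min r1 r2 / 2) * (t - t₀)) ^ 2 := by
    rw [← Real.exp_nat_mul]; push_cast; ring_nf
  have : S.errNorm t (z t) = √(S.errSq t (z t)) := rfl
  have h0 : S.errNorm t₀ (z t₀) = √(S.errSq t₀ (z t₀)) := rfl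
  rw [this, h0]
  refine (Real.sqrt_le_sqrt hsum).trans (le_of_eq ?_)
  rw [hexp, Real.sqrt_mul (by positivity), Real.sqrt_mul (by positivity),
    Real.sqrt_sq (Real.exp_pos _).le]

end Setup

/-! ### The closed loop as an ordinary differential equation for a vector -/

/-- The state as a vector. -/
def toVec (z : State) : Fin 11 → ℝ :=
  ![z.x, z.y, z.ψ, z.u, z.v, z.r, z.xh, z.yh, z.Vxh, z.Vyh, z.θ]

/-- The state given by a vector. -/
def ofVec (Z : Fin 11 → ℝ) : State :=
  ⟨Z 0, Z 1, Z 2, Z 3, Z 4, Z 5, Z 6, Z 7, Z 8, Z 9, Z 10⟩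

theorem toVec_ofVec (Z : Fin 11 → ℝ) : toVec (ofVec Z) = Z := by
  ext i; fin_cases i <;> rfl

/-- Since tubes have arbitrary bounds, smoothness on every tube is smoothness on `guidedSet`. -/
theorem exists_mem_tube {e : Fin 12 → ℝ} (he : e ∈ guidedSet) : ∃ η B, 0 < η ∧ e ∈ tube η B := by
  obtain ⟨h1, h2⟩ := he
  refine ⟨min (toArgs e).ud ((toArgs e).ud ^ 2 + (toArgs e).v ^ 2 - (toArgs e).VN ^ 2), ‖e‖,
    lt_min h1 (sub_pos.2 h2), ?_⟩
  have hn : ∀ i, |e i| ≤ ‖e‖ := fun i => norm_le_pi_norm e i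
  constructor
  · exact min_le_left _ _
  iterate 7 exact hn _
  · linarith [min_le_right (toArgs e).ud ((toArgs e).ud ^ 2 + (toArgs e).v ^ 2 - (toArgs e).VN ^ 2)]

namespace Setup
variable {S : Setup} {Kκ Kκ' : ℝ}

/-- The smoothness of the guidance quantities is read off their normalised forms. -/
theorem contDiffAt_toArgs_θdot {e : Fin 12 → ℝ} (he : e ∈ guidedSet) :
    ContDiffAt ℝ 2 (fun e => S.θdot (toArgs e)) e := by
  obtain ⟨η, B, hη, heB⟩ := exists_mem_tube he
  exact (((gradBdd_utd hη).contDiffAt heB).mul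
    ((tame_θdotN S hη).contDiffAt heB)).congr_of_eventuallyEq
    (eventuallyEq_of_mem (isOpen_guidedSet.mem_nhds he) fun e he => Guided.θdot_eq he)

theorem contDiffAt_toArgs_xKnown (hκ : ∀ θ, |S.κ θ| ≤ Kκ) (hκ' : ∀ θ, |deriv S.κ θ| ≤ Kκ')
    {e : Fin 12 → ℝ} (he : e ∈ guidedSet) : ContDiffAt ℝ 2 (fun e => S.xKnown (toArgs e)) e := by
  obtain ⟨η, B, hη, heB⟩ := exists_mem_tube he
  exact ((((gradBdd_utd hη).contDiffAt heB).mul (S.gradBdd_Δ.contDiffAt heB)).mul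
    ((tame_xKnownN hη hκ hκ').contDiffAt heB)).congr_of_eventuallyEq
    (eventuallyEq_of_mem (isOpen_guidedSet.mem_nhds he) fun e he => Guided.xKnown_eq he)

theorem contDiffAt_toArgs_yKnown (hκ : ∀ θ, |S.κ θ| ≤ Kκ) (hκ' : ∀ θ, |deriv S.κ θ| ≤ Kκ')
    {e : Fin 12 → ℝ} (he : e ∈ guidedSet) : ContDiffAt ℝ 2 (fun e => S.yKnown (toArgs e)) e := by
  obtain ⟨η, B, hη, heB⟩ := exists_mem_tube he
  exact ((((gradBdd_utd hη).contDiffAt heB).mul (S.gradBdd_Δ.contDiffAt heB)).mul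
    ((tame_yKnownN hη hκ hκ').contDiffAt heB)).congr_of_eventuallyEq
    (eventuallyEq_of_mem (isOpen_guidedSet.mem_nhds he) fun e he => Guided.yKnown_eq he)

theorem contDiffAt_toArgs_Cr {e : Fin 12 → ℝ} (he : e ∈ guidedSet) :
    ContDiffAt ℝ 2 (fun e => S.Cr (toArgs e)) e := by
  obtain ⟨η, B, hη, heB⟩ := exists_mem_tube he
  exact (tame_Cr S hη).contDiffAt heB

theorem contDiffAt_toArgs_losAngle {e : Fin 12 → ℝ} (he : e ∈ guidedSet) :
    ContDiffAt ℝ 2 (fun e => losAngle S.μ (toArgs e).ud (toArgs e).v (toArgs e).VN (toArgs e).x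
      (toArgs e).y) e := by
  obtain ⟨η, B, hη, heB⟩ := exists_mem_tube he
  exact (((tame_ζ S).add
    ((tame_ν hη).mul (tame_σ S hη))).contDiffAt heB).arctan.congr_of_eventuallyEq
    (eventuallyEq_of_mem (isOpen_guidedSet.mem_nhds he) fun e he => Guided.losAngle_eq he)

theorem contDiff_xp (S : Setup) : ContDiff ℝ 2 S.xp := by
  have h : deriv S.xp = fun θ => Real.cos (S.γ θ) := funext fun θ => (S.hasDerivAt_xp θ).deriv
  refine ContDiff.of_le (n := ∞) (contDiff_infty_iff_deriv.2
    ⟨fun θ => (S.hasDerivAt_xp θ).differentiableAt, ?_⟩) two_le_infty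
  rw [h]; exact Real.contDiff_cos.comp S.smooth

theorem contDiff_yp (S : Setup) : ContDiff ℝ 2 S.yp := by
  have h : deriv S.yp = fun θ => Real.sin (S.γ θ) := funext fun θ => (S.hasDerivAt_yp θ).deriv
  refine ContDiff.of_le (n := ∞) (contDiff_infty_iff_deriv.2
    ⟨fun θ => (S.hasDerivAt_yp θ).differentiableAt, ?_⟩) two_le_infty
  rw [h]; exact Real.contDiff_sin.comp S.smooth

/-- The arguments of `r_d` as a function of `(u_rd, u̇_rd, ü_rd)` and of the state. -/
def extArgs (S : Setup) (p : (Fin 3 → ℝ) × (Fin 11 → ℝ)) : Fin 12 → ℝ :=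
  ![(ofVec p.2).θ, (ofVec p.2).v, (ofVec p.2).u, p.1 0, p.1 1, S.VTh (ofVec p.2), S.VNh (ofVec p.2),
    S.ybp (ofVec p.2), S.xbp (ofVec p.2),
    (ofVec p.2).ψ - (S.γ (ofVec p.2).θ - Real.arctan ((ofVec p.2).v / p.1 0)
      - losAngle S.μ (p.1 0) (ofVec p.2).v (S.VNh (ofVec p.2)) (S.xbp (ofVec p.2))
        (S.ybp (ofVec p.2))),
    (ofVec p.2).x - (ofVec p.2).xh, (ofVec p.2).y - (ofVec p.2).yh]

/-- `(u_rd, u̇_rd, ü_rd)`. -/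
def refVec (S : Setup) (t : ℝ) : Fin 3 → ℝ := ![S.urd t, deriv S.urd t, deriv (deriv S.urd) t]

/-- The known rates of the arguments of `r_d` as a function of `(u_rd, u̇_rd, ü_rd)` and of the
state. -/
def extKnown (S : Setup) (p : (Fin 3 → ℝ) × (Fin 11 → ℝ)) : Fin 12 → ℝ :=
  ![S.θdot (toArgs (S.extArgs p)), S.vdot (ofVec p.2),
    p.1 1 - (S.d11 / S.m11 + S.ku) * (p.2 3 - p.1 0), p.1 1, p.1 2,
    S.VTdot (toArgs (S.extArgs p)), S.VNdot (toArgs (S.extArgs p)),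
    S.yKnown (toArgs (S.extArgs p)), S.xKnown (toArgs (S.extArgs p)),
    S.Cr (toArgs (S.extArgs p)) * (p.2 5 - S.rdVec (S.extArgs p)),
    -S.kx1 * (p.2 0 - p.2 6), -S.ky1 * (p.2 1 - p.2 7)]

/-- The vector field of the closed loop as a function of `(u_rd, u̇_rd, ü_rd)` and of the state. -/
def field (S : Setup) (p : (Fin 3 → ℝ) × (Fin 11 → ℝ)) : Fin 11 → ℝ :=
  ![p.2 3 * Real.cos (p.2 2) - p.2 4 * Real.sin (p.2 2) + S.Vx,
    p.2 3 * Real.sin (p.2 2) + p.2 4 * Real.cos (p.2 2) + S.Vy,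
    p.2 5,
    p.1 1 - (S.d11 / S.m11 + S.ku) * (p.2 3 - p.1 0),
    S.vdot (ofVec p.2),
    fderiv ℝ S.rdVec (S.extArgs p) (S.extKnown p) - S.k1 * (p.2 5 - S.rdVec (S.extArgs p))
      - S.k2 * S.Cr (toArgs (S.extArgs p)) * S.extArgs p 9,
    p.2 3 * Real.cos (p.2 2) - p.2 4 * Real.sin (p.2 2) + p.2 8 + S.kx1 * (p.2 0 - p.2 6),
    p.2 3 * Real.sin (p.2 2) + p.2 4 * Real.cos (p.2 2) + p.2 9 + S.ky1 * (p.2 1 - p.2 7),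
    S.kx2 * (p.2 0 - p.2 6), S.ky2 * (p.2 1 - p.2 7),
    S.θdot (toArgs (S.extArgs p))]

theorem extArgs_refVec (S : Setup) (t : ℝ) (z : State) :
    S.extArgs (S.refVec t, toVec z) = S.argsVec t z := rfl

theorem extKnown_refVec (S : Setup) (t : ℝ) (z : State) :
    S.extKnown (S.refVec t, toVec z) = S.knownVec t z := by
  have h : S.udot t z = deriv S.urd t - (S.d11 / S.m11 + S.ku) * (z.u - S.urd t) := by
    rw [udot, τu]; ring
  rw [knownVec, h]
  rfl

/-- The points at which both control laws are defined. -/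
def regularSet (S : Setup) : Set ((Fin 3 → ℝ) × (Fin 11 → ℝ)) :=
  {p | S.extArgs p ∈ guidedSet ∧ 0 < S.Cr (toArgs (S.extArgs p))}

theorem Dom.mem_regularSet {t : ℝ} {z : State} (h : S.Dom t z) (hud : 0 < S.urd t) :
    (S.refVec t, toVec z) ∈ S.regularSet :=
  ⟨h.guided hud, h.2⟩

theorem dom_of_mem_regularSet {t : ℝ} {z : State} (h : (S.refVec t, toVec z) ∈ S.regularSet) :
    S.Dom t z :=
  ⟨by rw [utd_sq]; exact h.1.2, h.2⟩

theorem contDiff_state (S : Setup) :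
    ContDiff ℝ 2 (fun p : (Fin 3 → ℝ) × (Fin 11 → ℝ) => S.VTh (ofVec p.2)) ∧
    ContDiff ℝ 2 (fun p : (Fin 3 → ℝ) × (Fin 11 → ℝ) => S.VNh (ofVec p.2)) ∧
    ContDiff ℝ 2 (fun p : (Fin 3 → ℝ) × (Fin 11 → ℝ) => S.ybp (ofVec p.2)) ∧
    ContDiff ℝ 2 (fun p : (Fin 3 → ℝ) × (Fin 11 → ℝ) => S.xbp (ofVec p.2)) := by
  have hγ := S.smooth.of_le two_le_infty
  have hx := S.contDiff_xp
  have hy := S.contDiff_yp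
  simp only [VTh, VNh, ybp, xbp, ofVec]
  refine ⟨?_, ?_, ?_, ?_⟩ <;> fun_prop

/-- The arguments of `r_d` other than `ψ̃`, which is replaced by `0`. The guidance law depends on
these only. -/
def guidanceArgs (S : Setup) (p : (Fin 3 → ℝ) × (Fin 11 → ℝ)) : Fin 12 → ℝ :=
  ![p.2 10, p.2 4, p.2 3, p.1 0, p.1 1, S.VTh (ofVec p.2), S.VNh (ofVec p.2), S.ybp (ofVec p.2),
    S.xbp (ofVec p.2), 0, p.2 0 - p.2 6, p.2 1 - p.2 7]

theorem contDiff_guidanceArgs (S : Setup) : ContDiff ℝ 2 S.guidanceArgs := by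
  obtain ⟨h1, h2, h3, h4⟩ := S.contDiff_state
  have hc1 : ∀ i, ContDiff ℝ 2 (fun p : (Fin 3 → ℝ) × (Fin 11 → ℝ) => p.1 i) := by
    intro i; fun_prop
  have hc2 : ∀ i, ContDiff ℝ 2 (fun p : (Fin 3 → ℝ) × (Fin 11 → ℝ) => p.2 i) := by
    intro i; fun_prop
  rw [contDiff_pi]
  intro i
  fin_cases i
  · exact hc2 10
  · exact hc2 4
  · exact hc2 3
  · exact hc1 0
  · exact hc1 1
  · exact h1
  · exact h2
  · exact h3
  · exact h4
  · exact contDiff_const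
  · exact (hc2 0).sub (hc2 6)
  · exact (hc2 1).sub (hc2 7)

theorem extArgs_nine (S : Setup) (p : (Fin 3 → ℝ) × (Fin 11 → ℝ)) :
    S.extArgs p 9 = p.2 2 - S.γ (p.2 10) + Real.arctan (p.2 4 / p.1 0)
      + losAngle S.μ (toArgs (S.guidanceArgs p)).ud (toArgs (S.guidanceArgs p)).v
        (toArgs (S.guidanceArgs p)).VN (toArgs (S.guidanceArgs p)).x
        (toArgs (S.guidanceArgs p)).y :=
  have h : ∀ a b c d : ℝ, a - (b - c - d) = a - b + c + d := by intros; ring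
  h _ _ _ _

theorem extArgs_of_ne (S : Setup) {i : Fin 12} (hi : i ≠ 9) :
    (fun p => S.extArgs p i) = fun p => S.guidanceArgs p i := by
  funext p
  fin_cases i <;> first | exact absurd rfl hi | simp [extArgs, guidanceArgs, ofVec]

theorem guidanceArgs_mem {p : (Fin 3 → ℝ) × (Fin 11 → ℝ)} (hp : S.extArgs p ∈ guidedSet) :
    S.guidanceArgs p ∈ guidedSet := by
  have h1 : 0 < p.1 0 := hp.1
  have h2 : S.VNh (ofVec p.2) ^ 2 < p.1 0 ^ 2 + p.2 4 ^ 2 := hp.2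
  exact ⟨h1, h2⟩

theorem contDiffAt_extArgs {p : (Fin 3 → ℝ) × (Fin 11 → ℝ)} (hp : S.extArgs p ∈ guidedSet) :
    ContDiffAt ℝ 2 S.extArgs p := by
  have hγ := S.smooth.of_le two_le_infty
  have hud : p.1 0 ≠ 0 := hp.1.ne'
  have hfc := S.contDiff_guidanceArgs
  have hlos := (contDiffAt_toArgs_losAngle (S := S) (guidanceArgs_mem hp)).comp p
    hfc.contDiffAt
  have hcrab : ContDiffAt ℝ 2 (fun p : (Fin 3 → ℝ) × (Fin 11 → ℝ) =>
      Real.arctan (p.2 4 / p.1 0)) p := by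
    refine ContDiffAt.arctan (ContDiffAt.div ?_ ?_ hud) <;> fun_prop
  have h2 : ContDiffAt ℝ 2 (fun p : (Fin 3 → ℝ) × (Fin 11 → ℝ) => p.2 2 - S.γ (p.2 10)) p := by
    fun_prop
  rw [contDiffAt_pi]
  intro i
  by_cases hi : i = 9
  · subst hi
    exact ((h2.add hcrab).add hlos).congr_of_eventuallyEq
      (Eventually.of_forall fun p => S.extArgs_nine p)
  · rw [S.extArgs_of_ne hi]
    exact (contDiff_pi.1 hfc i).contDiffAt

theorem isOpen_regularSet (S : Setup) : IsOpen S.regularSet := by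
  rw [isOpen_iff_mem_nhds]
  intro p hp
  have h1 := (contDiffAt_extArgs hp.1).continuousAt
  have h2 := ContinuousAt.comp (x := p) (contDiffAt_toArgs_Cr (S := S) hp.1).continuousAt h1
  filter_upwards [h1.preimage_mem_nhds (isOpen_guidedSet.mem_nhds hp.1),
    h2.eventually (lt_mem_nhds hp.2)] with q hq1 hq2
  exact ⟨hq1, hq2⟩

theorem contDiffAt_rdVec_of_mem (hκ : ∀ θ, |S.κ θ| ≤ Kκ) (hκ' : ∀ θ, |deriv S.κ θ| ≤ Kκ')
    {e : Fin 12 → ℝ} (he : e ∈ guidedSet) (hCr : 0 < S.Cr (toArgs e)) :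
    ContDiffAt ℝ 2 S.rdVec e := by
  obtain ⟨η, B, hη, heB⟩ := exists_mem_tube he
  obtain ⟨C, -, hC⟩ := rd_bound (B := B) hη hκ hκ' hCr
  exact (hC e ⟨heB, le_refl (S.Cr (toArgs e))⟩).1

theorem contDiffAt_field (hκ : ∀ θ, |S.κ θ| ≤ Kκ) (hκ' : ∀ θ, |deriv S.κ θ| ≤ Kκ')
    {p : (Fin 3 → ℝ) × (Fin 11 → ℝ)} (hp : p ∈ S.regularSet) : ContDiffAt ℝ 1 S.field p := by
  have hle : (1 : WithTop ℕ∞) ≤ 2 := one_le_two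
  have he := contDiffAt_extArgs hp.1
  have hrd := contDiffAt_rdVec_of_mem hκ hκ' hp.1 hp.2
  have hθ : ContDiffAt ℝ 1 (fun p => S.θdot (toArgs (S.extArgs p))) p :=
    ((contDiffAt_toArgs_θdot hp.1).comp p he).of_le hle
  have hx : ContDiffAt ℝ 1 (fun p => S.xKnown (toArgs (S.extArgs p))) p :=
    ((contDiffAt_toArgs_xKnown hκ hκ' hp.1).comp p he).of_le hle
  have hy : ContDiffAt ℝ 1 (fun p => S.yKnown (toArgs (S.extArgs p))) p :=
    ((contDiffAt_toArgs_yKnown hκ hκ' hp.1).comp p he).of_le hle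
  have hCr : ContDiffAt ℝ 1 (fun p => S.Cr (toArgs (S.extArgs p))) p :=
    ((contDiffAt_toArgs_Cr hp.1).comp p he).of_le hle
  have hr : ContDiffAt ℝ 1 (fun p => S.rdVec (S.extArgs p)) p := (hrd.comp p he).of_le hle
  have hfd : ContDiffAt ℝ 1 (fun p => fderiv ℝ S.rdVec (S.extArgs p)) p :=
    ContDiffAt.comp (g := fderiv ℝ S.rdVec) p (hrd.fderiv_right (by norm_num)) (he.of_le hle)
  have hei : ∀ i, ContDiffAt ℝ 1 (fun p => S.extArgs p i) p := fun i =>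
    (contDiffAt_pi.1 (he.of_le hle)) i
  have hγ : ContDiff ℝ 1 S.γ := S.smooth.of_le (hle.trans two_le_infty)
  have hκc : ContDiff ℝ 1 S.κ := S.contDiff_κ.of_le (hle.trans two_le_infty)
  have hv : ContDiffAt ℝ 1 (fun p : (Fin 3 → ℝ) × (Fin 11 → ℝ) => S.vdot (ofVec p.2)) p := by
    simp only [vdot, Vessel.X, Vessel.Y, ofVec]; fun_prop
  have hVT : ContDiffAt ℝ 1 (fun p => S.VTdot (toArgs (S.extArgs p))) p := by
    have h0 := hei 0
    have h6 := hei 6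
    have h10 := hei 10
    have h11 := hei 11
    have c := (Real.contDiff_cos.comp hγ).contDiffAt.comp p h0
    have s := (Real.contDiff_sin.comp hγ).contDiffAt.comp p h0
    have k := hκc.contDiffAt.comp p h0
    exact (((contDiffAt_const.mul h10).mul c).add ((contDiffAt_const.mul h11).mul s)).add
      ((k.mul hθ).mul h6)
  have hVN : ContDiffAt ℝ 1 (fun p => S.VNdot (toArgs (S.extArgs p))) p := by
    have h0 := hei 0
    have h5 := hei 5
    have h10 := hei 10
    have h11 := hei 11
    have c := (Real.contDiff_cos.comp hγ).contDiffAt.comp p h0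
    have s := (Real.contDiff_sin.comp hγ).contDiffAt.comp p h0
    have k := hκc.contDiffAt.comp p h0
    exact (((contDiffAt_const.mul h11).mul c).sub ((contDiffAt_const.mul h10).mul s)).sub
      ((k.mul hθ).mul h5)
  have hkn : ContDiffAt ℝ 1 S.extKnown p := by
    rw [contDiffAt_pi]
    intro i
    fin_cases i <;> simp only [extKnown]
    · exact hθ
    · exact hv
    · simp; fun_prop
    · simp; fun_prop
    · simp; fun_prop
    · exact hVT
    · exact hVN
    · exact hy
    · exact hx
    · exact hCr.mul (ContDiffAt.sub (by fun_prop) hr)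
    · simp; fun_prop
    · simp; fun_prop
  rw [contDiffAt_pi]
  intro i
  fin_cases i <;> simp only [field]
  · simp; fun_prop
  · simp; fun_prop
  · simp; fun_prop
  · simp; fun_prop
  · exact hv
  · exact ((hfd.clm_apply hkn).sub (contDiffAt_const.mul (ContDiffAt.sub (by fun_prop) hr))).sub
      ((contDiffAt_const.mul hCr).mul (hei 9))
  · simp; fun_prop
  · simp; fun_prop
  · simp; fun_prop
  · simp; fun_prop
  · exact hθ

/-- The closed loop in vector form. -/
theorem isSolutionOn_iff (hκ : ∀ θ, |S.κ θ| ≤ Kκ) (hκ' : ∀ θ, |deriv S.κ θ| ≤ Kκ') {J : Set ℝ}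
    (hud : ∀ t ∈ J, 0 < S.urd t) (z : ℝ → State) :
    S.IsSolutionOn J z ↔ (∀ t ∈ J, S.Dom t (z t)) ∧
      ∀ t ∈ J, HasDerivWithinAt (fun s => toVec (z s)) (S.field (S.refVec t, toVec (z t))) J t := by
  have hu : ∀ t z, S.Fu z.v z.r - S.d11 / S.m11 * z.u + S.τu t z
      = deriv S.urd t - (S.d11 / S.m11 + S.ku) * (z.u - S.urd t) := by
    intro t z; rw [τu]; ring
  have hr : ∀ t z, S.Dom t z → 0 < S.urd t → S.Fr z.u z.v z.r + S.τr t z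
      = S.field (S.refVec t, toVec z) 5 := by
    intro t z h hud
    have hd : DifferentiableAt ℝ S.rdVec (S.argsVec t z) :=
      (contDiffAt_rdVec_of_mem hκ hκ' (h.mem_regularSet hud).1 h.2).differentiableAt (by norm_num)
    change _ = fderiv ℝ S.rdVec (S.extArgs (S.refVec t, toVec z))
      (S.extKnown (S.refVec t, toVec z)) - S.k1 * S.rerr t z - S.k2 * S.Cr (S.args t z) * S.ψerr t z
    rw [extKnown_refVec, extArgs_refVec, ← rdKnown_eq hd, τr]
    ring
  have hθ : ∀ t z, S.updateLaw z.u z.v (z.ψ - S.γ z.θ) (S.xbp z) (S.VTh z)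
      = S.field (S.refVec t, toVec z) 10 := fun t z => (S.θdot_args t z).symm
  constructor
  · intro h
    refine ⟨h.dom, fun t ht => ?_⟩
    rw [hasDerivWithinAt_pi]
    intro i
    fin_cases i
    · exact h.x t ht
    · exact h.y t ht
    · exact h.ψ t ht
    · exact (h.u t ht).congr_deriv (hu _ _)
    · exact h.v t ht
    · exact (h.r t ht).congr_deriv (hr _ _ (h.dom t ht) (hud t ht))
    · exact h.xh t ht
    · exact h.yh t ht
    · exact h.Vxh t ht
    · exact h.Vyh t ht
    · exact (h.θ t ht).congr_deriv (hθ _ _)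
  · rintro ⟨hd, h⟩
    have h' : ∀ i, ∀ t ∈ J, HasDerivWithinAt (fun s => toVec (z s) i)
        (S.field (S.refVec t, toVec (z t)) i) J t := fun i t ht => hasDerivWithinAt_pi.1 (h t ht) i
    exact ⟨hd, h' 0, h' 1, h' 2, fun t ht => (h' 3 t ht).congr_deriv (hu _ _).symm, h' 4,
      fun t ht => (h' 5 t ht).congr_deriv (hr _ _ (hd t ht) (hud t ht)).symm, h' 6, h' 7, h' 8,
      h' 9, fun t ht => (h' 10 t ht).congr_deriv (hθ _ _).symm⟩

end Setup

/-! ### Local existence and continuation -/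

/-- Local existence for `ẋ = F (w t, x)` with `F` continuously differentiable and `w` merely
continuous. -/
theorem exists_forward_solution {E W : Type*} [NormedAddCommGroup E] [NormedSpace ℝ E]
    [CompleteSpace E] [NormedAddCommGroup W] [NormedSpace ℝ W] {F : W × E → E} {w : ℝ → W}
    (hw : Continuous w) {T : ℝ} {x₀ : E} (hF : ContDiffAt ℝ 1 F (w T, x₀)) :
    ∃ ε > 0, ∃ α : ℝ → E, α T = x₀ ∧
      ∀ t ∈ Icc T (T + ε), HasDerivWithinAt α (F (w t, α t)) (Icc T (T + ε)) t := by
  obtain ⟨K, U, hU, hK⟩ := hF.exists_lipschitzOnWith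
  obtain ⟨a, ha, haU⟩ := Metric.nhds_basis_closedBall.mem_iff.1 hU
  rw [← closedBall_prod_same] at haU
  obtain ⟨δ, hδ, hwδ⟩ := Metric.nhds_basis_closedBall.mem_iff.1
    (hw.continuousAt.preimage_mem_nhds (Metric.closedBall_mem_nhds (w T) ha))
  have hmem0 : (w T, x₀) ∈ U := mem_of_mem_nhds hU
  set L : ℝ := ‖F (w T, x₀)‖ + K * a with hL
  have hL0 : 0 ≤ L := by positivity
  set ε := min δ (a / (L + 1)) with hε
  have hε0 : 0 < ε := lt_min hδ (by positivity)
  have hwt : ∀ t ∈ Icc T (T + ε), w t ∈ Metric.closedBall (w T) a := fun t ht => hwδ (by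
    rw [Metric.mem_closedBall, Real.dist_eq, abs_of_nonneg (sub_nonneg.2 ht.1)]
    linarith [ht.2, min_le_left δ (a / (L + 1))])
  have hPL : IsPicardLindelof (fun t x => F (w t, x)) (tmin := T) (tmax := T + ε)
      ⟨T, left_mem_Icc.2 (by linarith)⟩ x₀ ⟨a, ha.le⟩ 0 ⟨L, hL0⟩ K := by
    refine ⟨fun t ht => ?_, fun x hx => ?_, fun t ht x hx => ?_, ?_⟩
    · refine LipschitzOnWith.of_dist_le_mul fun x hx y hy => ?_
      have := hK.dist_le_mul (w t, x) (haU ⟨hwt t ht, hx⟩) (w t, y) (haU ⟨hwt t ht, hy⟩)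
      rwa [Prod.dist_eq, dist_self, max_eq_right dist_nonneg] at this
    · exact hK.continuousOn.comp (hw.prodMk continuous_const).continuousOn
        fun t ht => haU ⟨hwt t ht, hx⟩
    · have h1 := hK.dist_le_mul (w t, x) (haU ⟨hwt t ht, hx⟩) (w T, x₀) hmem0
      have h2 : dist (w t, x) (w T, x₀) ≤ a := max_le (hwt t ht) hx
      have h3 := mul_le_mul_of_nonneg_left h2 K.2
      rw [dist_eq_norm] at h1
      have h4 := norm_le_norm_add_norm_sub' (F (w t, x)) (F (w T, x₀))
      change ‖F (w t, x)‖ ≤ L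
      linarith [show (K : ℝ) * dist (w t, x) (w T, x₀) ≤ K * a from h3]
    · change L * max (T + ε - T) (T - T) ≤ a - 0
      rw [add_sub_cancel_left, sub_self, max_eq_left hε0.le, sub_zero]
      calc L * ε ≤ L * (a / (L + 1)) := mul_le_mul_of_nonneg_left (min_le_right _ _) hL0
        _ = a * (L / (L + 1)) := by ring
        _ ≤ a * 1 := mul_le_mul_of_nonneg_left
            ((div_le_one (by positivity)).2 (by linarith)) ha.le
        _ = a := mul_one a
  obtain ⟨α, hα0, hα⟩ := hPL.exists_eq_forall_mem_Icc_hasDerivWithinAt₀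
  exact ⟨ε, hε0, α, hα0, hα⟩

namespace Setup
variable {S : Setup} {Kκ Kκ' : ℝ}

theorem continuous_refVec (hsm : ContDiff ℝ 2 S.urd) : Continuous S.refVec := by
  have h1 : ContDiff ℝ 1 (deriv S.urd) := (contDiff_succ_iff_deriv (n := 1)).1 hsm |>.2.2
  have h2 : ContDiff ℝ 0 (deriv (deriv S.urd)) := (contDiff_succ_iff_deriv (n := 0)).1 h1 |>.2.2
  refine continuous_pi fun i => ?_
  fin_cases i
  · exact hsm.continuous
  · exact h1.continuous
  · exact h2.continuous

/-- A solution on a compact interval can be continued to the right. -/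
theorem IsSolutionOn.exists_extend_right (hκ : ∀ θ, |S.κ θ| ≤ Kκ) (hκ' : ∀ θ, |deriv S.κ θ| ≤ Kκ')
    (hsm : ContDiff ℝ 2 S.urd) (hud : ∀ t, 0 ≤ t → 0 < S.urd t) {t₀ T : ℝ} (ht₀ : 0 ≤ t₀)
    (hT : t₀ ≤ T) {z : ℝ → State} (hz : S.IsSolutionOn (Icc t₀ T) z) :
    ∃ T' > T, ∃ z' : ℝ → State, EqOn z' z (Icc t₀ T) ∧ S.IsSolutionOn (Icc t₀ T') z' := by
  have hw := continuous_refVec hsm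
  have hpT := (hz.dom T (right_mem_Icc.2 hT)).mem_regularSet (hud T (ht₀.trans hT))
  obtain ⟨ε, hε, α, hα0, hα⟩ := exists_forward_solution hw (contDiffAt_field hκ hκ' hpT)
  -- the solution stays in the open set in which the control laws are defined for some time
  have hcont : ContinuousWithinAt (fun t => (S.refVec t, α t)) (Icc T (T + ε)) T :=
    hw.continuousWithinAt.prodMk (hα T (left_mem_Icc.2 (by linarith))).continuousWithinAt
  have hreg := hcont.preimage_mem_nhdsWithin (S.isOpen_regularSet.mem_nhds (by
    rw [hα0]; exact hpT))
  rw [nhdsWithin_Icc_eq_nhdsGE (by linarith : T < T + ε)] at hreg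
  obtain ⟨T', hTT', hsub'⟩ := mem_nhdsGE_iff_exists_Icc_subset.1
    (inter_mem hreg (Icc_mem_nhdsGE (by linarith : T < T + ε)))
  have hsub := hsub'.trans inter_subset_left
  have hsub1 := hsub'.trans inter_subset_right
  refine ⟨T', hTT', fun t => if t ≤ T then z t else ofVec (α t), fun t ht => if_pos ht.2, ?_⟩
  set z' : ℝ → State := fun t => if t ≤ T then z t else ofVec (α t) with hz'
  have h1 : EqOn (fun t => toVec (z' t)) (fun t => toVec (z t)) (Icc t₀ T) := fun t ht => by
    simp only [hz', if_pos ht.2]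
  have h2 : EqOn (fun t => toVec (z' t)) α (Icc T T') := fun t ht => by
    rcases ht.1.eq_or_lt with rfl | h
    · simp only [hz', if_pos le_rfl]; exact hα0.symm
    · simp only [hz', if_neg (not_le.2 h)]; exact toVec_ofVec _
  have hz1 := ((isSolutionOn_iff hκ hκ' (fun t ht => hud t (ht₀.trans ht.1)) z).1 hz).2
  have d1 : ∀ t ∈ Icc t₀ T, HasDerivWithinAt (fun t => toVec (z' t))
      (S.field (S.refVec t, toVec (z' t))) (Icc t₀ T) t := fun t ht => by
    have e : toVec (z' t) = toVec (z t) := h1 ht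
    rw [e]; exact (hz1 t ht).congr h1 e
  have d2 : ∀ t ∈ Icc T T', HasDerivWithinAt (fun t => toVec (z' t))
      (S.field (S.refVec t, toVec (z' t))) (Icc T T') t := fun t ht => by
    have e : toVec (z' t) = α t := h2 ht
    rw [e]; exact ((hα t (hsub1 ht)).mono hsub1).congr h2 e
  refine (isSolutionOn_iff hκ hκ' (fun t ht => hud t (ht₀.trans ht.1)) z').2 ⟨?_, ?_⟩
  · intro t ht
    rcases le_total t T with h | h
    · have e : z' t = z t := if_pos h
      rw [e]; exact hz.dom t ⟨ht.1, h⟩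
    · have hm : (S.refVec t, α t) ∈ S.regularSet := hsub ⟨h, ht.2⟩
      have e : toVec (z' t) = α t := h2 ⟨h, ht.2⟩
      rw [← e] at hm
      exact dom_of_mem_regularSet hm
  · intro t ht
    rcases lt_trichotomy t T with h | rfl | h
    · refine (d1 t ⟨ht.1, h.le⟩).mono_of_mem_nhdsWithin ?_
      filter_upwards [self_mem_nhdsWithin, mem_nhdsWithin_of_mem_nhds (Iio_mem_nhds h)]
        with s hs hs'
      exact ⟨hs.1, le_of_lt hs'⟩
    · rw [← Icc_union_Icc_eq_Icc hT hTT'.le]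
      exact (d1 t (right_mem_Icc.2 hT)).union (d2 t (left_mem_Icc.2 hTT'.le))
    · refine (d2 t ⟨h.le, ht.2⟩).mono_of_mem_nhdsWithin ?_
      filter_upwards [self_mem_nhdsWithin, mem_nhdsWithin_of_mem_nhds (Ioi_mem_nhds h)]
        with s hs hs'
      exact ⟨le_of_lt hs', hs.2⟩

/-- A solution of bounded speed on a half-open interval extends to the end point, as soon as its
limit lies in the set in which the control laws are defined. -/
theorem IsSolutionOn.exists_extend_closure (hκ : ∀ θ, |S.κ θ| ≤ Kκ)
    (hκ' : ∀ θ, |deriv S.κ θ| ≤ Kκ') (hsm : ContDiff ℝ 2 S.urd) (hud : ∀ t, 0 ≤ t → 0 < S.urd t)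
    {t₀ T B : ℝ} (ht₀ : 0 ≤ t₀) (hT : t₀ < T) {z : ℝ → State} (hz : S.IsSolutionOn (Ico t₀ T) z)
    (hB : ∀ t ∈ Ico t₀ T, ‖S.field (S.refVec t, toVec (z t))‖ ≤ B)
    (hlim : ∀ Z, Tendsto (fun t => toVec (z t)) (𝓝[<] T) (𝓝 Z) → (S.refVec T, Z) ∈ S.regularSet) :
    ∃ z' : ℝ → State, EqOn z' z (Ico t₀ T) ∧ S.IsSolutionOn (Icc t₀ T) z' := by
  have hw := continuous_refVec hsm
  have hz1 := ((isSolutionOn_iff hκ hκ' (fun t ht => hud t (ht₀.trans ht.1)) z).1 hz).2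
  have hB0 : 0 ≤ B := (norm_nonneg _).trans (hB t₀ ⟨le_rfl, hT⟩)
  have hlip : LipschitzOnWith ⟨B, hB0⟩ (fun t => toVec (z t)) (Ico t₀ T) :=
    (convex_Ico t₀ T).lipschitzOnWith_of_nnnorm_hasDerivWithin_le hz1 hB
  obtain ⟨g, hg, hgz⟩ := hlip.extend_pi
  have hIco : Ico t₀ T ∈ 𝓝[<] T := Ico_mem_nhdsLT hT
  have hgT : Tendsto g (𝓝[<] T) (𝓝 (g T)) := hg.continuous.continuousAt.mono_left nhdsWithin_le_nhds
  have hreg : (S.refVec T, g T) ∈ S.regularSet :=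
    hlim _ (hgT.congr' (eventuallyEq_of_mem hIco hgz.symm))
  have hd : ∀ t ∈ Ico t₀ T, HasDerivWithinAt g (S.field (S.refVec t, g t)) (Icc t₀ T) t := by
    intro t ht
    have h := (hz1 t ht).congr hgz.symm (hgz ht).symm
    rw [show toVec (z t) = g t from hgz ht] at h
    refine h.mono_of_mem_nhdsWithin ?_
    filter_upwards [self_mem_nhdsWithin, mem_nhdsWithin_of_mem_nhds (Iio_mem_nhds ht.2)]
        with s hs hs'
    exact ⟨hs.1, hs'⟩
  have hda : ∀ t ∈ Ioo t₀ T, HasDerivAt g (S.field (S.refVec t, g t)) t := fun t ht =>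
    (hd t ⟨ht.1.le, ht.2⟩).hasDerivAt (Icc_mem_nhds ht.1 ht.2)
  have hdT : HasDerivWithinAt g (S.field (S.refVec T, g T)) (Icc t₀ T) T := by
    refine (hasDerivWithinAt_Iic_of_tendsto_deriv (s := Ioo t₀ T)
      (fun t ht => (hda t ht).differentiableAt.differentiableWithinAt)
      hg.continuous.continuousWithinAt (Ioo_mem_nhdsLT hT) ?_).mono Icc_subset_Iic_self
    have hc : Tendsto (fun t => S.field (S.refVec t, g t)) (𝓝[<] T)
        (𝓝 (S.field (S.refVec T, g T))) :=
      ((contDiffAt_field hκ hκ' hreg).continuousAt.comp (x := T)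
        (f := fun t => (S.refVec t, g t))
        (hw.prodMk hg.continuous).continuousAt).mono_left nhdsWithin_le_nhds
    exact hc.congr' (eventuallyEq_of_mem (Ioo_mem_nhdsLT hT) fun t ht => (hda t ht).deriv.symm)
  refine ⟨fun t => ofVec (g t), fun t ht => ?_, ?_⟩
  · change ofVec (g t) = z t
    rw [← hgz ht]; rfl
  refine (isSolutionOn_iff hκ hκ' (fun t ht => hud t (ht₀.trans ht.1)) _).2 ⟨?_, ?_⟩
  · intro t ht
    rcases ht.2.eq_or_lt with rfl | h
    · refine dom_of_mem_regularSet ?_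
      rw [toVec_ofVec]; exact hreg
    · have e : ofVec (g t) = z t := by rw [← hgz ⟨ht.1, h⟩]; rfl
      change S.Dom t (ofVec (g t))
      rw [e]; exact hz.dom t ⟨ht.1, h⟩
  · simp only [toVec_ofVec]
    intro t ht
    rcases ht.2.eq_or_lt with rfl | h
    · exact hdT
    · exact hd t ⟨ht.1, h⟩

end Setup

/-! ### Boundedness of the closed loop -/

theorem exists_bound_of_continuous {n : ℕ} {f : (Fin n → ℝ) → ℝ} (hf : Continuous f) (M : ℝ) :
    ∃ C, 0 ≤ C ∧ ∀ e : Fin n → ℝ, (∀ i, |e i| ≤ M) → |f e| ≤ C := by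
  obtain ⟨C, hC⟩ := (isCompact_closedBall (0 : Fin n → ℝ) (max M 0)).exists_bound_of_continuousOn
    hf.continuousOn
  refine ⟨max C 0, le_max_right _ _, fun e he => (hC e ?_).trans (le_max_left _ _)⟩
  rw [mem_closedBall_zero_iff, pi_norm_le_iff_of_nonneg (le_max_right _ _)]
  exact fun i => (he i).trans (le_max_left _ _)

namespace Setup
variable {S : Setup} {u0 Bu Ymin Xmax κmax κ'max η c R : ℝ}

/-- Bounds for the rates of the arguments of `r_d`. -/
theorem exists_rates_bound (H : S.Standing u0 Bu Ymin Xmax κmax κ'max) {η' : ℝ} (hη : 0 < η')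
    (B M : ℝ) :
    ∃ C, 0 ≤ C ∧ ∀ e ∈ tube η' B, (∀ i ≠ 0, |e i| ≤ M) →
      |S.θdot (toArgs e)| ≤ C ∧ |S.VTdot (toArgs e)| ≤ C ∧ |S.VNdot (toArgs e)| ≤ C ∧
      |S.yKnown (toArgs e)| ≤ C ∧ |S.xKnown (toArgs e)| ≤ C := by
  obtain ⟨C1, hC1, h1⟩ := (tame_θdotN (B := B) S hη).exists_abs_le
  obtain ⟨C2, hC2, h2⟩ := (tame_VNdotN (B := B) hη H.κ_le H.κ'_le).exists_abs_le
  obtain ⟨C3, hC3, h3⟩ := (tame_yKnownN (B := B) hη H.κ_le H.κ'_le).exists_abs_le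
  obtain ⟨C4, hC4, h4⟩ := (tame_xKnownN (B := B) hη H.κ_le H.κ'_le).exists_abs_le
  have hκ0 : 0 ≤ κmax := (abs_nonneg _).trans (H.κ_le 0)
  have hkx := S.kx2_pos
  have hky := S.ky2_pos
  have hμ := S.μ_pos
  set W := 2 * |M| with hW
  set D := √S.μ + 2 * |M| with hD
  have hW0 : 0 ≤ W := by positivity
  have hD0 : 0 ≤ D := by positivity
  refine ⟨W * C1 + (S.kx2 * |M| + S.ky2 * |M| + κmax * (W * C1) * |M|) + W * C2 + W * D * C3
    + W * D * C4, by positivity, fun e he hM => ?_⟩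
  have hM' : ∀ i, i ≠ 0 → |e i| ≤ |M| := fun i hi => (hM i hi).trans (le_abs_self M)
  have hq : Guided (toArgs e) := tube_subset_guidedSet hη he
  have hsqrt : ∀ m a b : ℝ, 0 ≤ m → √(m + a ^ 2 + b ^ 2) ≤ √m + |a| + |b| := fun m a b hm => by
    refine Real.sqrt_le_iff.2 ⟨by positivity, ?_⟩
    have h := Real.sq_sqrt hm
    have := Real.sqrt_nonneg m
    rw [← sq_abs a, ← sq_abs b]
    nlinarith [abs_nonneg a, abs_nonneg b, mul_nonneg this (abs_nonneg a),
      mul_nonneg this (abs_nonneg b), mul_nonneg (abs_nonneg a) (abs_nonneg b)]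
  have hu : |utd (toArgs e).ud (toArgs e).v| ≤ W := by
    have := hsqrt 0 (e 3) (e 1) le_rfl
    rw [zero_add, Real.sqrt_zero, zero_add] at this
    rw [abs_of_pos hq.utd_pos]
    exact this.trans (by rw [hW]; linarith [hM' 3 (by decide), hM' 1 (by decide)])
  have hΔ : |S.Δ (toArgs e)| ≤ D := by
    rw [abs_of_pos (S.Δ_pos _)]
    exact (hsqrt S.μ (e 8) (e 7) hμ.le).trans
      (by rw [hD]; linarith [hM' 8 (by decide), hM' 7 (by decide)])
  have bθ : |S.θdot (toArgs e)| ≤ W * C1 := by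
    rw [hq.θdot_eq, abs_mul]
    exact mul_le_mul hu (h1 e he) (abs_nonneg _) hW0
  have bT : |S.VTdot (toArgs e)| ≤ S.kx2 * |M| + S.ky2 * |M| + κmax * (W * C1) * |M| := by
    have e1 := abs_mul_cos_add_mul_sin_le (S.kx2 * e 10) (S.ky2 * e 11) (S.γ (e 0))
    rw [abs_mul, abs_mul, abs_of_pos hkx, abs_of_pos hky] at e1
    have e2 := mul_le_mul_of_nonneg_left (hM' 10 (by decide)) hkx.le
    have e3 := mul_le_mul_of_nonneg_left (hM' 11 (by decide)) hky.le
    have e4 : |S.κ (e 0) * S.θdot (toArgs e) * e 6| ≤ κmax * (W * C1) * |M| := by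
      rw [abs_mul, abs_mul]
      exact mul_le_mul (mul_le_mul (H.κ_le _) bθ (abs_nonneg _) hκ0) (hM' 6 (by decide))
        (abs_nonneg _) (by positivity)
    exact (abs_add_le _ _).trans (add_le_add (e1.trans (add_le_add e2 e3)) e4)
  have bN : |S.VNdot (toArgs e)| ≤ W * C2 := by
    rw [hq.VNdot_eq, abs_mul]
    exact mul_le_mul hu (h2 e he) (abs_nonneg _) hW0
  have bWD : |utd (toArgs e).ud (toArgs e).v * S.Δ (toArgs e)| ≤ W * D := by
    rw [abs_mul]; exact mul_le_mul hu hΔ (abs_nonneg _) hW0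
  have bby : |S.yKnown (toArgs e)| ≤ W * D * C3 := by
    rw [hq.yKnown_eq, abs_mul]
    exact mul_le_mul bWD (h3 e he) (abs_nonneg _) (by positivity)
  have bx : |S.xKnown (toArgs e)| ≤ W * D * C4 := by
    rw [hq.xKnown_eq, abs_mul]
    exact mul_le_mul bWD (h4 e he) (abs_nonneg _) (by positivity)
  have p1 : 0 ≤ W * C1 := by positivity
  have p2 : 0 ≤ S.kx2 * |M| + S.ky2 * |M| + κmax * (W * C1) * |M| := by positivity
  have p3 : 0 ≤ W * C2 := by positivity
  have p4 : 0 ≤ W * D * C3 := by positivity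
  have p5 : 0 ≤ W * D * C4 := by positivity
  refine ⟨?_, ?_, ?_, ?_, ?_⟩ <;> linarith

/-- The arguments of `r_d` other than the path variable, the yaw rate error and the speeds are
bounded along regular solutions. -/
theorem exists_args_bound (H : S.Standing u0 Bu Ymin Xmax κmax κ'max) (hη : 0 < η) (hc : 0 < c)
    (R : ℝ) :
    ∃ M, 0 ≤ M ∧ ∀ (J : Set ℝ) (t₀ : ℝ) (z : ℝ → State), S.IsRegular η c R J t₀ z → ∀ t ∈ J,
      (∀ i ≠ 0, |S.argsVec t (z t) i| ≤ M) ∧ |S.rerr t (z t)| ≤ M ∧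
      |deriv (deriv S.urd) t| ≤ M ∧ |(z t).Vxh| ≤ M ∧ |(z t).Vyh| ≤ M := by
  obtain ⟨Bv, K, rate, hBv, hK, hrate, hdec⟩ := exists_heading_decay H hη hc R
  obtain ⟨K', rate', hK', hrate', hpos⟩ := exists_position_decay H hη hc R
  obtain ⟨η', B, hη', htube⟩ := exists_tube H η c R hη
  have hBu0 : 0 ≤ Bu := (abs_nonneg _).trans (H.urd_le 0 le_rfl)
  set Q := √((K + K') * R ^ 2) with hQ
  have hQ0 : 0 ≤ Q := Real.sqrt_nonneg _
  refine ⟨Bv + |B| + Q + Bu + |S.Vx| + |S.Vy|, by positivity, ?_⟩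
  intro J t₀ z hz t ht
  have ht0 : 0 ≤ t := hz.t₀_nonneg.trans (hz.isLeast.2 ht)
  obtain ⟨hv, hψr, hobs⟩ := hdec J t₀ z hz t ht
  have hp := hpos J t₀ z hz t ht
  have he := (htube J t₀ z hz t ht).1
  have hER := hz.errSq_le
  have hexp : ∀ r L : ℝ, 0 < r → 0 < L → L ≤ K + K' →
      L * S.errSq t₀ (z t₀) * Real.exp (-r * (t - t₀)) ≤ (K + K') * R ^ 2 := by
    intro r L hr hL hLK
    have h1 : Real.exp (-r * (t - t₀)) ≤ 1 :=
      Real.exp_le_one_iff.2 (by nlinarith [hz.isLeast.2 ht])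
    have h2 := mul_le_mul hLK hER (S.errSq_nonneg _ _) (by positivity)
    have h3 := mul_le_mul h2 h1 (Real.exp_pos _).le (by positivity)
    rwa [mul_one] at h3
  have hb1 := hexp rate K hrate hK (by linarith)
  have hb2 := hexp rate' K' hrate' hK' (by linarith)
  have hsq : ∀ a : ℝ, a ^ 2 ≤ (K + K') * R ^ 2 → |a| ≤ Q := fun a ha => Real.abs_le_sqrt ha
  have hψ := hsq (S.ψerr t (z t)) (by nlinarith [sq_nonneg (S.rerr t (z t))])
  have hr := hsq (S.rerr t (z t)) (by nlinarith [sq_nonneg (S.ψerr t (z t))])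
  have hx := hsq (S.xbp (z t)) (by nlinarith [sq_nonneg (S.ybp (z t))])
  have hy := hsq (S.ybp (z t)) (by nlinarith [sq_nonneg (S.xbp (z t))])
  have hO : √(S.obsSq t (z t)) ≤ Q := Real.sqrt_le_sqrt (hobs.trans hb1)
  obtain ⟨-, -, h3, h4, -⟩ := S.abs_le_sqrt_obsSq t (z t)
  have hB := le_abs_self B
  have n1 := abs_nonneg S.Vx
  have n2 := abs_nonneg S.Vy
  have n3 := abs_nonneg B
  refine ⟨?_, by linarith, by linarith [H.deriv2_urd_le t ht0], ?_, ?_⟩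
  · intro i hi
    fin_cases i
    · exact absurd rfl hi
    · exact hv.trans (by linarith)
    · exact he.u_le.trans (by linarith)
    · exact he.ud_le.trans (by linarith)
    · exact he.dud_le.trans (by linarith)
    · exact he.VT_le.trans (by linarith)
    · exact he.VN_le.trans (by linarith)
    · exact hy.trans (by linarith)
    · exact hx.trans (by linarith)
    · exact hψ.trans (by linarith)
    · exact he.xe_le.trans (by linarith)
    · exact he.ye_le.trans (by linarith)
  · have := abs_sub_abs_le_abs_sub (z t).Vxh S.Vx
    rw [abs_sub_comm] at this; linarith
  · have := abs_sub_abs_le_abs_sub (z t).Vyh S.Vy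
    rw [abs_sub_comm] at this; linarith

theorem norm_field_le {t b : ℝ} {z : State} (hb : 0 ≤ b)
    (h0 : |z.u * Real.cos z.ψ - z.v * Real.sin z.ψ + S.Vx| ≤ b)
    (h1 : |z.u * Real.sin z.ψ + z.v * Real.cos z.ψ + S.Vy| ≤ b) (h2 : |z.r| ≤ b)
    (h3 : |deriv S.urd t - (S.d11 / S.m11 + S.ku) * (z.u - S.urd t)| ≤ b)
    (h4 : |S.vdot z| ≤ b)
    (h5 : |fderiv ℝ S.rdVec (S.argsVec t z) (S.extKnown (S.refVec t, toVec z))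
      - S.k1 * S.rerr t z - S.k2 * S.Cr (S.args t z) * S.ψerr t z| ≤ b)
    (h6 : |z.u * Real.cos z.ψ - z.v * Real.sin z.ψ + z.Vxh + S.kx1 * (z.x - z.xh)| ≤ b)
    (h7 : |z.u * Real.sin z.ψ + z.v * Real.cos z.ψ + z.Vyh + S.ky1 * (z.y - z.yh)| ≤ b)
    (h8 : |S.kx2 * (z.x - z.xh)| ≤ b) (h9 : |S.ky2 * (z.y - z.yh)| ≤ b)
    (h10 : |S.θdot (S.args t z)| ≤ b) : ‖S.field (S.refVec t, toVec z)‖ ≤ b := by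
  rw [pi_norm_le_iff_of_nonneg hb]
  intro i
  fin_cases i
  · exact h0
  · exact h1
  · exact h2
  · exact h3
  · exact h4
  · exact h5
  · exact h6
  · exact h7
  · exact h8
  · exact h9
  · exact h10

theorem norm_knownVec_le {t b : ℝ} {z : State} (hb : 0 ≤ b) (h0 : |S.θdot (S.args t z)| ≤ b)
    (h1 : |S.vdot z| ≤ b) (h2 : |S.udot t z| ≤ b) (h3 : |deriv S.urd t| ≤ b)
    (h4 : |deriv (deriv S.urd) t| ≤ b) (h5 : |S.VTdot (S.args t z)| ≤ b)
    (h6 : |S.VNdot (S.args t z)| ≤ b) (h7 : |S.yKnown (S.args t z)| ≤ b)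
    (h8 : |S.xKnown (S.args t z)| ≤ b) (h9 : |S.CrAt t z * S.rerr t z| ≤ b)
    (h10 : |S.kx1 * (z.x - z.xh)| ≤ b) (h11 : |S.ky1 * (z.y - z.yh)| ≤ b) :
    ‖S.knownVec t z‖ ≤ b := by
  rw [← abs_neg, ← neg_mul] at h10 h11
  rw [pi_norm_le_iff_of_nonneg hb]
  intro i
  fin_cases i
  · exact h0
  · exact h1
  · exact h2
  · exact h3
  · exact h4
  · exact h5
  · exact h6
  · exact h7
  · exact h8
  · exact h9
  · exact h10
  · exact h11

/-- The sway velocity, both controls and the speed of the state are bounded along regular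
solutions. -/
theorem exists_field_bound (H : S.Standing u0 Bu Ymin Xmax κmax κ'max) (hη : 0 < η) (hc : 0 < c)
    (R : ℝ) :
    ∃ B, ∀ (J : Set ℝ) (t₀ : ℝ) (z : ℝ → State), S.IsRegular η c R J t₀ z → ∀ t ∈ J,
      |(z t).v| ≤ B ∧ |S.τr t (z t)| ≤ B ∧ |S.τu t (z t)| ≤ B ∧
      ‖S.field (S.refVec t, toVec (z t))‖ ≤ B := by
  obtain ⟨M, hM, hargs⟩ := exists_args_bound H hη hc R
  obtain ⟨η', B, hη', htube⟩ := exists_tube H η c R hη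
  obtain ⟨Cd, hCd, hrd⟩ := rd_bound (B := B) hη' H.κ_le H.κ'_le hc
  obtain ⟨Cr, hCr0, hCr⟩ := (tame_Cr (B := B) S hη').exists_abs_le
  obtain ⟨A, hA, hrate⟩ := exists_rates_bound H hη' B M
  set N := M + Cd * (1 + M) with hN
  have hMN : M ≤ N := by
    have : 0 ≤ Cd * (1 + M) := by positivity
    linarith
  have hN0 : 0 ≤ N := hM.trans hMN
  -- the surge control and the vessel dynamics are continuous functions of bounded quantities
  obtain ⟨Cu, hCu, hτu⟩ := exists_bound_of_continuous (n := 5) (f := fun e =>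
    -S.Fu (e 0) (e 1) + e 2 + S.d11 / S.m11 * e 3 - S.ku * (e 4 - e 3))
    (by simp only [Vessel.Fu]; fun_prop) N
  obtain ⟨Cv, hCv, hvd⟩ := exists_bound_of_continuous (n := 3) (f := fun e =>
    S.X (e 0) * e 1 + S.Y (e 0) * e 2) (by simp only [Vessel.X, Vessel.Y]; fun_prop) N
  obtain ⟨Cf, hCf, hFr⟩ := exists_bound_of_continuous (n := 3) (f := fun e =>
    S.Fr (e 0) (e 1) (e 2)) (by simp only [Vessel.Fr]; fun_prop) N
  have hd : 0 ≤ S.d11 / S.m11 := div_nonneg S.d11_nonneg S.m11_pos.le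
  have hkx1 := S.kx1_pos
  have hkx2 := S.kx2_pos
  have hky1 := S.ky1_pos
  have hky2 := S.ky2_pos
  have hk1 := S.k1_pos
  have hk2 := S.k2_pos
  have hku := S.ku_pos
  set U := M + (S.d11 / S.m11 + S.ku) * (2 * M) with hU
  have hU0 : 0 ≤ U := by positivity
  -- bound for the known rates of the arguments of `r_d`
  set L := A + Cv + U + M + Cr * M + S.kx1 * M + S.ky1 * M with hL
  have hL0 : 0 ≤ L := by positivity
  set P := Cd * (1 + M) * L + S.k1 * M + S.k2 * Cr * M with hP
  have hP0 : 0 ≤ P := by positivity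
  refine ⟨N + Cu + Cf + P + Cv + U + A + 3 * M + |S.Vx| + |S.Vy| + S.kx1 * M + S.ky1 * M
    + S.kx2 * M + S.ky2 * M, ?_⟩
  intro J t₀ z hz t ht
  obtain ⟨ha, hr, hdd, hVx, hVy⟩ := hargs J t₀ z hz t ht
  have he := htube J t₀ z hz t ht
  obtain ⟨bθ, bT, bN, bby, bx⟩ := hrate _ he.1 ha
  obtain ⟨hrd1, hrd2, hrd3⟩ := hrd _ he
  have hv : |(z t).v| ≤ M := ha 1 (by decide)
  have hu : |(z t).u| ≤ M := ha 2 (by decide)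
  have hud : |S.urd t| ≤ M := ha 3 (by decide)
  have hdud : |deriv S.urd t| ≤ M := ha 4 (by decide)
  have hψ : |S.ψerr t (z t)| ≤ M := ha 9 (by decide)
  have hxe : |(z t).x - (z t).xh| ≤ M := ha 10 (by decide)
  have hye : |(z t).y - (z t).yh| ≤ M := ha 11 (by decide)
  have hCrt : |S.Cr (S.args t (z t))| ≤ Cr := hCr _ he.1
  have hvM : Cd * (1 + |(z t).v|) ≤ Cd * (1 + M) :=
    mul_le_mul_of_nonneg_left (by linarith) hCd
  have hrN : |(z t).r| ≤ N := by
    have e : (z t).r = S.rerr t (z t) + S.rd (S.args t (z t)) := by rw [rerr]; ring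
    rw [e]
    exact (abs_add_le _ _).trans (add_le_add hr
      ((show |S.rd (S.args t (z t))| ≤ _ from hrd2).trans hvM))
  have b3 := hτu ![(z t).v, (z t).r, deriv S.urd t, S.urd t, (z t).u] (by
    intro i
    fin_cases i
    · exact hv.trans hMN
    · exact hrN
    · exact hdud.trans hMN
    · exact hud.trans hMN
    · exact hu.trans hMN)
  have b4 := hvd ![(z t).u, (z t).r, (z t).v] (by
    intro i
    fin_cases i
    · exact hu.trans hMN
    · exact hrN
    · exact hv.trans hMN)
  have b5 := hFr ![(z t).u, (z t).v, (z t).r] (by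
    intro i
    fin_cases i
    · exact hu.trans hMN
    · exact hv.trans hMN
    · exact hrN)
  replace b3 : |S.τu t (z t)| ≤ Cu := b3
  replace b4 : |S.vdot (z t)| ≤ Cv := b4
  replace b5 : |S.Fr (z t).u (z t).v (z t).r| ≤ Cf := b5
  have b6 : |deriv S.urd t - (S.d11 / S.m11 + S.ku) * ((z t).u - S.urd t)| ≤ U := by
    refine (abs_sub _ _).trans (add_le_add hdud ?_)
    rw [abs_mul, abs_of_nonneg (by positivity)]
    exact mul_le_mul_of_nonneg_left ((abs_sub _ _).trans (by linarith)) (by positivity)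
  have hCrM := mul_le_mul hCrt hr (abs_nonneg _) hCr0
  have hmulM : ∀ k a : ℝ, 0 < k → |a| ≤ M → |k * a| ≤ k * M := fun k a hk ha => by
    rw [abs_mul, abs_of_pos hk]; exact mul_le_mul_of_nonneg_left ha hk.le
  have m1 := hmulM _ _ hkx1 hxe
  have m2 := hmulM _ _ hky1 hye
  have m3 := hmulM _ _ hkx2 hxe
  have m4 := hmulM _ _ hky2 hye
  have q1 : 0 ≤ S.kx1 * M := by positivity
  have q2 : 0 ≤ S.ky1 * M := by positivity
  have q3 : 0 ≤ S.kx2 * M := by positivity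
  have q4 : 0 ≤ S.ky2 * M := by positivity
  have q5 : 0 ≤ Cr * M := by positivity
  have hudot : S.udot t (z t) = deriv S.urd t - (S.d11 / S.m11 + S.ku) * ((z t).u - S.urd t) := by
    rw [udot, τu]; ring
  have hkn : ‖S.extKnown (S.refVec t, toVec (z t))‖ ≤ L := by
    rw [extKnown_refVec]
    refine norm_knownVec_le hL0 (bθ.trans ?_) (b4.trans ?_) (hudot ▸ b6.trans ?_) (hdud.trans ?_)
      (hdd.trans ?_) (bT.trans ?_) (bN.trans ?_) (bby.trans ?_) (bx.trans ?_)
      ((abs_mul _ _).le.trans (hCrM.trans ?_)) (m1.trans ?_) (m2.trans ?_) <;> linarith only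
        [hL, hA, hCv, hU0, hM, q1, q2, q5]
  have b7 : |fderiv ℝ S.rdVec (S.argsVec t (z t)) (S.extKnown (S.refVec t, toVec (z t)))
      - S.k1 * S.rerr t (z t) - S.k2 * S.Cr (S.args t (z t)) * S.ψerr t (z t)| ≤ P := by
    refine (abs_sub _ _).trans (add_le_add ((abs_sub _ _).trans (add_le_add ?_
      (hmulM _ _ hk1 hr))) ?_)
    · exact (ContinuousLinearMap.le_opNorm _ _).trans
        (mul_le_mul (hrd3.trans hvM) hkn (norm_nonneg _) (by positivity))
    · rw [abs_mul, abs_mul, abs_of_pos hk2]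
      exact mul_le_mul (mul_le_mul_of_nonneg_left hCrt hk2.le) hψ (abs_nonneg _) (by positivity)
  have hτr : S.τr t (z t) = (fderiv ℝ S.rdVec (S.argsVec t (z t))
      (S.extKnown (S.refVec t, toVec (z t))) - S.k1 * S.rerr t (z t)
      - S.k2 * S.Cr (S.args t (z t)) * S.ψerr t (z t)) - S.Fr (z t).u (z t).v (z t).r := by
    rw [τr, rdKnown_eq (hrd1.differentiableAt (by norm_num)), extKnown_refVec]
    ring
  have hcs := abs_mul_cos_add_mul_sin_le (z t).u (-(z t).v) (z t).ψ
  have hsc := abs_neg_mul_sin_add_mul_cos_le (-(z t).u) (z t).v (z t).ψ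
  rw [abs_neg] at hcs hsc
  rw [neg_neg] at hsc
  have hcs' : |(z t).u * Real.cos (z t).ψ - (z t).v * Real.sin (z t).ψ| ≤ 2 * M := by
    refine le_trans (le_of_eq ?_) (hcs.trans (by linarith))
    congr 1; ring
  have n1 := abs_nonneg S.Vx
  have n2 := abs_nonneg S.Vy
  refine ⟨by linarith, ?_, by linarith, ?_⟩
  · rw [hτr]
    exact (abs_sub _ _).trans (by linarith)
  refine norm_field_le ?_ ((abs_add_le _ _).trans ((add_le_add hcs' le_rfl).trans ?_))
    ((abs_add_le _ _).trans ((add_le_add hsc le_rfl).trans ?_)) (hrN.trans ?_) (b6.trans ?_)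
    (b4.trans ?_) (b7.trans ?_)
    ((abs_add_three _ _ _).trans ((add_le_add (add_le_add hcs' hVx) m1).trans ?_))
    ((abs_add_three _ _ _).trans ((add_le_add (add_le_add hsc hVy) m2).trans ?_))
    (m3.trans ?_) (m4.trans ?_) (bθ.trans ?_) <;> linarith only
      [hA, hCv, hU0, hM, hN0, q1, q2, q3, q4, q5, hP0, hCu, hCf, n1, n2, hv, hu]

end Setup

namespace Setup
variable {S : Setup} {u0 Bu Ymin Xmax κmax κ'max η c R : ℝ}

/-! ### Maximal solutions -/

/-- Being a solution is a local property. -/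
theorem isSolutionOn_of_local {J : Set ℝ} {z : ℝ → State}
    (h : ∀ t ∈ J, ∃ (I : Set ℝ) (z' : ℝ → State), t ∈ I ∧ I ∈ 𝓝[J] t ∧ EqOn z z' I ∧
      S.IsSolutionOn I z') : S.IsSolutionOn J z := by
  have key : ∀ {I : Set ℝ} {z' : ℝ → State} {t d : ℝ} (f : State → ℝ), t ∈ I → I ∈ 𝓝[J] t →
      EqOn z z' I → HasDerivWithinAt (fun s => f (z' s)) d I t →
      HasDerivWithinAt (fun s => f (z s)) d J t := by
    intro I z' t d f ht hI he hd
    refine (hd.mono_of_mem_nhdsWithin hI).congr_of_eventuallyEq ?_ (congrArg f (he ht))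
    filter_upwards [hI] with s hs
    exact congrArg f (he hs)
  constructor <;> intro t ht <;> obtain ⟨I, z', htI, hI, he, hs⟩ := h t ht <;> rw [he htI]
  · exact hs.dom t htI
  · exact key State.x htI hI he (hs.x t htI)
  · exact key State.y htI hI he (hs.y t htI)
  · exact key State.ψ htI hI he (hs.ψ t htI)
  · exact key State.u htI hI he (hs.u t htI)
  · exact key State.v htI hI he (hs.v t htI)
  · exact key State.r htI hI he (hs.r t htI)
  · exact key State.xh htI hI he (hs.xh t htI)
  · exact key State.yh htI hI he (hs.yh t htI)
  · exact key State.Vxh htI hI he (hs.Vxh t htI)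
  · exact key State.Vyh htI hI he (hs.Vyh t htI)
  · exact key State.θ htI hI he (hs.θ t htI)

theorem isSolutionOn_singleton {t₀ : ℝ} {ξ : State} (hξ : S.Dom t₀ ξ) :
    S.IsSolutionOn {t₀} fun _ => ξ := by
  have key : ∀ a d t : ℝ, HasDerivWithinAt (fun _ => a) d {t₀} t := fun a d t =>
    HasFDerivWithinAt.of_subsingleton subsingleton_singleton
  refine ⟨?_, ?_, ?_, ?_, ?_, ?_, ?_, ?_, ?_, ?_, ?_, ?_⟩ <;> rintro t rfl
  · exact hξ
  all_goals exact key _ _ _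

/-- Solutions on intervals with least element `t₀`, starting at `ξ`. -/
def PartialSolution (S : Setup) (t₀ : ℝ) (ξ : State) : Type :=
  {p : Set ℝ × (ℝ → State) //
    IsLeast p.1 t₀ ∧ p.1.OrdConnected ∧ S.IsSolutionOn p.1 p.2 ∧ p.2 t₀ = ξ}

/-- Zorn's lemma for partial solutions ordered by extension. -/
theorem exists_isMaximalSolution {t₀ : ℝ} {ξ : State} (hξ : S.Dom t₀ ξ) :
    ∃ (J : Set ℝ) (z : ℝ → State), S.IsMaximalSolution t₀ J z ∧ z t₀ = ξ := by
  classical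
  let r : S.PartialSolution t₀ ξ → S.PartialSolution t₀ ξ → Prop := fun p q =>
    p.1.1 ⊆ q.1.1 ∧ EqOn q.1.2 p.1.2 p.1.1
  have hne : Nonempty (S.PartialSolution t₀ ξ) :=
    ⟨⟨({t₀}, fun _ => ξ), isLeast_singleton, ordConnected_singleton, isSolutionOn_singleton hξ,
      rfl⟩⟩
  obtain ⟨m, hm⟩ := exists_maximal_of_nonempty_chains_bounded (r := r) (fun C hC hCne => by
    -- the union of a chain
    let J : Set ℝ := ⋃ p ∈ C, p.1.1
    let z : ℝ → State := fun t => if h : ∃ p ∈ C, t ∈ p.1.1 then h.choose.1.2 t else ξ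
    have hmemJ : ∀ {p}, p ∈ C → p.1.1 ⊆ J := fun hp t ht => mem_biUnion hp ht
    have hz : ∀ p ∈ C, EqOn z p.1.2 p.1.1 := by
      intro p hp t ht
      have h : ∃ p ∈ C, t ∈ p.1.1 := ⟨p, hp, ht⟩
      have e : z t = h.choose.1.2 t := dif_pos h
      rw [e]
      obtain ⟨hq, htq⟩ := h.choose_spec
      by_cases hpq : h.choose = p
      · rw [hpq]
      · rcases hC hq hp hpq with h' | h'
        · exact (h'.2 htq).symm
        · exact h'.2 ht
    have hleast : IsLeast J t₀ := by
      obtain ⟨p, hp⟩ := hCne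
      refine ⟨hmemJ hp p.2.1.1, fun t ht => ?_⟩
      obtain ⟨q, hq, htq⟩ := mem_iUnion₂.1 ht
      exact q.2.1.2 htq
    have hord : J.OrdConnected := ⟨fun s hs t ht u hu => by
      obtain ⟨q, hq, htq⟩ := mem_iUnion₂.1 ht
      exact hmemJ hq (q.2.2.1.out q.2.1.1 htq ⟨(hleast.2 hs).trans hu.1, hu.2⟩)⟩
    have hsol : S.IsSolutionOn J z := by
      refine isSolutionOn_of_local fun t ht => ?_
      -- some member of the chain is a neighbourhood of `t` within the union
      obtain ⟨q, hq, htq, hqn⟩ : ∃ q ∈ C, t ∈ q.1.1 ∧ q.1.1 ∈ 𝓝[J] t := by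
        by_cases h : ∃ s ∈ J, t < s
        · obtain ⟨s, hs, hts⟩ := h
          obtain ⟨q, hq, hsq⟩ := mem_iUnion₂.1 hs
          refine ⟨q, hq, q.2.2.1.out q.2.1.1 hsq ⟨hleast.2 ht, hts.le⟩, ?_⟩
          filter_upwards [self_mem_nhdsWithin, mem_nhdsWithin_of_mem_nhds (Iio_mem_nhds hts)]
            with w hw hw'
          exact q.2.2.1.out q.2.1.1 hsq ⟨hleast.2 hw, le_of_lt hw'⟩
        · obtain ⟨q, hq, htq⟩ := mem_iUnion₂.1 ht
          refine ⟨q, hq, htq, ?_⟩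
          filter_upwards [self_mem_nhdsWithin] with w hw
          exact q.2.2.1.out q.2.1.1 htq ⟨hleast.2 hw, not_lt.1 fun h' => h ⟨w, hw, h'⟩⟩
      exact ⟨q.1.1, q.1.2, htq, hqn, hz q hq, q.2.2.2.1⟩
    have hz0 : z t₀ = ξ := by
      obtain ⟨p, hp⟩ := hCne
      exact (hz p hp p.2.1.1).trans p.2.2.2.2
    exact ⟨⟨(J, z), hleast, hord, hsol, hz0⟩, fun p hp => ⟨hmemJ hp, hz p hp⟩⟩)
    (fun {a b c} hab hbc => ⟨hab.1.trans hbc.1, fun t ht => (hbc.2 (hab.1 ht)).trans (hab.2 ht)⟩)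
  refine ⟨m.1.1, m.1.2, ⟨m.2.1, m.2.2.1, m.2.2.2.1, ?_⟩, m.2.2.2.2⟩
  intro J' z' hl ho hsub heq hs
  exact ((hm ⟨(J', z'), hl, ho, hs, (heq m.2.1.1).trans m.2.2.2.2⟩ ⟨hsub, heq⟩).1).antisymm hsub

/-- Regular solutions that cannot be continued are complete. -/
theorem IsMaximalSolution.eq_Ici (H : S.Standing u0 Bu Ymin Xmax κmax κ'max) (hη : 0 < η)
    (hc : 0 < c) {t₀ : ℝ} {J : Set ℝ} {z : ℝ → State} (hmax : S.IsMaximalSolution t₀ J z)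
    (hz : S.IsRegular η c R J t₀ z) : J = Ici t₀ := by
  obtain ⟨hleast, hord, hsol, hext⟩ := hmax
  have ht₀ := hz.t₀_nonneg
  have hud : ∀ t, 0 ≤ t → 0 < S.urd t := fun t ht => H.u0_pos.trans_le (H.urd_ge t ht)
  by_cases hb : BddAbove J
  · exfalso
    set T := sSup J with hT
    have hle : ∀ t ∈ J, t ≤ T := fun t ht => le_csSup hb ht
    by_cases hTJ : T ∈ J
    · have hJ : J = Icc t₀ T := Subset.antisymm (fun t ht => ⟨hleast.2 ht, hle t ht⟩)
        (hord.out hleast.1 hTJ)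
      rw [hJ] at hsol
      obtain ⟨T', hTT', z', heq, hs⟩ :=
        hsol.exists_extend_right H.κ_le H.κ'_le H.smooth hud ht₀ (hleast.2 hTJ)
      have hT₀ : t₀ ≤ T' := (hleast.2 hTJ).trans hTT'.le
      have := hext (Icc t₀ T') z' (isLeast_Icc hT₀) ordConnected_Icc
        (hJ ▸ Icc_subset_Icc_right hTT'.le) (hJ ▸ heq) hs
      exact absurd (hle T' (this ▸ right_mem_Icc.2 hT₀)) (not_le.2 hTT')
    · have hlt : ∀ t ∈ J, t < T := fun t ht => (hle t ht).lt_of_ne fun h => hTJ (h ▸ ht)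
      have hJ : J = Ico t₀ T := by
        refine Subset.antisymm (fun t ht => ⟨hleast.2 ht, hlt t ht⟩) fun t ht => ?_
        obtain ⟨s, hs, hts⟩ := exists_lt_of_lt_csSup ⟨t₀, hleast.1⟩ ht.2
        exact hord.out hleast.1 hs ⟨ht.1, hts.le⟩
      have hT₀ : t₀ < T := hlt t₀ hleast.1
      obtain ⟨B, hB⟩ := exists_field_bound H hη hc R
      have hw := continuous_refVec H.smooth
      have hsol' := hsol
      rw [hJ] at hsol'
      obtain ⟨z', heq, hs⟩ := hsol'.exists_extend_closure H.κ_le H.κ'_le H.smooth hud ht₀ hT₀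
        (fun t ht => (hB J t₀ z hz t (hJ ▸ ht)).2.2.2) (fun Z hZ => by
          have hmem : ∀ᶠ t in 𝓝[<] T, t ∈ J :=
            hJ ▸ Ico_mem_nhdsLT hT₀
          have hZ' : Tendsto (fun t => (S.refVec t, toVec (z t))) (𝓝[<] T) (𝓝 (S.refVec T, Z)) :=
            (hw.continuousAt.mono_left nhdsWithin_le_nhds).prodMk_nhds hZ
          have hgap : η + S.VNh (ofVec Z) ^ 2 ≤ S.urd T ^ 2 := by
            have h1 : Tendsto (fun t => S.VNh (z t)) (𝓝[<] T) (𝓝 (S.VNh (ofVec Z))) :=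
              (S.contDiff_state.2.1.continuous.continuousAt (x := (S.refVec T, Z))).tendsto.comp hZ'
            have h2 : Tendsto S.urd (𝓝[<] T) (𝓝 (S.urd T)) :=
              H.smooth.continuous.continuousAt.mono_left nhdsWithin_le_nhds
            exact le_of_tendsto_of_tendsto ((h1.pow 2).const_add η) (h2.pow 2)
              (hmem.mono fun t ht => hz.gap t ht)
          have hg : S.extArgs (S.refVec T, Z) ∈ guidedSet := by
            have h1 : 0 < S.urd T := hud T (ht₀.trans hT₀.le)
            have h2 : S.VNh (ofVec Z) ^ 2 < S.urd T ^ 2 + (ofVec Z).v ^ 2 := by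
              linarith [sq_nonneg (ofVec Z).v]
            exact ⟨h1, h2⟩
          have hCr : c ≤ S.Cr (toArgs (S.extArgs (S.refVec T, Z))) := by
            have h1 := (ContinuousAt.comp (x := (S.refVec T, Z))
              (contDiffAt_toArgs_Cr (S := S) hg).continuousAt
              (contDiffAt_extArgs hg).continuousAt).tendsto.comp hZ'
            exact ge_of_tendsto h1 (hmem.mono fun t ht => hz.Cr_ge t ht)
          exact ⟨hg, hc.trans_le hCr⟩)
      have := hext (Icc t₀ T) z' (isLeast_Icc hT₀.le) ordConnected_Icc
        (hJ ▸ Ico_subset_Icc_self) (hJ ▸ heq) hs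
      exact hTJ (this ▸ right_mem_Icc.2 hT₀.le)
  · refine Subset.antisymm (fun t ht => hleast.2 ht) fun t ht => ?_
    obtain ⟨s, hs, hts⟩ := not_bddAbove_iff.1 hb t
    exact hord.out hleast.1 hs ⟨ht, hts.le⟩

/-! ### The observer along the closed loop -/

/-- A bound on the current and on its estimation error bounds `V̂_N`. -/
theorem VNh_sq_le {V D : ℝ} {z : State} (hV0 : 0 ≤ V) (hD0 : 0 ≤ D)
    (hV : S.Vx ^ 2 + S.Vy ^ 2 ≤ V ^ 2)
    (hD : (S.Vx - z.Vxh) ^ 2 + (S.Vy - z.Vyh) ^ 2 ≤ D ^ 2) : S.VNh z ^ 2 ≤ (V + D) ^ 2 := by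
  have h1 : S.VNh z ^ 2 ≤ z.Vxh ^ 2 + z.Vyh ^ 2 := by
    rw [VNh]
    have := Real.sin_sq_add_cos_sq (S.γ z.θ)
    nlinarith [sq_nonneg (z.Vxh * Real.cos (S.γ z.θ) + z.Vyh * Real.sin (S.γ z.θ))]
  have h2 : (S.Vx * (S.Vx - z.Vxh) + S.Vy * (S.Vy - z.Vyh)) ^ 2 ≤ (V * D) ^ 2 := by
    have h3 := mul_le_mul hV hD (by positivity) (by positivity)
    nlinarith [sq_nonneg (S.Vx * (S.Vy - z.Vyh) - S.Vy * (S.Vx - z.Vxh))]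
  have h3 := (abs_le.1 (abs_le_of_sq_le_sq h2 (by positivity))).1
  nlinarith

/-- The observer energy does not increase, so that the current estimation error stays below
`Vmax`. -/
theorem IsSolutionOn.current_error_le {Vmax t₀ : ℝ} {J : Set ℝ} {z : ℝ → State}
    (hz : S.IsSolutionOn J z) (hJ : J.OrdConnected) (ht₀ : IsLeast J t₀)
    (hobs : S.ObserverInit Vmax (z t₀)) : ∀ t ∈ J,
      (S.Vx - (z t).Vxh) ^ 2 + (S.Vy - (z t).Vyh) ^ 2 ≤ Vmax ^ 2 := by
  have hx2 := S.kx2_pos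
  have hy2 := S.ky2_pos
  have hx1 := S.kx1_pos
  have hy1 := S.ky1_pos
  intro t ht
  have hanti := antitoneOn_of_hasDerivWithinAt_nonpos hJ
    (f := fun t => ((z t).x - (z t).xh) ^ 2 + ((z t).y - (z t).yh) ^ 2
      + (1 / S.kx2) * (S.Vx - (z t).Vxh) ^ 2 + (1 / S.ky2) * (S.Vy - (z t).Vyh) ^ 2)
    (f' := fun t => -2 * S.kx1 * ((z t).x - (z t).xh) ^ 2 - 2 * S.ky1 * ((z t).y - (z t).yh) ^ 2)
    (fun t ht => by
      refine (((((hz.hasDeriv_xe ht).fun_pow 2).fun_add ((hz.hasDeriv_ye ht).fun_pow 2)).fun_add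
        (((hz.hasDeriv_Vxe ht).fun_pow 2).const_mul (1 / S.kx2))).fun_add
        (((hz.hasDeriv_Vye ht).fun_pow 2).const_mul (1 / S.ky2))).congr_deriv ?_
      push_cast
      field_simp
      ring)
    (fun t ht => by
      nlinarith [mul_nonneg hx1.le (sq_nonneg ((z t).x - (z t).xh)),
        mul_nonneg hy1.le (sq_nonneg ((z t).y - (z t).yh))]) ht₀.1 ht (ht₀.2 ht)
  have h := hanti.trans hobs
  set k := max S.kx2 S.ky2 with hk
  have hk0 : 0 < k := lt_max_of_lt_left hx2
  have e1 : 1 / k * (S.Vx - (z t).Vxh) ^ 2 ≤ 1 / S.kx2 * (S.Vx - (z t).Vxh) ^ 2 :=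
    mul_le_mul_of_nonneg_right (one_div_le_one_div_of_le hx2 (le_max_left _ _)) (sq_nonneg _)
  have e2 : 1 / k * (S.Vy - (z t).Vyh) ^ 2 ≤ 1 / S.ky2 * (S.Vy - (z t).Vyh) ^ 2 :=
    mul_le_mul_of_nonneg_right (one_div_le_one_div_of_le hy2 (le_max_right _ _)) (sq_nonneg _)
  have h' : ((S.Vx - (z t).Vxh) ^ 2 + (S.Vy - (z t).Vyh) ^ 2) / k ≤ Vmax ^ 2 / k := by
    have e3 : ((S.Vx - (z t).Vxh) ^ 2 + (S.Vy - (z t).Vyh) ^ 2) / k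
        = 1 / k * (S.Vx - (z t).Vxh) ^ 2 + 1 / k * (S.Vy - (z t).Vyh) ^ 2 := by ring
    rw [e3]
    linarith [sq_nonneg ((z t).x - (z t).xh), sq_nonneg ((z t).y - (z t).yh)]
  exact (div_le_div_iff_of_pos_right hk0).1 h'

theorem current_error_le_obsSq (S : Setup) (t : ℝ) (z : State) :
    (S.Vx - z.Vxh) ^ 2 + (S.Vy - z.Vyh) ^ 2 ≤ S.obsSq t z := by
  rw [obsSq]
  linarith [sq_nonneg (z.x - z.xh), sq_nonneg (z.y - z.yh), sq_nonneg (z.u - S.urd t)]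

/-- With an admissibly initialised observer, `V̂_N²` stays uniformly below `u_rd²`. -/
theorem IsSolutionOn.exists_gap {Vmax t₀ : ℝ} {J : Set ℝ} {z : ℝ → State}
    (hz : S.IsSolutionOn J z) (hJ : J.OrdConnected) (hleast : IsLeast J t₀) (ht₀ : 0 ≤ t₀)
    (hobs : S.ObserverInit Vmax (z t₀)) (hVmax : 0 < Vmax) (hV : S.Vx ^ 2 + S.Vy ^ 2 ≤ Vmax ^ 2)
    (hsm : ContDiff ℝ 2 S.urd) (hgt : ∀ t, 0 ≤ t → 2 * Vmax < S.urd t) :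
    ∃ η, 0 < η ∧ ∀ t ∈ J, η + S.VNh (z t) ^ 2 ≤ S.urd t ^ 2 := by
  obtain ⟨K, rate, hK, hrate, hdec⟩ := S.obsSq_decay hsm
  -- after the time `t₁` the estimation error of the current is at most `Vmax / 2`
  have hlim : Tendsto (fun t => K * S.obsSq t₀ (z t₀) * Real.exp (-rate * (t - t₀))) atTop
      (𝓝 0) := by
    have h1 : Tendsto (fun t : ℝ => -rate * (t - t₀)) atTop atBot :=
      (tendsto_atTop_add_const_right _ (-t₀) tendsto_id).const_mul_atTop_of_neg
        (neg_lt_zero.2 hrate)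
    simpa using (Real.tendsto_exp_atBot.comp h1).const_mul (K * S.obsSq t₀ (z t₀))
  obtain ⟨t₁, ht₁⟩ := eventually_atTop.1
    (hlim.eventually (ge_mem_nhds (by positivity : 0 < (Vmax / 2) ^ 2)))
  obtain ⟨η₁, hη₁, hcomp⟩ : ∃ η₁, 0 < η₁ ∧ ∀ t ∈ Icc t₀ t₁, η₁ ≤ S.urd t ^ 2 - (2 * Vmax) ^ 2 := by
    by_cases h : t₀ ≤ t₁
    · obtain ⟨s, hs, hmin⟩ := isCompact_Icc.exists_isMinOn (nonempty_Icc.2 h)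
        ((hsm.continuous.pow 2).sub continuous_const :
          Continuous fun t => S.urd t ^ 2 - (2 * Vmax) ^ 2).continuousOn
      refine ⟨_, ?_, fun t ht => hmin ht⟩
      exact sub_pos.2 (pow_lt_pow_left₀ (hgt s (ht₀.trans hs.1)) (by positivity) two_ne_zero)
    · exact ⟨1, one_pos, fun t ht => absurd (ht.1.trans ht.2) h⟩
  refine ⟨min η₁ (Vmax ^ 2), lt_min hη₁ (by positivity), fun t ht => ?_⟩
  rcases le_total t t₁ with h | h
  · have h1 := VNh_sq_le hVmax.le hVmax.le hV (hz.current_error_le hJ hleast hobs t ht)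
    have h2 := hcomp t ⟨hleast.2 ht, h⟩
    have h3 := min_le_left η₁ (Vmax ^ 2)
    rw [← two_mul] at h1
    linarith
  · have h1 := VNh_sq_le hVmax.le (by positivity : 0 ≤ Vmax / 2) hV
      ((S.current_error_le_obsSq t (z t)).trans
        ((hdec J t₀ z hJ hleast hz t ht).trans (ht₁ t h)))
    have h2 := hgt t (ht₀.trans (hleast.2 ht))
    have h3 := min_le_right η₁ (Vmax ^ 2)
    nlinarith

/-- For small initial errors `V̂_N²` stays uniformly below `u_rd²`. -/
theorem exists_small_isRegular {Vmax : ℝ} (hVmax : 0 < Vmax) (hV : S.Vx ^ 2 + S.Vy ^ 2 ≤ Vmax ^ 2)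
    (hsm : ContDiff ℝ 2 S.urd) (hgt : ∀ t, 0 ≤ t → 2 * Vmax < S.urd t) :
    ∃ ρ, 0 < ρ ∧ ∀ R t₀ : ℝ, 0 ≤ t₀ → ∀ z : ℝ → State, S.IsSolutionOn (Ici t₀) z →
      (∀ t, t₀ ≤ t → c ≤ S.CrAt t (z t)) → |(z t₀).v| ≤ R → S.errNorm t₀ (z t₀) < ρ →
      S.IsRegular (Vmax ^ 2) c (max R ρ) (Ici t₀) t₀ z := by
  obtain ⟨K, rate, hK, hrate, hdec⟩ := S.obsSq_decay hsm
  refine ⟨Vmax / (2 * (K + 1)), by positivity, ?_⟩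
  intro R t₀ ht₀ z hz hCr hv he
  refine ⟨ordConnected_Ici, isLeast_Ici, ht₀, hz, hCr, fun t ht => ?_,
    hv.trans (le_max_left _ _), he.le.trans (le_max_right _ _)⟩
  have h1 := hdec _ t₀ z ordConnected_Ici isLeast_Ici hz t ht
  have h2 : Real.exp (-rate * (t - t₀)) ≤ 1 :=
    Real.exp_le_one_iff.2 (by nlinarith [mem_Ici.1 ht])
  have h3 : S.obsSq t₀ (z t₀) ≤ (Vmax / (2 * (K + 1))) ^ 2 := by
    refine (S.obsSq_le_errSq _ _).trans ?_
    rw [← errNorm_sq]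
    exact pow_le_pow_left₀ (Real.sqrt_nonneg _) he.le 2
  have h4 : S.obsSq t (z t) ≤ (Vmax / 2) ^ 2 := by
    have h5 : K * S.obsSq t₀ (z t₀) * Real.exp (-rate * (t - t₀))
        ≤ K * (Vmax / (2 * (K + 1))) ^ 2 := by
      refine (mul_le_of_le_one_right (mul_nonneg hK.le (S.obsSq_nonneg _ _)) h2).trans ?_
      exact mul_le_mul_of_nonneg_left h3 hK.le
    have h6 : K * (Vmax / (2 * (K + 1))) ^ 2 = K / (K + 1) ^ 2 * (Vmax / 2) ^ 2 := by
      field_simp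
    have h7 : K / (K + 1) ^ 2 ≤ 1 := (div_le_one (by positivity)).2 (by nlinarith)
    calc _ ≤ _ := h1.trans h5
      _ ≤ _ := by rw [h6]; exact mul_le_of_le_one_left (sq_nonneg _) h7
  have h8 := VNh_sq_le hVmax.le (by positivity : 0 ≤ Vmax / 2) hV
    ((S.current_error_le_obsSq t (z t)).trans h4)
  have h9 := hgt t (ht₀.trans ht)
  nlinarith

end Setup

end

end VesselPF

theorem mainTheorem1 (S : Setup) (Vmax Ymin Xmax κmax c : ℝ)
    -- ocean current
    (hVmax : 0 < Vmax) (hV : √(S.Vx ^ 2 + S.Vy ^ 2) ≤ Vmax)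
    -- desired surge velocity
    (hurd : ContDiff ℝ 2 S.urd)
    (hurd_bdd : ∃ B, ∀ t, 0 ≤ t →
      |S.urd t| ≤ B ∧ |deriv S.urd t| ≤ B ∧ |deriv (deriv S.urd) t| ≤ B)
    (hurd_gt : ∀ t, 0 ≤ t → 2 * Vmax < S.urd t)
    -- sway damping and sway-yaw coupling on the operating range
    (hYmin : 0 < Ymin)
    (hY : ∀ t, 0 ≤ t → ∀ u ∈ Icc (-Vmax) (S.urd t), S.Y u ≤ -Ymin)
    (hX : IsLUB {s | ∃ t, 0 ≤ t ∧ ∃ u ∈ Icc (-Vmax) (S.urd t), s = |S.X u|} Xmax)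
    -- curvature and look-ahead constant
    (hκ : IsLUB (range fun θ => |S.κ θ|) κmax)
    (hκ' : ∃ B, ∀ θ, |deriv S.κ θ| ≤ B)
    (hcurv : 2 * Xmax * κmax < Ymin)
    (hμ : 8 * Xmax / (Ymin - 2 * Xmax * κmax) < S.μ)
    -- the lower bound for `C_r`
    (hc : 0 < c) :
    -- the closed loop has a maximal solution from every initial state where it is defined
    (∀ t₀, 0 ≤ t₀ → ∀ ξ : State, S.Dom t₀ ξ → S.ObserverInit Vmax ξ →
      ∃ (J : Set ℝ) (z : ℝ → State), S.IsMaximalSolution t₀ J z ∧ z t₀ = ξ) ∧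
    -- completeness, boundedness, path following and global attractivity
    (∀ t₀, 0 ≤ t₀ → ∀ (J : Set ℝ) (z : ℝ → State), S.IsMaximalSolution t₀ J z →
      S.ObserverInit Vmax (z t₀) → (∀ t ∈ J, c ≤ S.CrAt t (z t)) →
      J = Ici t₀ ∧
      (∃ B, ∀ t, t₀ ≤ t → |(z t).v| ≤ B ∧ |S.τr t (z t)| ≤ B ∧ |S.τu t (z t)| ≤ B) ∧
      Tendsto (fun t => (z t).x - S.xp (z t).θ) atTop (𝓝 0) ∧
      Tendsto (fun t => (z t).y - S.yp (z t).θ) atTop (𝓝 0) ∧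
      Tendsto (fun t => S.errNorm t (z t)) atTop (𝓝 0)) ∧
    -- stability of the origin of the error system
    (∀ R, 0 < R → ∀ ε, 0 < ε → ∃ δ, 0 < δ ∧
      ∀ t₀, 0 ≤ t₀ → ∀ z : ℝ → State, S.IsSolutionOn (Ici t₀) z →
        (∀ t, t₀ ≤ t → c ≤ S.CrAt t (z t)) → |(z t₀).v| ≤ R → S.errNorm t₀ (z t₀) < δ →
        ∀ t, t₀ ≤ t → S.errNorm t (z t) < ε) ∧
    -- local exponential stability of the origin of the error system
    (∀ R, 0 < R → ∃ ρ k lam, 0 < ρ ∧ 0 < k ∧ 0 < lam ∧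
      ∀ t₀, 0 ≤ t₀ → ∀ z : ℝ → State, S.IsSolutionOn (Ici t₀) z →
        (∀ t, t₀ ≤ t → c ≤ S.CrAt t (z t)) → |(z t₀).v| ≤ R → S.errNorm t₀ (z t₀) < ρ →
        ∀ t, t₀ ≤ t →
          S.errNorm t (z t) ≤ k * S.errNorm t₀ (z t₀) * Real.exp (-lam * (t - t₀))) := by
  have hV' : S.Vx ^ 2 + S.Vy ^ 2 ≤ Vmax ^ 2 := (Real.sqrt_le_left hVmax.le).1 hV
  obtain ⟨Bu, hBu⟩ := hurd_bdd
  obtain ⟨κ'max, hκ'max⟩ := hκ'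
  have hmem : ∀ t, 0 ≤ t → S.urd t ∈ Icc (-Vmax) (S.urd t) := fun t ht =>
    right_mem_Icc.2 (by linarith [hurd_gt t ht])
  have hXle : ∀ t, 0 ≤ t → |S.X (S.urd t)| ≤ Xmax := fun t ht =>
    hX.1 ⟨t, ht, S.urd t, hmem t ht, rfl⟩
  have hκle : ∀ θ, |S.κ θ| ≤ κmax := fun θ => hκ.1 ⟨θ, rfl⟩
  have hXκ : 0 ≤ Xmax * κmax :=
    mul_nonneg ((abs_nonneg _).trans (hXle 0 le_rfl)) ((abs_nonneg _).trans (hκle 0))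
  have H : S.Standing (2 * Vmax) Bu Ymin Xmax κmax κ'max :=
    ⟨hurd, by positivity, fun t ht => (hurd_gt t ht).le, fun t ht => (hBu t ht).1,
      fun t ht => (hBu t ht).2.1, fun t ht => (hBu t ht).2.2,
      fun t ht => hY t ht _ (hmem t ht), hXle, hκle, hκ'max, by linarith⟩
  obtain ⟨ρ, hρ, hreg⟩ := Setup.exists_small_isRegular (c := c) hVmax hV' hurd hurd_gt
  have hexp : ∀ R, 0 < R → ∃ ρ k lam, 0 < ρ ∧ 0 < k ∧ 0 < lam ∧
      ∀ t₀, 0 ≤ t₀ → ∀ z : ℝ → State, S.IsSolutionOn (Ici t₀) z →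
        (∀ t, t₀ ≤ t → c ≤ S.CrAt t (z t)) → |(z t₀).v| ≤ R → S.errNorm t₀ (z t₀) < ρ →
        ∀ t, t₀ ≤ t →
          S.errNorm t (z t) ≤ k * S.errNorm t₀ (z t₀) * Real.exp (-lam * (t - t₀)) := by
    intro R _
    obtain ⟨k, lam, hk, hlam, hdec⟩ :=
      Setup.exists_errNorm_decay H (by positivity : 0 < Vmax ^ 2) hc (max R ρ)
    exact ⟨ρ, k, lam, hρ, hk, hlam, fun t₀ ht₀ z hz hCr hv he t ht =>
      hdec _ t₀ z (hreg R t₀ ht₀ z hz hCr hv he) t ht⟩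
  refine ⟨fun t₀ _ ξ hξ _ => Setup.exists_isMaximalSolution hξ, ?_, ?_, hexp⟩
  · intro t₀ ht₀ J z hmax hobs hCr
    obtain ⟨η, hη, hgap⟩ := hmax.2.2.1.exists_gap hmax.2.1 hmax.1 ht₀ hobs hVmax hV' hurd hurd_gt
    have hz : S.IsRegular η c (max |(z t₀).v| (S.errNorm t₀ (z t₀))) J t₀ z :=
      ⟨hmax.2.1, hmax.1, ht₀, hmax.2.2.1, hCr, hgap, le_max_left _ _, le_max_right _ _⟩
    have hJ : J = Ici t₀ := hmax.eq_Ici H hη hc hz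
    obtain ⟨B, hB⟩ := Setup.exists_field_bound H hη hc _
    obtain ⟨k, lam, hk, hlam, hdec⟩ := Setup.exists_errNorm_decay H hη hc _
    have hE0 : ∀ t, 0 ≤ S.errNorm t (z t) := fun t => Real.sqrt_nonneg _
    have hE : Tendsto (fun t => S.errNorm t (z t)) atTop (𝓝 0) := by
      have h1 : Tendsto (fun t : ℝ => -lam * (t - t₀)) atTop atBot :=
        (tendsto_atTop_add_const_right _ (-t₀) tendsto_id).const_mul_atTop_of_neg
          (neg_lt_zero.2 hlam)
      have h2 : Tendsto (fun t => k * S.errNorm t₀ (z t₀) * Real.exp (-lam * (t - t₀))) atTop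
          (𝓝 0) := by
        simpa using (Real.tendsto_exp_atBot.comp h1).const_mul (k * S.errNorm t₀ (z t₀))
      refine tendsto_of_tendsto_of_tendsto_of_le_of_le' tendsto_const_nhds h2
        (Eventually.of_forall hE0) ?_
      filter_upwards [eventually_ge_atTop t₀] with t ht
      exact hdec J t₀ z hz t (hJ ▸ ht)
    -- the distance to the path point is the norm of the path-following errors
    have hdist : ∀ t, ((z t).x - S.xp (z t).θ) ^ 2 + ((z t).y - S.yp (z t).θ) ^ 2
        ≤ S.errNorm t (z t) ^ 2 := by
      intro t
      have h1 : S.xbp (z t) ^ 2 + S.ybp (z t) ^ 2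
          = ((z t).x - S.xp (z t).θ) ^ 2 + ((z t).y - S.yp (z t).θ) ^ 2 := by
        have hsc := Real.sin_sq_add_cos_sq (S.γ (z t).θ)
        simp only [Setup.xbp, Setup.ybp]
        linear_combination (((z t).x - S.xp (z t).θ) ^ 2 + ((z t).y - S.yp (z t).θ) ^ 2) * hsc
      rw [Setup.errNorm_sq, Setup.errSq_eq, ← h1]
      linarith [sq_nonneg (S.ψerr t (z t)), sq_nonneg (S.rerr t (z t)), S.obsSq_nonneg t (z t)]
    refine ⟨hJ, ⟨B, fun t ht => ?_⟩, ?_, ?_, hE⟩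
    · obtain ⟨h1, h2, h3, -⟩ := hB J t₀ z hz t (hJ ▸ ht)
      exact ⟨h1, h2, h3⟩
    · refine squeeze_zero_norm (fun t => ?_) hE
      exact abs_le_of_sq_le_sq (by linarith [hdist t, sq_nonneg ((z t).y - S.yp (z t).θ)]) (hE0 t)
    · refine squeeze_zero_norm (fun t => ?_) hE
      exact abs_le_of_sq_le_sq (by linarith [hdist t, sq_nonneg ((z t).x - S.xp (z t).θ)]) (hE0 t)
  · intro R hR ε hε
    obtain ⟨ρ', k, lam, hρ', hk, hlam, h⟩ := hexp R hR
    refine ⟨min ρ' (ε / k), lt_min hρ' (by positivity), ?_⟩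
    intro t₀ ht₀ z hz hCr hv he t ht
    have h1 := h t₀ ht₀ z hz hCr hv (he.trans_le (min_le_left _ _)) t ht
    have h2 : Real.exp (-lam * (t - t₀)) ≤ 1 := Real.exp_le_one_iff.2 (by nlinarith)
    have hE0 : 0 ≤ S.errNorm t₀ (z t₀) := Real.sqrt_nonneg _
    calc _ ≤ _ := h1
      _ ≤ k * S.errNorm t₀ (z t₀) := mul_le_of_le_one_right (by positivity) h2
      _ < k * (ε / k) := mul_lt_mul_of_pos_left (he.trans_le (min_le_right _ _)) hk
      _ = ε := mul_div_cancel₀ ε hk.ne'
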